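/- Let $n\ge 1$. A bitstring is read as a lattice path, a bit $1$ being a step up and a bit $0$ a step down; its height is the number of $1$s minus the number of $0$s. Level $k$ of the $N$-cube consists of the bitstrings of length $N$ with exactly $k$ ones. Let $D_{N,k}$ be the set of those bitstrings of level $k$ in which every prefix contains at least as many $1$s as $0$s, $D^{=0}_{N,k}\subseteq D_{N,k}$ the subset of strings with equality for at least one non-empty prefix, $D=\bigcup_k D_{2k,k}$ (including the empty string $()$), and $D^{=0}=\bigcup_{N,k}D^{=0}_{N,k}$. *Lexical matchings.* For $x$ in level $k$ of the $N$-cube let $x^{\uparrow}$ be the path obtained from $x$ by appending down-steps until it ends at height $-1$ (nothing is appended if $x$ already ends at height $\le -1$). Scan the down-steps of $x^{\uparrow}$ row by row from top to bottom, and from right to left in each row, numbering them $0,1,2,\dots$. If the $i$th down-step belongs to $x$, flip it to obtain the partner of $x$ in level $k+1$; otherwise $x$ is unmatched. This gives the $i$-lexical matching $M^i_{N,k}$ between levels $k$ and $k+1$. *The cycle factor.* Let $\mathcal P=M^n_{2n+1,n+1}\cup M^{n+1}_{2n+1,n+1}$. Let $F$ (resp. $L$, $I$) be the set of vertices of level $n+1$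 of the $(2n+1)$-cube covered by $M^n_{2n+1,n+1}$ and not by $M^{n+1}_{2n+1,n+1}$ (resp. by the latter and not by the former, resp. by neither), and let $L'$ be the set of $x\in L$ of the form $x=(u,0,1,v)$ with $u\in D$, $v\in D^{=0}$. Writing $M[X]$ for the edges of $M$ incident with a vertex of $X$, put $$E=M^n_{2n+1,n}[F\cup(L\setminus L')\cup I]\ \cup\ M^{n-1}_{2n+1,n}[I]\ \cup\ M^{n-2}_{2n+1,n}[L'],\qquad \mathcal C_{2n+1}=\mathcal P\cup f(\mathcal P)\cup E,$$ where $f$ reverses and complements bitstrings. ($L'=\emptyset$ for $n=1$.) *Rooted trees and $\rho$.* Let $\mathcal T_{n+1}$ be the set of strings $(y,0)$ with $y\in D^{=0}_{2n+1,n+1}$; via the standard Catalan bijection these are the ordered rooted trees with $n+1$ edges whose root has degree at least two. With $u,v_1,v_2,v_3\in D$, let $\rho$ be given by $$(1,u,0,1,v_3,0)\mapsto(u,1,1,v_3,0,0),\qquad (1,u,0,v_1,1,v_2,0,1,v_3,0)\mapsto(u,1,1,v_1,0,v_2,1,v_3,0,0)$$ if $u\ne()$, and $$(1,0,1,v_3,0)\mapsto(1,0,v_3,1,0),\qquad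 (1,0,v_1,1,v_2,0,1,v_3,0)\mapsto(1,1,v_1,0,v_2,0,v_3,1,0).$$ *Trivalent trees.* A plane trivalent tree is a finite tree in which every vertex has degree $1$ or $3$ (internal vertices being those of degree $3$), together with a cyclic ordering of the neighbours of each vertex, considered up to isomorphisms preserving these orderings. A rooted trivalent tree is one with a chosen root and a chosen leftmost child of the root; the children of the root are ordered by the cyclic ordering starting from the leftmost child, the children of any other vertex by the cyclic ordering starting after its parent. Moving the root to its leftmost child makes the old root the rightmost child of the new root; the rotation of a trivalent tree rooted at an internal vertex repeats this move, at least once, until the root is again an internal vertex. *The map $\tau$.* Define binary trees $\ell(x),r(x)$ for $x\in D$: both are a single vertex if $x=()$; $\ell((1,u,0,v))$ has a root with left child $\ell(u)$ and right child $r(v)$; $r((u,1,v,0))$ has a root with left child $\ell(u)$ and right child $r(v)$ ($u,v\in D$). Each $x'\in\mathcal T_{n+1}$ is uniquely $(1,u,0,v,1,w,0)$ with $u,v,w\in D$; let $\tau(x')$ be the trivalent tree whose root has left child $\ell(u)$, middle child $r(v)$ and right child $r(w)$. **Lemma.** Let $n\ge1$. The graph $\mathcal C_{2n+1}$ is a cycle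 factor of the subgraph of the $(2n+1)$-cube induced by the middle four levels $n-1,\dots,n+2$, i.e. a subgraph that is the union of its cycles, every vertex of the four levels lying on exactly one of them. There is a bijection $\Phi$ between the cycles of $\mathcal C_{2n+1}$ and the plane trivalent trees with $n$ internal vertices. More precisely, $\rho$ is a well-defined permutation of $\mathcal T_{n+1}$; $\tau$ is a bijection from $\mathcal T_{n+1}$ to the trivalent trees with $n$ internal vertices rooted at an internal vertex (up to isomorphism); for every $x'\in\mathcal T_{n+1}$ the tree $\tau(\rho(x'))$ is the rotation of $\tau(x')$; and if a cycle $C$ contains the vertex $x$, where $(x,0)\in\mathcal T_{n+1}$, then $\Phi(C)$ is the plane trivalent tree obtained from $\tau((x,0))$ by forgetting the root. -/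

import Mathlib

namespace FourLevels

/-! ### Bitstrings and lattice paths

Bitstrings are lists of booleans; `true` is the bit 1 (an upstep), `false` is the bit 0 (a
downstep). -/

/-- The height of the end point of the lattice path of `x`: number of 1s minus number of 0s. -/
def height (x : List Bool) : ℤ := (x.count true : ℤ) - (x.count false : ℤ)

/-- `L_{n,k}`: the bitstrings of length `n` with exactly `k` ones. -/
def levelSet (n k : ℕ) : Set (List Bool) := {x | x.length = n ∧ x.count true = k}

/-- `D_{n,k}`: in every prefix there are at least as many 1s as 0s. -/
def dyckSet (n k : ℕ) : Set (List Bool) :=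
  {x | x ∈ levelSet n k ∧ ∀ p, p <+: x → p.count false ≤ p.count true}

/-- `D_{n,k}^{=0}`: equality holds for at least one non-empty prefix. -/
def dyckZero (n k : ℕ) : Set (List Bool) :=
  {x | x ∈ dyckSet n k ∧ ∃ p, p <+: x ∧ p ≠ [] ∧ p.count false = p.count true}

/-- `D`, the union of all `D_{2k,k}`: the Dyck words. -/
def dyckWords : Set (List Bool) := ⋃ k : ℕ, dyckSet (2 * k) k

/-- `D^{=0}`, the union of all `D_{n,k}^{=0}`. -/
def dyckZeroAll : Set (List Bool) := ⋃ n : ℕ, ⋃ k : ℕ, dyckZero n k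

/-- Complement and reverse a bitstring (the automorphism `f` of the cube). -/
def compRev (x : List Bool) : List Bool := (x.map not).reverse

/-! ### Lexical matchings -/

/-- `x^↑`: append downsteps until the path ends at height `-1`; nothing is appended if the path
already ends at height `-1` or below. -/
def upExt (x : List Bool) : List Bool := x ++ List.replicate (height x + 1).toNat false

/-- For a downstep of the path `z` at (0-based) position `a`, the number of downsteps scanned
before it, when the downsteps of `z` are scanned row-wise from top to bottom and from right to left
in each row. The row of a downstep is given by the height of its starting point. -/
def downRank (z : List Bool) (a : ℕ) : ℕ :=
  ((Finset.range z.length).filter fun b =>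
    z[b]? = some false ∧
      (height (z.take a) < height (z.take b) ∨
        (height (z.take b) = height (z.take a) ∧ a < b))).card

/-- The `i`-lexical matching `M_{n,k}^i` between the levels `k` and `k+1` of the `n`-cube, as a
relation: `x` in level `k` is matched to `y` if `y` arises from `x` by flipping the downstep of
`x^↑` with number `i` in the scanning order (starting from 0), and this downstep is part of `x`. -/
def lexMatch (n k : ℕ) (i : ℤ) (x y : List Bool) : Prop :=
  x ∈ levelSet n k ∧
    ∃ p s : List Bool, x = p ++ false :: s ∧ y = p ++ true :: s ∧
      (downRank (upExt x) p.length : ℤ) = i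

/-! ### The cycle factor -/

/-- The edge set `𝒫` between the levels `n+1` and `n+2`, the union of the `n`-lexical and the
`(n+1)`-lexical matchings (`x` in level `n+1`, `y` in level `n+2`). -/
def pathEdge (n : ℕ) (x y : List Bool) : Prop :=
  lexMatch (2 * n + 1) (n + 1) n x y ∨ lexMatch (2 * n + 1) (n + 1) (n + 1) x y

/-- `x` is covered by the matching `M_{2n+1,n+1}^i` (for `x` in the lower level `n+1`). -/
def coveredBy (n : ℕ) (i : ℤ) (x : List Bool) : Prop :=
  ∃ y, lexMatch (2 * n + 1) (n + 1) i x y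

/-- `F(𝒫)`: the first vertices of the paths. -/
def firstVerts (n : ℕ) : Set (List Bool) :=
  {x | x ∈ levelSet (2 * n + 1) (n + 1) ∧ coveredBy n n x ∧ ¬ coveredBy n (n + 1) x}

/-- `L(𝒫)`: the last vertices of the paths. -/
def lastVerts (n : ℕ) : Set (List Bool) :=
  {x | x ∈ levelSet (2 * n + 1) (n + 1) ∧ coveredBy n (n + 1) x ∧ ¬ coveredBy n n x}

/-- `I(𝒫)`: the isolated vertices. -/
def isolatedVerts (n : ℕ) : Set (List Bool) :=
  {x | x ∈ levelSet (2 * n + 1) (n + 1) ∧ ¬ coveredBy n n x ∧ ¬ coveredBy n (n + 1) x}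

/-- `L'(𝒫)`: the `x ∈ L(𝒫)` of the form `(u,0,1,v)` with `u ∈ D` and `v ∈ D^{=0}`. -/
def lastVerts' (n : ℕ) : Set (List Bool) :=
  {x | x ∈ lastVerts n ∧
    ∃ u v : List Bool, u ∈ dyckWords ∧ v ∈ dyckZeroAll ∧ x = u ++ [false, true] ++ v}

/-- The edge set `E = E^n ∪ E^{n-1} ∪ E^{n-2}` between the levels `n` and `n+1` (`x` in level `n`,
`y` in level `n+1`). -/
def middleEdge (n : ℕ) (x y : List Bool) : Prop :=
  (lexMatch (2 * n + 1) n n x y ∧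
    y ∈ firstVerts n ∪ (lastVerts n \ lastVerts' n) ∪ isolatedVerts n) ∨
  (lexMatch (2 * n + 1) n ((n : ℤ) - 1) x y ∧ y ∈ isolatedVerts n) ∨
  (lexMatch (2 * n + 1) n ((n : ℤ) - 2) x y ∧ y ∈ lastVerts' n)

/-- The vertices of the middle four levels `n-1, n, n+1, n+2` of the `(2n+1)`-cube. -/
abbrev MidVertex (n : ℕ) : Type :=
  {x : List Bool // x.length = 2 * n + 1 ∧ n ≤ x.count true + 1 ∧ x.count true ≤ n + 2}

/-- The subgraph of the `(2n+1)`-cube induced by the middle four levels: two bitstrings are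
adjacent if they differ in exactly one bit. -/
def midGraph (n : ℕ) : SimpleGraph (MidVertex n) :=
  SimpleGraph.fromRel fun x y =>
    ∃ (p s : List Bool) (b : Bool), x.1 = p ++ b :: s ∧ y.1 = p ++ (!b) :: s

/-- The graph `𝒞_{2n+1}` with edge set `𝒫 ∪ f(𝒫) ∪ E` on the middle four levels. Each set of edges
is given by its edges from the lower to the upper level; as `f` exchanges the two, `(x, y)`
is in `f(𝒫)` iff `(f y, f x)` is in `𝒫`. -/
def cycleFactor (n : ℕ) : SimpleGraph (MidVertex n) :=
  SimpleGraph.fromRel fun x y =>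
    pathEdge n x.1 y.1 ∨ pathEdge n (compRev y.1) (compRev x.1) ∨ middleEdge n x.1 y.1

/-- The cycles of a graph, as subgraphs. -/
abbrev CyclesOf {V : Type} (G : SimpleGraph V) : Type :=
  {S : G.Subgraph // ∃ (v : V) (w : G.Walk v v), w.IsCycle ∧ w.toSubgraph = S}

/-- `G` is a cycle factor of `H`: a subgraph of `H` that is the union of its cycles, every vertex
being on exactly one of them. -/
def IsCycleFactor {V : Type} (G H : SimpleGraph V) : Prop :=
  G ≤ H ∧ (∀ v : V, ∃! S : CyclesOf G, v ∈ S.1.verts) ∧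
    ∀ v w : V, G.Adj v w → ∃ S : CyclesOf G, S.1.Adj v w

/-! ### The rooted trees `𝒯_{n+1}` and the map `ρ` -/

/-- `𝒯_{n+1} = D_{2n+1,n+1}^{=0} ∘ 0`. -/
abbrev DyckTree (n : ℕ) : Type :=
  {x : List Bool // ∃ y ∈ dyckZero (2 * n + 1) (n + 1), x = y ++ [false]}

/-- The rotation map `ρ` as a relation between bitstrings: a heavy rotation if the leftmost child
of the root is not a leaf (`u ≠ []`), a light rotation if it is a leaf. -/
inductive Rho : List Bool → List Bool → Prop
  | heavy₁ {u v₃ : List Bool} (hu : u ∈ dyckWords) (hne : u ≠ []) (h₃ : v₃ ∈ dyckWords) :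
      Rho ([true] ++ u ++ [false] ++ [true] ++ v₃ ++ [false])
        (u ++ [true, true] ++ v₃ ++ [false, false])
  | heavy₂ {u v₁ v₂ v₃ : List Bool} (hu : u ∈ dyckWords) (hne : u ≠ [])
      (h₁ : v₁ ∈ dyckWords) (h₂ : v₂ ∈ dyckWords) (h₃ : v₃ ∈ dyckWords) :
      Rho ([true] ++ u ++ [false] ++ (v₁ ++ [true] ++ v₂ ++ [false]) ++ [true] ++ v₃ ++ [false])
        (u ++ [true, true] ++ v₁ ++ [false] ++ v₂ ++ [true] ++ v₃ ++ [false, false])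
  | light₁ {v₃ : List Bool} (h₃ : v₃ ∈ dyckWords) :
      Rho ([true, false] ++ [true] ++ v₃ ++ [false])
        ([true, false] ++ v₃ ++ [true, false])
  | light₂ {v₁ v₂ v₃ : List Bool}
      (h₁ : v₁ ∈ dyckWords) (h₂ : v₂ ∈ dyckWords) (h₃ : v₃ ∈ dyckWords) :
      Rho ([true, false] ++ (v₁ ++ [true] ++ v₂ ++ [false]) ++ [true] ++ v₃ ++ [false])
        ([true, true] ++ v₁ ++ [false] ++ v₂ ++ [false] ++ v₃ ++ [true, false])

/-! ### Plane trivalent trees -/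

/-- A plane trivalent tree: a finite tree in which every vertex has degree 1 or 3, with a cyclic
ordering of the neighbours of each vertex `v`, given by the permutation `next v` that sends each
neighbour to the following one. -/
structure PlaneTree where
  V : Type
  finite : Finite V
  graph : SimpleGraph V
  isTree : graph.IsTree
  degree_eq : ∀ v, (graph.neighborSet v).ncard = 1 ∨ (graph.neighborSet v).ncard = 3
  next : ∀ v, Equiv.Perm (graph.neighborSet v)
  next_cyclic : ∀ v, (next v).IsCycleOn Set.univ

/-- A vertex is internal if its degree is 3. -/
def PlaneTree.Internal (T : PlaneTree) (v : T.V) : Prop := (T.graph.neighborSet v).ncard = 3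

/-- The number of internal vertices. -/
noncomputable def PlaneTree.numInternal (T : PlaneTree) : ℕ := {v | T.Internal v}.ncard

/-- An isomorphism of plane trees: a graph isomorphism that preserves the cyclic orderings. -/
def PlaneTree.IsIso (T T' : PlaneTree) (e : T.graph ≃g T'.graph) : Prop :=
  ∀ v (w : T.graph.neighborSet v),
    e.mapNeighborSet v (T.next v w) = T'.next (e v) (e.mapNeighborSet v w)

theorem PlaneTree.next_congr (T : PlaneTree) {v v' : T.V} (h : v = v')
    (w : T.graph.neighborSet v) (w' : T.graph.neighborSet v') (hw : w.1 = w'.1) :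
    (T.next v w).1 = (T.next v' w').1 := by
  subst h
  rw [Subtype.ext hw]

theorem PlaneTree.isIso_refl (T : PlaneTree) : T.IsIso T (SimpleGraph.Iso.refl) := by
  intro v w
  rfl

theorem PlaneTree.isIso_symm {T T' : PlaneTree} {e : T.graph ≃g T'.graph} (h : T.IsIso T' e) :
    T'.IsIso T e.symm := by
  intro v w
  apply Subtype.ext
  have h1 := congrArg Subtype.val (h (e.symm v) (e.symm.mapNeighborSet v w))
  have h2 := T'.next_congr (e.apply_symm_apply v)
    (e.mapNeighborSet (e.symm v) (e.symm.mapNeighborSet v w)) w (e.apply_symm_apply w.1)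
  rw [h2] at h1
  change e.symm (T'.next v w).1 = _
  rw [← h1]
  exact e.symm_apply_apply _

theorem PlaneTree.isIso_trans {T T' T'' : PlaneTree} {e : T.graph ≃g T'.graph}
    {e' : T'.graph ≃g T''.graph} (h : T.IsIso T' e) (h' : T'.IsIso T'' e') :
    T.IsIso T'' (e.trans e') := by
  intro v w
  apply Subtype.ext
  have h1 := congrArg Subtype.val (h' (e v) (e.mapNeighborSet v w))
  rw [← h v w] at h1
  exact h1

/-- Plane trivalent trees with `n` internal vertices, up to isomorphism. -/
def planeSetoid (n : ℕ) : Setoid {T : PlaneTree // T.numInternal = n} where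
  r T T' := ∃ e, T.1.IsIso T'.1 e
  iseqv :=
    { refl := fun T => ⟨_, T.1.isIso_refl⟩
      symm := fun ⟨_, h⟩ => ⟨_, PlaneTree.isIso_symm h⟩
      trans := fun ⟨_, h⟩ ⟨_, h'⟩ => ⟨_, PlaneTree.isIso_trans h h'⟩ }

/-- The set of plane trivalent trees with `n` internal vertices. -/
abbrev PlaneTrivalent (n : ℕ) : Type 1 := Quotient (planeSetoid n)

/-! ### Rooted trivalent trees -/

/-- A plane trivalent tree with a root and a leftmost child of the root. The children of the root
are ordered from left to right by the cyclic ordering, starting from `first`; the children of a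
non-root vertex are ordered by the cyclic ordering, starting after its parent. -/
structure RootedTree extends PlaneTree where
  root : V
  first : graph.neighborSet root

/-- An isomorphism of rooted trivalent trees also preserves the root and its leftmost child. -/
def RootedTree.IsIso (R R' : RootedTree) (e : R.graph ≃g R'.graph) : Prop :=
  R.toPlaneTree.IsIso R'.toPlaneTree e ∧ e R.root = R'.root ∧ e R.first.1 = R'.first.1

/-- The trivalent trees with `n` internal vertices that are rooted at an internal vertex. -/
abbrev InternallyRooted (n : ℕ) : Type 1 :=
  {R : RootedTree // R.Internal R.root ∧ R.numInternal = n}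

/-- Isomorphism of rooted trivalent trees. -/
def rootedSetoid (n : ℕ) : Setoid (InternallyRooted n) where
  r R R' := ∃ e, R.1.IsIso R'.1 e
  iseqv :=
    { refl := fun R => ⟨_, R.1.isIso_refl, rfl, rfl⟩
      symm := fun ⟨e, h, h₁, h₂⟩ => ⟨_, PlaneTree.isIso_symm h,
        by rw [← h₁]; exact e.symm_apply_apply _, by rw [← h₂]; exact e.symm_apply_apply _⟩
      trans := fun ⟨e, h, h₁, h₂⟩ ⟨e', h', h₁', h₂'⟩ => ⟨_, PlaneTree.isIso_trans h h',
        by rw [← h₁', ← h₁]; rfl, by rw [← h₂', ← h₂]; rfl⟩ }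

/-- The set of trivalent trees with `n` internal vertices rooted at an internal vertex. -/
abbrev RootedTrivalent (n : ℕ) : Type 1 := Quotient (rootedSetoid n)

/-- Forget the root. -/
def InternallyRooted.unroot {n : ℕ} (R : InternallyRooted n) :
    {T : PlaneTree // T.numInternal = n} :=
  ⟨R.1.toPlaneTree, R.2.2⟩

/-- Left-rotation: move the root to the leftmost child of the root. The old root becomes the
rightmost child of the new root, so the new leftmost child is the neighbour following the old
root. -/
def RootedTree.leftRotate (R : RootedTree) : RootedTree where
  toPlaneTree := R.toPlaneTree
  root := R.first.1
  first := R.next R.first.1 ⟨R.root, R.first.2.symm⟩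

/-- `R'` arises from `R` by repeatedly moving the root to the leftmost child (at least once), until
the root is again an internal vertex. -/
def RootedTree.RotatesTo (R R' : RootedTree) : Prop :=
  ∃ k : ℕ, 1 ≤ k ∧ RootedTree.leftRotate^[k] R = R' ∧ R'.Internal R'.root ∧
    ∀ j : ℕ, 1 ≤ j → j < k →
      ¬ (RootedTree.leftRotate^[j] R).Internal (RootedTree.leftRotate^[j] R).root

/-! ### The bijection `τ` -/

/-- Binary trees: a single vertex, or a root with a left and a right child. -/
inductive BinTree : Type
  | leaf : BinTree
  | node : BinTree → BinTree → BinTree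

mutual

/-- `IsEll x t` means `ℓ(x) = t`: `ℓ(())` is a single vertex, and for `x = (1,u,0,v)` with
`u, v ∈ D` the root of `ℓ(x)` has left child `ℓ(u)` and right child `r(v)`. -/
inductive IsEll : List Bool → BinTree → Prop
  | nil : IsEll [] BinTree.leaf
  | node {u v : List Bool} {a b : BinTree} (hu : u ∈ dyckWords) (hv : v ∈ dyckWords)
      (ha : IsEll u a) (hb : IsAr v b) :
      IsEll ([true] ++ u ++ [false] ++ v) (BinTree.node a b)

/-- `IsAr x t` means `r(x) = t`: `r(())` is a single vertex, and for `x = (u,1,v,0)` with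
`u, v ∈ D` the root of `r(x)` has left child `ℓ(u)` and right child `r(v)`. -/
inductive IsAr : List Bool → BinTree → Prop
  | nil : IsAr [] BinTree.leaf
  | node {u v : List Bool} {a b : BinTree} (hu : u ∈ dyckWords) (hv : v ∈ dyckWords)
      (ha : IsEll u a) (hb : IsAr v b) :
      IsAr (u ++ [true] ++ v ++ [false]) (BinTree.node a b)

end

/-- `T.IsBranch p v t`: the part of `T` hanging off the neighbour `v` of `p`, viewed as a rooted
tree with root `v` below its parent `p`, is the binary tree `t`. -/
inductive PlaneTree.IsBranch (T : PlaneTree) : T.V → T.V → BinTree → Prop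
  | leaf {p v : T.V} (h : T.graph.Adj v p) (hv : (T.graph.neighborSet v).ncard = 1) :
      T.IsBranch p v BinTree.leaf
  | node {p v : T.V} {s t : BinTree} (h : T.graph.Adj v p) (hv : T.Internal v)
      (hs : T.IsBranch v (T.next v ⟨p, h⟩).1 s)
      (ht : T.IsBranch v (T.next v (T.next v ⟨p, h⟩)).1 t) :
      T.IsBranch p v (BinTree.node s t)

/-- `R` consists of an internal root with left child `a`, middle child `b` and right child `c`. -/
def RootedTree.HasShape (R : RootedTree) (a b c : BinTree) : Prop :=
  R.Internal R.root ∧ R.IsBranch R.root R.first.1 a ∧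
    R.IsBranch R.root (R.next R.root R.first).1 b ∧
    R.IsBranch R.root (R.next R.root (R.next R.root R.first)).1 c

/-- `R` is (a copy of) the tree `τ(x)`: for `x = (1,u,0,v,1,w,0)` with `u, v, w ∈ D` the root of
`τ(x)` has left child `ℓ(u)`, middle child `r(v)` and right child `r(w)`. -/
def IsTau (x : List Bool) (R : RootedTree) : Prop :=
  ∃ (u v w : List Bool) (a b c : BinTree),
    u ∈ dyckWords ∧ v ∈ dyckWords ∧ w ∈ dyckWords ∧
    x = [true] ++ u ++ [false] ++ v ++ [true] ++ w ++ [false] ∧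
    IsEll u a ∧ IsAr v b ∧ IsAr w c ∧ R.HasShape a b c

end FourLevels

open FourLevels

namespace FourLevels

/-! ### Heights and counting downsteps -/

-- Everything is expressed through Dyck words. A vertex of level n+1 is X 1 w with X of height zero
-- and w in D; a vertex of level n+2 is Z 1 w with Z of height two. Counting the downsteps scanned
-- after the flipped one (`corank`) instead of those scanned before it removes n from the matchings:
-- those in 𝒫 flip coranks 1 and 0, those in E flip coranks 0, 1 and 2. All partners then become
-- explicit. Along a path of 𝒫 only X (or Z) changes; F consists of the X 1 w with X a non-empty
-- Dyck word, L of those with X = u 0 1 v, and I of those with X empty. The edges of E are U 0 w — U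
-- 1 w, v' 0 — 1 v and u 0 v' 0 1 w — u 0 1 v 1 w, where v' is obtained from v by c 1 d 0 ↦ 1 c 0 d
-- (`BinTree.shift`).
--
-- This list is invariant under f, so it is enough to see that vertices of the two upper levels have
-- degree two (`exists_pair_linked`). A finite two-regular graph is the disjoint union of its
-- cycles, and the cycles are its components.
--
-- To identify the components, attach to U 1 w the pair (ℓ(U), r(w)), read as two binary trees whose
-- roots are joined by an edge, that is, a plane trivalent tree with a marked oriented edge. The
-- paths of 𝒫 and f(𝒫) and the edges U 0 w — U 1 w keep the pair; each other edge of E moves the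
-- mark one step along the face (`faceStep`). So the orbit of the pair is constant on components
-- (`hasClass_iff_of_reachable`), and every step along the face is realized in the graph
-- (`joined_of_faceStep`). A plane tree has just one face, so the pairs of branches at the oriented
-- edges of a trivalent tree form a single orbit, and this orbit determines the tree
-- (`PlaneTree.exists_isIso_iff`). Cycles and plane trees are therefore classified by the same
-- orbits.
--
-- For the rooted statements, (1,u,0,v,1,w,0) is the triple (u,v,w), a rooted trivalent tree is the
-- triple of branches at its root, and τ applies ℓ, r, r to the entries. As r(v) = ℓ(v'), the maps ρ
-- and rotation are conjugate under τ (`tauTriple_rhoTriple`).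

@[simp] theorem height_nil : height [] = 0 := by simp [height]

@[simp] theorem height_true_cons (l : List Bool) : height (true :: l) = height l + 1 := by
  simp [height]; ring

@[simp] theorem height_false_cons (l : List Bool) : height (false :: l) = height l - 1 := by
  simp [height]; ring

@[simp] theorem height_append (l r : List Bool) : height (l ++ r) = height l + height r := by
  simp [height]; ring

theorem height_add_length (l : List Bool) : height l + l.length = 2 * l.count true := by
  induction l with
  | nil => simp
  | cons b l ih => cases b <;> simp <;> linarith

/-- The number of downsteps of the path `l` that start at height at most `c`. -/
def lowDowns : ℤ → List Bool → ℕ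
  | _, [] => 0
  | c, true :: l => lowDowns (c - 1) l
  | c, false :: l => (if 0 ≤ c then 1 else 0) + lowDowns (c + 1) l

@[simp] theorem lowDowns_nil (c : ℤ) : lowDowns c [] = 0 := rfl

@[simp] theorem lowDowns_true (c : ℤ) (l : List Bool) :
    lowDowns c (true :: l) = lowDowns (c - 1) l := rfl

@[simp] theorem lowDowns_false (c : ℤ) (l : List Bool) :
    lowDowns c (false :: l) = (if 0 ≤ c then 1 else 0) + lowDowns (c + 1) l := rfl

theorem lowDowns_append (c : ℤ) (l r : List Bool) :
    lowDowns c (l ++ r) = lowDowns c l + lowDowns (c - height l) r := by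
  induction l generalizing c with
  | nil => simp
  | cons b l ih =>
    cases b
    · simp [ih, add_assoc, show c + 1 - height l = c - (height l - 1) by ring]
    · simp [ih, show c - 1 - height l = c - (height l + 1) by ring]

theorem lowDowns_mono (l : List Bool) {c d : ℤ} (h : c ≤ d) : lowDowns c l ≤ lowDowns d l := by
  induction l generalizing c d with
  | nil => simp
  | cons b l ih =>
    cases b
    · have := ih (show c + 1 ≤ d + 1 by linarith)
      simp only [lowDowns_false]
      split_ifs <;> omega
    · exact ih (by linarith)

/-- A path that ends below the height `j ≤ 0` has a downstep starting at height `j`. -/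
theorem lowDowns_lt_of_height_lt (l : List Bool) {j : ℤ} (hj : j ≤ 0) (h : height l < j) :
    lowDowns (j - 1) l < lowDowns j l := by
  induction l generalizing j with
  | nil => simp at h; omega
  | cons b l ih =>
    cases b
    · simp only [height_false_cons] at h
      simp only [lowDowns_false]
      -- For `j = 0` the first downstep is itself the one looked for; for `j < 0` it starts above
      -- `j` and the tail supplies one.
      rcases eq_or_lt_of_le hj with rfl | hj'
      · have := lowDowns_mono l (show (0 : ℤ) - 1 + 1 ≤ 0 + 1 by norm_num)
        simp at this ⊢; omega
      · have := ih (show j + 1 ≤ 0 by omega) (by omega)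
        rw [show j + 1 - 1 = j - 1 + 1 by ring] at this
        rw [if_neg (by omega), if_neg (by omega)]; omega
    · simp only [height_true_cons] at h
      simpa using ih (show j - 1 ≤ 0 by omega) (by omega)

theorem lowDowns_eq_zero_iff (l : List Bool) {c : ℤ} (hc : c ≤ 0) :
    lowDowns c l = 0 ↔ ∀ p, p <+: l → c ≤ height p := by
  induction l generalizing c with
  | nil => simp [hc]
  | cons b l ih =>
    cases b
    · simp only [lowDowns_false, List.prefix_cons_iff]
      constructor
      · intro h p hp
        have hc' : ¬ 0 ≤ c := fun h0 => by simp [h0] at h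
        rcases hp with rfl | ⟨t, rfl, ht⟩
        · simpa using hc
        · have := (ih (c := c + 1) (by omega)).1 (by omega) t ht
          simp; omega
      · intro h
        have h1 := h [false] (Or.inr ⟨[], rfl, List.nil_prefix⟩)
        simp at h1
        rw [if_neg (by omega), (ih (c := c + 1) (by omega)).2]
        intro p hp
        have := h (false :: p) (Or.inr ⟨p, rfl, hp⟩)
        simp at this; omega
    · simp only [lowDowns_true, List.prefix_cons_iff]
      rw [ih (by omega)]
      constructor
      · rintro h p (rfl | ⟨t, rfl, ht⟩)
        · simpa using hc
        · have := h t ht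
          simp; omega
      · intro h p hp
        have := h (true :: p) (Or.inr ⟨p, rfl, hp⟩)
        simp at this; omega

/-! ### Complementing and reversing -/

@[simp] theorem compRev_nil : compRev [] = [] := rfl

@[simp] theorem compRev_append (l r : List Bool) : compRev (l ++ r) = compRev r ++ compRev l := by
  simp [compRev]

theorem compRev_cons (b : Bool) (l : List Bool) : compRev (b :: l) = compRev l ++ [!b] := by
  simp [compRev]

@[simp] theorem compRev_compRev (l : List Bool) : compRev (compRev l) = l := by
  simp [compRev, List.map_reverse, Function.comp_def]

@[simp] theorem length_compRev (l : List Bool) : (compRev l).length = l.length := by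
  simp [compRev]

@[simp] theorem height_compRev (l : List Bool) : height (compRev l) = -height l := by
  induction l with
  | nil => simp
  | cons b l ih => cases b <;> simp [compRev_cons, ih] <;> ring

/-! ### Binary trees as Dyck words -/

namespace BinTree

/-- The number of inner nodes. -/
def size : BinTree → ℕ
  | leaf => 0
  | node a b => a.size + b.size + 1

/-- The Dyck word of a binary tree. -/
def word : BinTree → List Bool
  | leaf => []
  | node a b => true :: (a.word ++ false :: b.word)

/-- The tree of the concatenation of two Dyck words. -/
def app : BinTree → BinTree → BinTree
  | leaf, t => t
  | node a b, t => node a (b.app t)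

/-- The tree of the Dyck word `(c,1,d,0)`. -/
def snoc (c d : BinTree) : BinTree := c.app (node d leaf)

/-- The tree of the complemented and reversed Dyck word. -/
def mirror : BinTree → BinTree
  | leaf => leaf
  | node a b => b.mirror.snoc a.mirror

/-- The map `(c,1,d,0) ↦ (1,c,0,d)` on Dyck words. -/
def shift : BinTree → BinTree
  | leaf => leaf
  | node a b =>
    match b.shift with
    | leaf => node leaf a
    | node c d => node (node a c) d

@[simp] theorem size_leaf : leaf.size = 0 := rfl
@[simp] theorem size_node (a b : BinTree) : (node a b).size = a.size + b.size + 1 := rfl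
@[simp] theorem word_leaf : leaf.word = [] := rfl
@[simp] theorem word_node (a b : BinTree) :
    (node a b).word = true :: (a.word ++ false :: b.word) := rfl
@[simp] theorem leaf_app (t : BinTree) : leaf.app t = t := rfl
@[simp] theorem node_app (a b t : BinTree) : (node a b).app t = node a (b.app t) := rfl
@[simp] theorem leaf_snoc (d : BinTree) : leaf.snoc d = node d leaf := rfl
@[simp] theorem node_snoc (a b d : BinTree) : (node a b).snoc d = node a (b.snoc d) := rfl
@[simp] theorem mirror_leaf : leaf.mirror = leaf := rfl
@[simp] theorem mirror_node (a b : BinTree) : (node a b).mirror = b.mirror.snoc a.mirror := rfl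
@[simp] theorem shift_leaf : leaf.shift = leaf := rfl

@[simp] theorem app_leaf (t : BinTree) : t.app leaf = t := by
  induction t with
  | leaf => rfl
  | node a b _ ih => simp [ih]

theorem app_assoc (a b c : BinTree) : (a.app b).app c = a.app (b.app c) := by
  induction a with
  | leaf => rfl
  | node x y _ ih => simp [ih]

@[simp] theorem snoc_app (c d t : BinTree) : (c.snoc d).app t = c.app (node d t) := by
  simp [snoc, app_assoc]

@[simp] theorem size_app (a b : BinTree) : (a.app b).size = a.size + b.size := by
  induction a with
  | leaf => simp
  | node x y _ ih => simp [ih]; omega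

@[simp] theorem size_snoc (a b : BinTree) : (a.snoc b).size = a.size + b.size + 1 := by
  simp [snoc, add_assoc]

@[simp] theorem word_app (a b : BinTree) : (a.app b).word = a.word ++ b.word := by
  induction a with
  | leaf => rfl
  | node x y _ ih => simp [ih]

@[simp] theorem word_snoc (c d : BinTree) :
    (c.snoc d).word = c.word ++ true :: (d.word ++ [false]) := by
  simp [snoc]

/-- A non-empty Dyck word can be split before its last component (c,1,d,0) as well as after its
first one. This is the case distinction for everything that involves `shift` or `ar`. -/
theorem eq_leaf_or_snoc (t : BinTree) : t = leaf ∨ ∃ c d : BinTree, t = c.snoc d := by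
  induction t with
  | leaf => exact Or.inl rfl
  | node a b _ ih =>
    right
    rcases ih with rfl | ⟨c, d, rfl⟩
    · exact ⟨leaf, a, rfl⟩
    · exact ⟨node a c, d, rfl⟩

@[simp] theorem shift_snoc (c d : BinTree) : (c.snoc d).shift = node c d := by
  induction c with
  | leaf => rfl
  | node a b _ ih => simp [shift, ih]

@[simp] theorem snoc_ne_leaf (c d : BinTree) : c.snoc d ≠ leaf := by
  cases c <;> simp

@[simp] theorem size_shift (t : BinTree) : t.shift.size = t.size := by
  rcases t.eq_leaf_or_snoc with rfl | ⟨c, d, rfl⟩ <;> simp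

theorem shift_injective : Function.Injective shift := by
  intro s t h
  rcases s.eq_leaf_or_snoc with rfl | ⟨c, d, rfl⟩ <;>
    rcases t.eq_leaf_or_snoc with rfl | ⟨c', d', rfl⟩ <;> simp_all

theorem shift_surjective : Function.Surjective shift
  | leaf => ⟨leaf, rfl⟩
  | node c d => ⟨c.snoc d, shift_snoc c d⟩

@[simp] theorem mirror_snoc (c d : BinTree) : (c.snoc d).mirror = node d.mirror c.mirror := by
  induction c with
  | leaf => rfl
  | node a b _ ih => simp [ih]

@[simp] theorem mirror_mirror (t : BinTree) : t.mirror.mirror = t := by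
  induction t with
  | leaf => rfl
  | node a b iha ihb => simp [iha, ihb]

@[simp] theorem size_mirror (t : BinTree) : t.mirror.size = t.size := by
  induction t with
  | leaf => rfl
  | node a b iha ihb => simp [iha, ihb]; omega

@[simp] theorem compRev_word (t : BinTree) : compRev t.word = t.mirror.word := by
  induction t with
  | leaf => rfl
  | node a b iha ihb => simp [compRev_cons, iha, ihb]

@[simp] theorem height_word (t : BinTree) : height t.word = 0 := by
  induction t with
  | leaf => simp
  | node a b iha ihb => simp [iha, ihb]

@[simp] theorem length_word (t : BinTree) : t.word.length = 2 * t.size := by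
  induction t with
  | leaf => simp
  | node a b iha ihb => simp [iha, ihb]; omega

/-- All downsteps of a Dyck word start at positive height. Hence Dyck factors lying at or above the
height of the flipped step contribute nothing to a corank, and coranks are read off from the
separating letters. -/
theorem lowDowns_word (t : BinTree) {c : ℤ} (hc : c ≤ 0) : lowDowns c t.word = 0 := by
  induction t generalizing c with
  | leaf => simp
  | node a b iha ihb =>
    simp [lowDowns_append, iha (show c - 1 ≤ 0 by omega), ihb hc]
    omega

/-- The map `ℓ`, as a map from the trees of Dyck words to binary trees. -/
def ell : BinTree → BinTree
  | leaf => leaf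
  | node u v => node u.ell v.shift.ell
termination_by t => t.size
decreasing_by all_goals (simp only [size_node, size_shift]; omega)

/-- The map `r`, as a map from the trees of Dyck words to binary trees. -/
def ar (t : BinTree) : BinTree := t.shift.ell

@[simp] theorem ell_leaf : leaf.ell = leaf := by rw [ell]
@[simp] theorem ell_node (u v : BinTree) : (node u v).ell = node u.ell v.ar := by rw [ell, ar]
@[simp] theorem ar_leaf : leaf.ar = leaf := by simp [ar]
@[simp] theorem ar_snoc (u v : BinTree) : (u.snoc v).ar = node u.ell v.ar := by simp [ar]

theorem size_ell (t : BinTree) : t.ell.size = t.size := by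
  induction h : t.size using Nat.strong_induction_on generalizing t with
  | _ k ih =>
    cases t with
    | leaf => simpa using h
    | node u v =>
      simp at h
      have h1 := ih u.size (by omega) u rfl
      have h2 := ih v.shift.size (by simp; omega) v.shift rfl
      simp [ar, h1, h2, h]

@[simp] theorem size_ar (t : BinTree) : t.ar.size = t.size := by simp [ar, size_ell]

/-- The recursion of `ell` passes through `shift`, which preserves size but not the subtree order;
hence induction on size. -/
theorem ell_injective : Function.Injective ell := by
  intro s
  induction h : s.size using Nat.strong_induction_on generalizing s with
  | _ k ih =>
    intro t hst
    cases s with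
    | leaf => cases t <;> simp_all
    | node u v =>
      cases t with
      | leaf => simp at hst
      | node u' v' =>
        simp at h hst
        rw [ih u.size (by omega) rfl hst.1,
          shift_injective (ih v.shift.size (by simp; omega) rfl hst.2)]

theorem ell_surjective : Function.Surjective ell := by
  intro t
  induction t with
  | leaf => exact ⟨leaf, by simp⟩
  | node a b iha ihb =>
    obtain ⟨u, rfl⟩ := iha
    obtain ⟨v, rfl⟩ := ihb
    obtain ⟨v, rfl⟩ := shift_surjective v
    exact ⟨node u v, by simp [ar]⟩

theorem ar_injective : Function.Injective ar := fun _ _ h => shift_injective (ell_injective h)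

theorem ar_surjective : Function.Surjective ar := ell_surjective.comp shift_surjective

/-! ### Parsing -/

/-- Cut at the first step below height zero. -/
theorem exists_eq_word_append_false (l : List Bool) (h : height l < 0) :
    ∃ (u : BinTree) (r : List Bool), l = u.word ++ false :: r := by
  induction hk : l.length using Nat.strong_induction_on generalizing l with
  | _ k ih =>
    rcases l with _ | ⟨_ | _, l⟩
    · simp at h
    · exact ⟨leaf, l, rfl⟩
    -- After an up-step the remainder has height below -1, so it can be cut twice: at its return to
    -- the starting height, and again where the path goes below it.
    · simp at h hk
      obtain ⟨a, r, rfl⟩ := ih _ (by omega) l (by omega) rfl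
      simp at h hk
      obtain ⟨b, r, rfl⟩ := ih _ (by omega) r (by omega) rfl
      exact ⟨node a b, r, by simp⟩

theorem exists_eq_append_true_word (l : List Bool) (h : 0 < height l) :
    ∃ (r : List Bool) (w : BinTree), l = r ++ true :: w.word := by
  obtain ⟨u, r, hr⟩ := exists_eq_word_append_false (compRev l) (by simpa using h)
  refine ⟨compRev r, u.mirror, ?_⟩
  rw [← compRev_compRev l, hr]
  simp [compRev_cons]

/-- A remainder that does not begin with an up-step makes the word the longest Dyck prefix, so
parsing is unambiguous. -/
theorem word_append_inj {u u' : BinTree} {r r' : List Bool} (hr : ∀ l, r ≠ true :: l)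
    (hr' : ∀ l, r' ≠ true :: l) (h : u.word ++ r = u'.word ++ r') : u = u' ∧ r = r' := by
  induction u generalizing u' r r' with
  | leaf =>
    cases u' with
    | leaf => exact ⟨rfl, h⟩
    | node a' b' => exact absurd h (hr _)
  | node a b iha ihb =>
    cases u' with
    | leaf => exact absurd h.symm (hr' _)
    | node a' b' =>
      simp at h
      obtain ⟨rfl, h1⟩ := iha (by simp) (by simp) h
      simp at h1
      obtain ⟨rfl, h2⟩ := ihb hr hr' h1
      exact ⟨rfl, h2⟩

theorem word_injective : Function.Injective word := by
  intro u u' h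
  exact (word_append_inj (r := []) (r' := []) (by simp) (by simp) (by simpa using h)).1

theorem word_append_false_inj {u u' : BinTree} {r r' : List Bool}
    (h : u.word ++ false :: r = u'.word ++ false :: r') : u = u' ∧ r = r' := by
  have := word_append_inj (by simp) (by simp) h
  simpa using this

theorem word_ne_word_append_false (u u' : BinTree) (r : List Bool) :
    u.word ≠ u'.word ++ false :: r := by
  intro h
  have := (word_append_inj (u := u) (u' := u') (r := []) (r' := false :: r) (by simp) (by simp)
    (by simpa using h)).2
  simp at this

theorem append_true_word_inj {w w' : BinTree} {r r' : List Bool}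
    (h : r ++ true :: w.word = r' ++ true :: w'.word) : r = r' ∧ w = w' := by
  have h1 := congrArg compRev h
  simp [compRev_cons] at h1
  obtain ⟨h2, h3⟩ := word_append_false_inj h1
  have h4 := congrArg compRev h3
  have h5 := congrArg mirror h2
  simp at h4 h5
  exact ⟨h4, h5⟩

end BinTree

/-! ### Dyck words -/

theorem mem_levelSet_iff {l : List Bool} {n k : ℕ} :
    l ∈ levelSet n k ↔ l.length = n ∧ height l = 2 * k - n := by
  have := height_add_length l
  simp only [levelSet, Set.mem_ofPred_eq]
  constructor
  · rintro ⟨rfl, rfl⟩; exact ⟨rfl, by omega⟩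
  · rintro ⟨rfl, h⟩; exact ⟨rfl, by omega⟩

theorem mem_dyckSet_iff {l : List Bool} {n k : ℕ} :
    l ∈ dyckSet n k ↔ l.length = n ∧ height l = 2 * k - n ∧ lowDowns 0 l = 0 := by
  simp only [dyckSet, Set.mem_ofPred_eq, mem_levelSet_iff, lowDowns_eq_zero_iff l le_rfl, and_assoc]
  simp [height]

theorem mem_dyckWords_iff {l : List Bool} : l ∈ dyckWords ↔ ∃ t : BinTree, l = t.word := by
  simp only [dyckWords, Set.mem_iUnion, mem_dyckSet_iff]
  constructor
  · rintro ⟨k, h1, h2, h3⟩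
    -- The appended downstep makes the path end at -1. If the cut came before this last step, `l`
    -- itself would contain a downstep starting at height zero.
    obtain ⟨u, r, hr⟩ := BinTree.exists_eq_word_append_false (l ++ [false]) (by
      simp; push_cast at h2; omega)
    rcases r.eq_nil_or_concat with rfl | ⟨r, b, rfl⟩
    · exact ⟨u, by simpa using hr⟩
    · simp only [List.concat_eq_append, ← List.cons_append, ← List.append_assoc] at hr
      obtain ⟨rfl, -⟩ := List.append_inj' hr rfl
      simp [lowDowns_append] at h3
  · rintro ⟨t, rfl⟩
    exact ⟨t.size, by simp, by simp, t.lowDowns_word le_rfl⟩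

@[simp] theorem BinTree.word_mem_dyckWords (t : BinTree) : t.word ∈ dyckWords :=
  mem_dyckWords_iff.2 ⟨t, rfl⟩

/-- The words of height one in `D^{=0}`. -/
theorem mem_dyckZero_iff {l : List Bool} {n k : ℕ} (hl : height l = 1) :
    l ∈ dyckZero n k ↔ l.length = n ∧ 2 * k = n + 1 ∧
      ∃ a b w : BinTree, l = (BinTree.node a b).word ++ true :: w.word := by
  simp only [dyckZero, Set.mem_ofPred_eq, mem_dyckSet_iff]
  constructor
  · rintro ⟨⟨h1, h2, h3⟩, p, hp, hne, hc⟩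
    refine ⟨h1, by omega, ?_⟩
    obtain ⟨r, w, rfl⟩ := BinTree.exists_eq_append_true_word l (by omega)
    simp [lowDowns_append] at hl h3
    obtain ⟨u, rfl⟩ := mem_dyckWords_iff.1 (show r ∈ dyckWords from
      Set.mem_iUnion.2 ⟨r.count true, mem_dyckSet_iff.2 ⟨by
        have := height_add_length r; omega, by push_cast; omega, h3.1⟩⟩)
    cases u with
    | node a b => exact ⟨a, b, w, rfl⟩
    | leaf =>
      -- With an empty first factor the path is an up-step followed by a Dyck word, so no non-empty
      -- prefix returns to height zero.
      exfalso
      simp [List.prefix_cons_iff, hne] at hp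
      obtain ⟨t, rfl, ht⟩ := hp
      have h4 := (lowDowns_eq_zero_iff _ le_rfl).1 (w.lowDowns_word le_rfl) t ht
      simp [height] at hc h4
      omega
  · rintro ⟨h1, h2, a, b, w, rfl⟩
    refine ⟨⟨h1, by omega, ?_⟩, (BinTree.node a b).word, List.prefix_append _ _, by simp, ?_⟩
    · rw [lowDowns_append, BinTree.lowDowns_word _ le_rfl, lowDowns_true,
        BinTree.lowDowns_word _ (by simp)]
    · have := (BinTree.node a b).height_word
      simp only [height] at this
      omega

/-! ### Ranks of downsteps -/

/-- The number of downsteps of the path `(p,0,s)` that are scanned after the downstep between `p`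
and `s`. -/
def corank (p s : List Bool) : ℕ := lowDowns (height p) p + lowDowns 0 s

/-- Downsteps start either above `c` or at height at most `c`. This links the position-indexed count
in `downRank` with the recursive count `lowDowns`. -/
theorem sum_highDowns_add_lowDowns (c : ℤ) (l : List Bool) :
    (∑ b ∈ Finset.range l.length, if l[b]? = some false ∧ c < height (l.take b) then 1 else 0) +
      lowDowns c l = l.count false := by
  induction l generalizing c with
  | nil => simp
  | cons x l ih =>
    rw [List.length_cons, Finset.sum_range_succ']
    cases x
    · have := ih (c + 1)
      simp only [List.getElem?_cons_succ, List.take_succ_cons, height_false_cons, lowDowns_false,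
        List.count_cons_self, List.getElem?_cons_zero, List.take_zero, height_nil, true_and,
        lt_sub_iff_add_lt]
      split_ifs <;> omega
    · have := ih (c - 1)
      simp [sub_lt_iff_lt_add] at this ⊢
      omega

/-- Every downstep other than the chosen one is scanned either before or after it. A step to the
left comes before iff it starts strictly higher; a step to the right comes before iff it starts at
least as high, which is one above the start of `s`. -/
theorem downRank_add_corank (p s : List Bool) :
    downRank (p ++ false :: s) p.length + corank p s + 1 = (p ++ false :: s).count false := by
  have h1 := sum_highDowns_add_lowDowns (height p) p
  have h2 := sum_highDowns_add_lowDowns 0 s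
  rw [downRank, Finset.card_filter, List.length_append, List.length_cons, Finset.sum_range_add,
    Finset.sum_range_succ', corank]
  have e0 : (p ++ false :: s).take p.length = p := List.take_left
  simp only [e0]
  have hp : ∀ b ∈ Finset.range p.length,
      (if (p ++ false :: s)[b]? = some false ∧ (height p < height ((p ++ false :: s).take b) ∨
        height ((p ++ false :: s).take b) = height p ∧ p.length < b) then 1 else 0) =
      if p[b]? = some false ∧ height p < height (p.take b) then 1 else 0 := by
    intro b hb
    rw [Finset.mem_range] at hb
    have e1 : (p ++ false :: s)[b]? = p[b]? := List.getElem?_append_left hb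
    have e2 : (p ++ false :: s).take b = p.take b := List.take_append_of_le_length hb.le
    rw [e1, e2]
    congr 1
    simp only [eq_iff_iff]
    apply and_congr_right
    intro _
    constructor
    · rintro (h | h) <;> omega
    · exact Or.inl
  have hs : ∀ b ∈ Finset.range s.length,
      (if (p ++ false :: s)[p.length + (b + 1)]? = some false ∧
        (height p < height ((p ++ false :: s).take (p.length + (b + 1))) ∨
        height ((p ++ false :: s).take (p.length + (b + 1))) = height p ∧
          p.length < p.length + (b + 1)) then 1 else 0) =
      if s[b]? = some false ∧ 0 < height (s.take b) then 1 else 0 := by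
    intro b _
    have e1 : (p ++ false :: s)[p.length + (b + 1)]? = s[b]? := by
      rw [List.getElem?_append_right (by omega)]; simp
    have e2 : (p ++ false :: s).take (p.length + (b + 1)) = p ++ false :: s.take b := by
      rw [List.take_length_add_append, List.take_succ_cons]
    rw [e1, e2]
    congr 1
    simp only [height_append, height_false_cons, eq_iff_iff]
    apply and_congr_right
    intro _
    constructor
    · rintro (h | h) <;> omega
    · intro h
      -- Relative height 1 in `s` is the row of the chosen step; anything larger is a higher row.
      by_cases h' : height (s.take b) = 1
      · right; omega
      · left; omega
  rw [Finset.sum_congr rfl hp, Finset.sum_congr rfl hs]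
  simp only [Nat.add_zero, lt_self_iff_false, and_false, or_self, if_false, e0,
    List.count_append, List.count_cons_self]
  omega

/-- `y` arises from `x` by flipping a downstep of corank `c` in the path `(x,t)`. -/
def Flip (c : ℕ) (t x y : List Bool) : Prop :=
  ∃ p s : List Bool, x = p ++ false :: s ∧ y = p ++ true :: s ∧ corank p (s ++ t) = c

theorem Flip.length_eq {c : ℕ} {t x y : List Bool} (h : Flip c t x y) : y.length = x.length := by
  obtain ⟨p, s, rfl, rfl, -⟩ := h; simp

theorem Flip.height_eq {c : ℕ} {t x y : List Bool} (h : Flip c t x y) :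
    height y = height x + 2 := by
  obtain ⟨p, s, rfl, rfl, -⟩ := h; simp; ring

/-- A path of height 1 gets two downsteps appended, and then has n+2 of them, so rank i means corank
n+1-i. -/
theorem lexMatch_upper_iff {n : ℕ} (c : ℕ) {i : ℤ} (hi : i = n + 1 - c) {x y : List Bool} :
    lexMatch (2 * n + 1) (n + 1) i x y ↔
      x.length = 2 * n + 1 ∧ height x = 1 ∧ Flip c [false, false] x y := by
  rw [lexMatch, mem_levelSet_iff, and_assoc,
    show (2 * ((n + 1 : ℕ) : ℤ) - ((2 * n + 1 : ℕ) : ℤ)) = 1 by push_cast; ring]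
  apply and_congr_right; intro hl
  apply and_congr_right; intro hh
  apply exists_congr; intro p
  apply exists_congr; intro s
  apply and_congr_right; rintro rfl
  apply and_congr_right; intro _
  have h1 := downRank_add_corank p (s ++ [false, false])
  have h2 : upExt (p ++ false :: s) = p ++ false :: (s ++ [false, false]) := by
    rw [upExt, hh]; simp
  have h3 := height_add_length (p ++ false :: s)
  have h4 : (p ++ false :: s).count true + (p ++ false :: s).count false =
      (p ++ false :: s).length := by
    simp only [height] at hh; simp only [height] at h3; omega
  simp at h1 h4 hl hh h3
  rw [h2]
  omega

/-- A path of height -1 is not extended and has n+1 downsteps, so rank i means corank n-i. -/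
theorem lexMatch_lower_iff {n : ℕ} (c : ℕ) {i : ℤ} (hi : i = n - c) {x y : List Bool} :
    lexMatch (2 * n + 1) n i x y ↔
      x.length = 2 * n + 1 ∧ height x = -1 ∧ Flip c [] x y := by
  rw [lexMatch, mem_levelSet_iff, and_assoc,
    show (2 * (n : ℤ) - ((2 * n + 1 : ℕ) : ℤ)) = -1 by push_cast; ring]
  apply and_congr_right; intro hl
  apply and_congr_right; intro hh
  apply exists_congr; intro p
  apply exists_congr; intro s
  apply and_congr_right; rintro rfl
  apply and_congr_right; intro _
  have h1 := downRank_add_corank p s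
  have h2 : upExt (p ++ false :: s) = p ++ false :: s := by
    rw [upExt, hh]; simp
  have h3 := height_add_length (p ++ false :: s)
  have h4 : (p ++ false :: s).count true + (p ++ false :: s).count false =
      (p ++ false :: s).length := by
    simp only [height] at hh; simp only [height] at h3; omega
  simp at h1 h4 hl hh h3
  rw [h2, List.append_nil]
  omega

/-- Two factorizations of a list around the letter `b` agree or one of them is to the left. -/
theorem append_cons_cases {b : Bool} {p s p' s' : List Bool}
    (h : p ++ b :: s = p' ++ b :: s') :
    (p = p' ∧ s = s') ∨ (∃ q, p' = p ++ b :: q ∧ s = q ++ b :: s') ∨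
      (∃ q, p = p' ++ b :: q ∧ s' = q ++ b :: s) := by
  rcases List.append_eq_append_iff.1 h with ⟨q, rfl, h2⟩ | ⟨q, rfl, h2⟩
  · rcases q with _ | ⟨x, q⟩
    · simp at h2; exact Or.inl ⟨by simp, h2⟩
    · simp at h2
      obtain ⟨rfl, rfl⟩ := h2
      exact Or.inr (Or.inl ⟨q, rfl, rfl⟩)
  · rcases q with _ | ⟨x, q⟩
    · simp at h2; exact Or.inl ⟨by simp, h2.symm⟩
    · simp at h2
      obtain ⟨rfl, rfl⟩ := h2
      exact Or.inr (Or.inr ⟨q, rfl, rfl⟩)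

/-- Compare two up-steps as candidates to be turned down. The one that starts higher, or the right
one in case of equal height, gets the strictly larger corank: some downstep is counted for it and
not for the other. Such a step is found in `q` if the second candidate starts lower, and in `s` or
`p` otherwise. -/
theorem corank_up_ne {p q s : List Bool} (h : height (p ++ true :: (q ++ true :: s)) = 1) :
    corank p (q ++ true :: s) ≠ corank (p ++ true :: q) s := by
  simp only [height_append, height_true_cons] at h
  simp only [corank, lowDowns_append, height_append, height_true_cons, lowDowns_true]
  rw [show height p + (height q + 1) - height p - 1 = height q by ring]
  rcases lt_or_ge (height q) 0 with hd | hd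
  · have h1 := lowDowns_mono p (show height p + (height q + 1) ≤ height p by omega)
    have h2 := lowDowns_lt_of_height_lt q le_rfl hd
    have h3 := lowDowns_mono q (show height q ≤ 0 - 1 by omega)
    have h4 := lowDowns_mono s (show 0 ≤ 0 - height q - 1 by omega)
    omega
  · have h1 := lowDowns_mono p (show height p ≤ height p + (height q + 1) by omega)
    have h3 := lowDowns_mono q hd
    have h4 := lowDowns_mono s (show 0 - height q - 1 ≤ 0 by omega)
    rcases lt_or_ge (height s) 0 with hs | hs
    · have h5 := lowDowns_lt_of_height_lt s le_rfl hs
      have h6 := lowDowns_mono s (show 0 - height q - 1 ≤ 0 - 1 by omega)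
      omega
    -- Only here is the total height 1 needed: if `s` does not descend, then `height p + 1 ≤ 0`, so
    -- `p` crosses from height `height p + 1` down to its end.
    · have h5 := lowDowns_lt_of_height_lt p (j := height p + 1) (by omega) (by omega)
      have h6 := lowDowns_mono p (show height p + 1 ≤ height p + (height q + 1) by omega)
      rw [show height p + 1 - 1 = height p by ring] at h5
      omega

/-- Of two downsteps exactly one is scanned after the other, and it is counted in the corank of the
other only. -/
theorem corank_down_ne {p q s : List Bool} :
    corank p (q ++ false :: s) ≠ corank (p ++ false :: q) s := by
  simp only [corank, lowDowns_append, height_append, height_false_cons, lowDowns_false]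
  rw [show height p + (height q - 1) - height p + 1 = height q by ring]
  rcases lt_or_ge 0 (height q) with hd | hd
  · have h1 := lowDowns_mono p (show height p ≤ height p + (height q - 1) by omega)
    have h3 := lowDowns_mono q hd.le
    have h4 := lowDowns_mono s (show 0 - height q + 1 ≤ 0 by omega)
    rw [if_neg (by omega), if_pos (by omega)]
    omega
  · have h1 := lowDowns_mono p (show height p + (height q - 1) ≤ height p by omega)
    have h3 := lowDowns_mono q hd
    have h4 := lowDowns_mono s (show 0 ≤ 0 - height q + 1 by omega)
    rw [if_pos (by omega), if_neg (by omega)]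
    omega

/-- Injectivity of the lexical matchings. The tail `t` is what `upExt` appends, so the height
condition covers both y of height 3 with two added downsteps and y of height 1 with none. -/
theorem Flip.left_unique {c : ℕ} {t x x' y : List Bool} (hy : height (y ++ t) = 1)
    (h : Flip c t x y) (h' : Flip c t x' y) : x = x' := by
  obtain ⟨p, s, rfl, rfl, hc⟩ := h
  obtain ⟨p', s', rfl, hy', hc'⟩ := h'
  rcases append_cons_cases hy' with ⟨rfl, rfl⟩ | ⟨q, rfl, rfl⟩ | ⟨q, rfl, rfl⟩
  · rfl
  · simp only [List.append_assoc, List.cons_append] at hy hc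
    exact absurd (hc.trans hc'.symm) (corank_up_ne hy)
  · simp only [List.append_assoc, List.cons_append] at hy hc'
    exact absurd (hc'.trans hc.symm) (corank_up_ne hy)

theorem Flip.right_unique {c : ℕ} {t x y y' : List Bool}
    (h : Flip c t x y) (h' : Flip c t x y') : y = y' := by
  obtain ⟨p, s, rfl, rfl, hc⟩ := h
  obtain ⟨p', s', hx, rfl, hc'⟩ := h'
  rcases append_cons_cases hx with ⟨rfl, rfl⟩ | ⟨q, rfl, rfl⟩ | ⟨q, rfl, rfl⟩
  · rfl
  · simp only [List.append_assoc, List.cons_append] at hc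
    exact absurd (hc.trans hc'.symm) corank_down_ne
  · simp only [List.append_assoc, List.cons_append] at hc'
    exact absurd (hc'.trans hc.symm) corank_down_ne

open FourLevels.BinTree (leaf node)

/-! ### Bridges -/

/-- Paths of height zero: a Dyck word `u`, or `(u,0,X,1,w)` with Dyck words `u`, `w` and a path `X`
of height zero. -/
inductive Bridge : Type
  | base : BinTree → Bridge
  | wrap : BinTree → Bridge → BinTree → Bridge

namespace Bridge

/-- The path of a bridge. -/
def word : Bridge → List Bool
  | base u => u.word
  | wrap u X w => u.word ++ false :: (X.word ++ true :: w.word)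

/-- The path `(X,1,w)` of height one. -/
def upper (X : Bridge) (w : BinTree) : List Bool := X.word ++ true :: w.word

/-- The path `(w,0,X)` of height minus one. -/
def lower (w : BinTree) (X : Bridge) : List Bool := w.word ++ false :: X.word

/-- The complemented and reversed bridge. -/
def mirror : Bridge → Bridge
  | base u => base u.mirror
  | wrap u X w => wrap w.mirror X.mirror u.mirror

/-- The Dyck word at the start of the path of lexical matching edges through `(X,1,w)`. -/
def source : Bridge → BinTree
  | base u => u
  | wrap u X w => node (u.app X.source) w

@[simp] theorem word_base (u : BinTree) : (base u).word = u.word := rfl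
@[simp] theorem word_wrap (u : BinTree) (X : Bridge) (w : BinTree) :
    (wrap u X w).word = u.word ++ false :: (X.word ++ true :: w.word) := rfl
@[simp] theorem mirror_base (u : BinTree) : (base u).mirror = base u.mirror := rfl
@[simp] theorem mirror_wrap (u : BinTree) (X : Bridge) (w : BinTree) :
    (wrap u X w).mirror = wrap w.mirror X.mirror u.mirror := rfl
@[simp] theorem source_base (u : BinTree) : (base u).source = u := rfl
@[simp] theorem source_wrap (u : BinTree) (X : Bridge) (w : BinTree) :
    (wrap u X w).source = node (u.app X.source) w := rfl

@[simp] theorem height_word (X : Bridge) : height X.word = 0 := by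
  induction X with
  | base u => simp
  | wrap u X w ih => simp [ih]

@[simp] theorem mirror_mirror (X : Bridge) : X.mirror.mirror = X := by
  induction X with
  | base u => simp
  | wrap u X w ih => simp [ih]

theorem compRev_word (X : Bridge) : compRev X.word = X.mirror.word := by
  induction X with
  | base u => simp
  | wrap u X w ih => simp [ih, compRev_cons]

theorem compRev_upper (X : Bridge) (w : BinTree) :
    compRev (upper X w) = lower w.mirror X.mirror := by
  simp [upper, lower, compRev_cons, compRev_word]

theorem compRev_lower (w : BinTree) (X : Bridge) :
    compRev (lower w X) = upper X.mirror w.mirror := by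
  simp [upper, lower, compRev_cons, compRev_word]

@[simp] theorem height_upper (X : Bridge) (w : BinTree) : height (upper X w) = 1 := by
  simp [upper]

@[simp] theorem height_lower (X : Bridge) (w : BinTree) : height (lower w X) = -1 := by
  simp [lower]

theorem word_injective : Function.Injective word := by
  intro X
  induction X with
  | base u =>
    intro Y h
    cases Y with
    | base u' => rw [BinTree.word_injective h]
    | wrap u' Y w' => exact absurd h (BinTree.word_ne_word_append_false _ _ _)
  | wrap u X w ih =>
    intro Y h
    cases Y with
    | base u' => exact absurd h.symm (BinTree.word_ne_word_append_false _ _ _)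
    | wrap u' Y w' =>
      obtain ⟨rfl, h1⟩ := BinTree.word_append_false_inj h
      obtain ⟨h2, rfl⟩ := BinTree.append_true_word_inj h1
      rw [ih h2]

theorem upper_inj {X X' : Bridge} {w w' : BinTree} :
    upper X w = upper X' w' ↔ X = X' ∧ w = w' := by
  constructor
  · intro h
    obtain ⟨h1, h2⟩ := BinTree.append_true_word_inj h
    exact ⟨word_injective h1, h2⟩
  · rintro ⟨rfl, rfl⟩; rfl

theorem lower_inj {X X' : Bridge} {w w' : BinTree} :
    lower w X = lower w' X' ↔ w = w' ∧ X = X' := by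
  constructor
  · intro h
    obtain ⟨h1, h2⟩ := BinTree.word_append_false_inj h
    exact ⟨h1, word_injective h2⟩
  · rintro ⟨rfl, rfl⟩; rfl

/-- Cut at the first step below zero and, in what follows it, at the last up-step reaching the final
height. If the path never goes below zero, the cut of `l ++ [false]` falls at its last step. -/
theorem exists_word_eq (l : List Bool) (h : height l = 0) : ∃ X : Bridge, l = X.word := by
  induction hk : l.length using Nat.strong_induction_on generalizing l with
  | _ k ih =>
    obtain ⟨u, r, hr⟩ := BinTree.exists_eq_word_append_false (l ++ [false]) (by simp [h])
    rcases r.eq_nil_or_concat with rfl | ⟨r, b, rfl⟩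
    · exact ⟨base u, by simpa using hr⟩
    · simp only [List.concat_eq_append, ← List.cons_append, ← List.append_assoc] at hr
      obtain ⟨rfl, -⟩ := List.append_inj' hr rfl
      simp at h hk
      obtain ⟨r, w, rfl⟩ := BinTree.exists_eq_append_true_word r (by omega)
      simp at h hk
      obtain ⟨X, rfl⟩ := ih _ (by omega) r h rfl
      exact ⟨wrap u X w, rfl⟩

theorem exists_upper_eq (l : List Bool) (h : height l = 1) : ∃ X w, l = upper X w := by
  obtain ⟨r, w, rfl⟩ := BinTree.exists_eq_append_true_word l (by omega)
  obtain ⟨X, rfl⟩ := exists_word_eq r (by simpa using h)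
  exact ⟨X, w, rfl⟩

theorem exists_lower_eq (l : List Bool) (h : height l = -1) : ∃ w X, l = lower w X := by
  obtain ⟨X, w, hX⟩ := exists_upper_eq (compRev l) (by simp [h])
  exact ⟨w.mirror, X.mirror, by rw [← compRev_upper, ← hX, compRev_compRev]⟩

end Bridge

open FourLevels.Bridge (base wrap upper lower)

-- Vertices of level n+2 and their two partners in 𝒫

/-- Paths of height two: `(a,1,b,1,c)` with Dyck words `a`, `b`, `c`, or `(u,0,Z,1,w)` with Dyck
words `u`, `w` and a path `Z` of height two. -/
inductive Rise : Type
  | base : BinTree → BinTree → BinTree → Rise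
  | wrap : BinTree → Rise → BinTree → Rise

namespace Rise

/-- The path of height two. -/
def word : Rise → List Bool
  | base a b c => a.word ++ true :: (b.word ++ true :: c.word)
  | wrap u Z w => u.word ++ false :: (Z.word ++ true :: w.word)

/-- The path `(Z,1,w)` of height three. -/
def top (Z : Rise) (w : BinTree) : List Bool := Z.word ++ true :: w.word

/-- The partner in the matching that flips the leftmost lowest downstep. -/
def low : Rise → Bridge
  | base a b c => .wrap a (.base b) c
  | wrap u Z w => .wrap u Z.low w

/-- The partner in the matching that flips the downstep scanned before the leftmost lowest one. -/
def next : Rise → Bridge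
  | base a b c =>
    match a.mirror with
    | .leaf => .base (node b c)
    | .node q p => .wrap p.mirror (.wrap q.mirror (.base leaf) b) c
  | wrap u Z w => .wrap u Z.next w

@[simp] theorem low_base (a b c : BinTree) : (base a b c).low = .wrap a (.base b) c := rfl
@[simp] theorem low_wrap (u : BinTree) (Z : Rise) (w : BinTree) :
    (wrap u Z w).low = .wrap u Z.low w := rfl
@[simp] theorem next_base_leaf (b c : BinTree) : (base leaf b c).next = .base (node b c) := rfl
@[simp] theorem next_base_snoc (p q b c : BinTree) :
    (base (p.snoc q) b c).next = .wrap p (.wrap q (.base leaf) b) c := by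
  simp [next]
@[simp] theorem next_wrap (u : BinTree) (Z : Rise) (w : BinTree) :
    (wrap u Z w).next = .wrap u Z.next w := rfl

/-- The word `source` does not change along a path of 𝒫, because the two edges at each vertex of
level n+2 preserve it. -/
theorem source_next (Z : Rise) : Z.next.source = Z.low.source := by
  induction Z with
  | base a b c => rcases a.eq_leaf_or_snoc with rfl | ⟨p, q, rfl⟩ <;> simp
  | wrap u Z w ih => simp [ih]

theorem next_ne_low (Z : Rise) : Z.next ≠ Z.low := by
  induction Z with
  | base a b c => rcases a.eq_leaf_or_snoc with rfl | ⟨p, q, rfl⟩ <;> simp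
  | wrap u Z w ih => simp [ih]

/-- A bridge that goes below zero has an innermost Dyck core; raising the downstep just before that
core gives the preimage. A Dyck word offers no such step. -/
theorem exists_low_eq_iff (X : Bridge) : (∃ Z : Rise, Z.low = X) ↔ ∀ u, X ≠ .base u := by
  constructor
  · rintro ⟨_ | _, rfl⟩ u <;> simp
  · intro h
    induction X with
    | base u => exact absurd rfl (h u)
    | wrap u X w ih =>
      cases X with
      | base b => exact ⟨base u b w, rfl⟩
      | wrap u' X w' =>
        obtain ⟨Z, hZ⟩ := ih (by simp)
        exact ⟨wrap u Z w, by simp [hZ]⟩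

/-- The preimage is again found at the core: a non-empty core has its first component opened, while
an empty core needs two nested wraps, which are merged. The excluded bridges have an empty core
inside at most one wrap. -/
theorem exists_next_eq_iff (X : Bridge) :
    (∃ Z : Rise, Z.next = X) ↔ X ≠ .base leaf ∧ ∀ u v, X ≠ .wrap u (.base leaf) v := by
  constructor
  · rintro ⟨Z, rfl⟩
    have key : ∀ Z : Rise, Z.next ≠ .base leaf := by
      rintro (⟨a, b, c⟩ | _)
      · rcases a.eq_leaf_or_snoc with rfl | ⟨p, q, rfl⟩ <;> simp
      · simp
    refine ⟨key Z, fun u v => ?_⟩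
    rcases Z with ⟨a, b, c⟩ | ⟨u', Z, w⟩
    · rcases a.eq_leaf_or_snoc with rfl | ⟨p, q, rfl⟩ <;> simp
    · simp [key Z]
  · rintro ⟨h1, h2⟩
    induction X with
    | base u =>
      cases u with
      | leaf => exact absurd rfl h1
      | node b c => exact ⟨base leaf b c, rfl⟩
    | wrap u X w ih =>
      by_cases hX : ∃ q b, X = .wrap q (.base leaf) b
      · obtain ⟨q, b, rfl⟩ := hX
        exact ⟨base (u.snoc q) b w, by simp⟩
      · push Not at hX
        obtain ⟨Z, hZ⟩ := ih (by rintro rfl; exact h2 _ _ rfl) hX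
        exact ⟨wrap u Z w, by simp [hZ]⟩

theorem exists_top_eq (l : List Bool) (h : height l = 3) : ∃ Z w, l = top Z w := by
  -- The two final up-steps are moved into the nesting: u 0 X 1 w 1 b 1 c is u 0 (X 1 w 1 b) 1 c.
  have key : ∀ (X : Bridge) (b c : BinTree), ∃ Z : Rise, upper X b ++ true :: c.word = Z.word := by
    intro X
    induction X with
    | base a => exact fun b c => ⟨base a b c, by simp [word, upper]⟩
    | wrap u X w ih =>
      intro b c
      obtain ⟨Z, hZ⟩ := ih w b
      exact ⟨wrap u Z c, by simp [word, upper, ← hZ]⟩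
  obtain ⟨r, w, rfl⟩ := BinTree.exists_eq_append_true_word l (by omega)
  simp at h
  obtain ⟨r, c, rfl⟩ := BinTree.exists_eq_append_true_word r (by omega)
  simp at h
  obtain ⟨X, b, rfl⟩ := Bridge.exists_upper_eq r (by omega)
  obtain ⟨Z, hZ⟩ := key X b c
  exact ⟨Z, w, by rw [top, ← hZ]⟩

/-- Both vanishing counts say that the flipped step is scanned last. The two height conditions are
carried along so that the induction can check that the surrounding u 0 … 1 w adds no downstep to the
count. -/
theorem flip_low (Z : Rise) : ∃ p s : List Bool, Z.low.word = p ++ false :: s ∧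
    Z.word = p ++ true :: s ∧ height p ≤ 0 ∧ lowDowns (height p) p = 0 ∧ lowDowns 0 s = 0 ∧
    height p + height s = 1 := by
  induction Z with
  | base a b c =>
    refine ⟨a.word, b.word ++ true :: c.word, by simp, by simp [word], by simp, ?_, ?_, by simp⟩
    · simpa using a.lowDowns_word le_rfl
    · simp [lowDowns_append, BinTree.lowDowns_word]
  | wrap u Z w ih =>
    obtain ⟨p, s, h1, h2, h3, h4, h5, h6⟩ := ih
    refine ⟨u.word ++ false :: p, s ++ true :: w.word, by simp [h1], by simp [word, h2],
      by simp; omega, ?_, ?_, by simp; omega⟩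
    · simp [lowDowns_append]
      exact ⟨BinTree.lowDowns_word _ (by omega), by omega, h4⟩
    · simp [lowDowns_append]
      exact ⟨h5, BinTree.lowDowns_word _ (by omega)⟩

/-- The count is 1, except when the flipped step starts at height 1. Then the missing downstep comes
from outside: the 0 of the next enclosing wrap, or, at the outermost level, the last of the two
downsteps appended by `upExt`. -/
theorem flip_next (Z : Rise) : ∃ p s : List Bool, Z.next.word = p ++ false :: s ∧
    Z.word = p ++ true :: s ∧ height p ≤ 1 ∧
    lowDowns (height p) p + lowDowns 0 s = (if height p = 1 then 0 else 1) ∧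
    height p + height s = 1 := by
  induction Z with
  | base a b c =>
    rcases a.eq_leaf_or_snoc with rfl | ⟨a, q, rfl⟩
    · refine ⟨true :: b.word, c.word, by simp, by simp [word], by simp, ?_, by simp⟩
      simp [BinTree.lowDowns_word]
    · refine ⟨a.word, q.word ++ false :: true :: (b.word ++ true :: c.word), by simp,
        by simp [word], by simp, ?_, by simp⟩
      simp [lowDowns_append, BinTree.lowDowns_word]
  | wrap u Z w ih =>
    obtain ⟨p, s, h1, h2, h3, h4, h6⟩ := ih
    refine ⟨u.word ++ false :: p, s ++ true :: w.word, by simp [h1], by simp [word, h2],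
      by simp; omega, ?_, by simp; omega⟩
    simp [lowDowns_append]
    rw [BinTree.lowDowns_word _ (by omega), BinTree.lowDowns_word _ (by omega)]
    split_ifs at * <;> omega

theorem flip_low_top (Z : Rise) (w : BinTree) :
    Flip 0 [false, false] (upper Z.low w) (Z.top w) := by
  obtain ⟨p, s, h1, h2, h3, h4, h5, h6⟩ := Z.flip_low
  refine ⟨p, s ++ true :: w.word, by simp [upper, h1], by simp [top, h2], ?_⟩
  simp [corank, lowDowns_append, h4, h5]
  exact ⟨BinTree.lowDowns_word _ (by omega), by omega, by omega⟩

theorem flip_next_top (Z : Rise) (w : BinTree) :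
    Flip 1 [false, false] (upper Z.next w) (Z.top w) := by
  obtain ⟨p, s, h1, h2, h3, h4, h6⟩ := Z.flip_next
  refine ⟨p, s ++ true :: w.word, by simp [upper, h1], by simp [top, h2], ?_⟩
  simp [corank, lowDowns_append]
  rw [BinTree.lowDowns_word _ (by omega)]
  split_ifs at * <;> omega

@[simp] theorem height_top (Z : Rise) (w : BinTree) : height (Z.top w) = 3 := by
  have := (Z.flip_low_top w).height_eq
  simpa using this

end Rise

/-! ### The edges of the cycle factor -/

theorem lexMatch_low_iff {n : ℕ} {x : List Bool} {Z : Rise} {w : BinTree} :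
    lexMatch (2 * n + 1) (n + 1) (n + 1) x (Z.top w) ↔
      x.length = 2 * n + 1 ∧ x = upper Z.low w := by
  rw [lexMatch_upper_iff 0 (by simp)]
  apply and_congr_right; intro hl
  constructor
  · exact fun h => h.2.left_unique (by simp) (Z.flip_low_top w)
  · rintro rfl; exact ⟨by simp, Z.flip_low_top w⟩

theorem lexMatch_next_iff {n : ℕ} {x : List Bool} {Z : Rise} {w : BinTree} :
    lexMatch (2 * n + 1) (n + 1) n x (Z.top w) ↔
      x.length = 2 * n + 1 ∧ x = upper Z.next w := by
  rw [lexMatch_upper_iff 1 (by simp)]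
  apply and_congr_right; intro hl
  constructor
  · exact fun h => h.2.left_unique (by simp) (Z.flip_next_top w)
  · rintro rfl; exact ⟨by simp, Z.flip_next_top w⟩

theorem lexMatch_upper_height {n : ℕ} {i : ℤ} {x y : List Bool}
    (h : lexMatch (2 * n + 1) (n + 1) i x y) :
    x.length = 2 * n + 1 ∧ y.length = 2 * n + 1 ∧ height x = 1 ∧ height y = 3 := by
  obtain ⟨h1, p, s, rfl, rfl, -⟩ := h
  rw [mem_levelSet_iff] at h1
  push_cast at h1
  simp at h1 ⊢
  omega

theorem lexMatch_lower_height {n : ℕ} {i : ℤ} {x y : List Bool}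
    (h : lexMatch (2 * n + 1) n i x y) :
    x.length = 2 * n + 1 ∧ y.length = 2 * n + 1 ∧ height x = -1 ∧ height y = 1 := by
  obtain ⟨h1, p, s, rfl, rfl, -⟩ := h
  rw [mem_levelSet_iff] at h1
  push_cast at h1
  simp at h1 ⊢
  omega

theorem pathEdge_height {n : ℕ} {x y : List Bool} (h : pathEdge n x y) :
    x.length = 2 * n + 1 ∧ y.length = 2 * n + 1 ∧ height x = 1 ∧ height y = 3 :=
  h.elim lexMatch_upper_height lexMatch_upper_height

theorem pathEdge_top_iff {n : ℕ} {x : List Bool} {Z : Rise} {w : BinTree} :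
    pathEdge n x (Z.top w) ↔
      x.length = 2 * n + 1 ∧ (x = upper Z.next w ∨ x = upper Z.low w) := by
  rw [pathEdge, lexMatch_low_iff, lexMatch_next_iff]
  tauto

theorem coveredBy_low_iff {n : ℕ} {X : Bridge} {w : BinTree}
    (hl : (upper X w).length = 2 * n + 1) :
    coveredBy n (n + 1) (upper X w) ↔ ∃ Z : Rise, Z.low = X := by
  constructor
  · rintro ⟨y, hy⟩
    obtain ⟨Z, w', rfl⟩ := Rise.exists_top_eq y (lexMatch_upper_height hy).2.2.2
    exact ⟨Z, (Bridge.upper_inj.1 (lexMatch_low_iff.1 hy).2).1.symm⟩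
  · rintro ⟨Z, rfl⟩
    exact ⟨Z.top w, lexMatch_low_iff.2 ⟨hl, rfl⟩⟩

theorem coveredBy_next_iff {n : ℕ} {X : Bridge} {w : BinTree}
    (hl : (upper X w).length = 2 * n + 1) :
    coveredBy n n (upper X w) ↔ ∃ Z : Rise, Z.next = X := by
  constructor
  · rintro ⟨y, hy⟩
    obtain ⟨Z, w', rfl⟩ := Rise.exists_top_eq y (lexMatch_upper_height hy).2.2.2
    exact ⟨Z, (Bridge.upper_inj.1 (lexMatch_next_iff.1 hy).2).1.symm⟩
  · rintro ⟨Z, rfl⟩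
    exact ⟨Z.top w, lexMatch_next_iff.2 ⟨hl, rfl⟩⟩

theorem mem_level_upper_iff {n : ℕ} {x : List Bool} :
    x ∈ levelSet (2 * n + 1) (n + 1) ↔
      x.length = 2 * n + 1 ∧ ∃ X w, x = upper X w := by
  rw [mem_levelSet_iff]
  apply and_congr_right; intro _
  push_cast
  constructor
  · intro h; exact Bridge.exists_upper_eq x (by omega)
  · rintro ⟨X, w, rfl⟩; simp; ring

/-- Not being a value of `low` forces X to be a Dyck word, and being a value of `next` forces it to
be non-empty. The sets L and I are found in the same way. -/
theorem mem_firstVerts_iff {n : ℕ} {x : List Bool} :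
    x ∈ firstVerts n ↔
      x.length = 2 * n + 1 ∧ ∃ a b w, x = upper (base (node a b)) w := by
  simp only [firstVerts, Set.mem_ofPred_eq, mem_level_upper_iff, and_assoc]
  apply and_congr_right; intro hl
  constructor
  · rintro ⟨⟨X, w, rfl⟩, h1, h2⟩
    rw [coveredBy_next_iff hl, Rise.exists_next_eq_iff] at h1
    rw [coveredBy_low_iff hl, Rise.exists_low_eq_iff] at h2
    push Not at h2
    obtain ⟨u, rfl⟩ := h2
    cases u with
    | leaf => exact absurd rfl h1.1
    | node a b => exact ⟨a, b, w, rfl⟩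
  · rintro ⟨a, b, w, rfl⟩
    rw [coveredBy_next_iff hl, Rise.exists_next_eq_iff, coveredBy_low_iff hl,
      Rise.exists_low_eq_iff]
    exact ⟨⟨_, _, rfl⟩, by simp, by simp⟩

theorem mem_lastVerts_iff {n : ℕ} {x : List Bool} :
    x ∈ lastVerts n ↔
      x.length = 2 * n + 1 ∧ ∃ u v w, x = upper (wrap u (base leaf) v) w := by
  simp only [lastVerts, Set.mem_ofPred_eq, mem_level_upper_iff, and_assoc]
  apply and_congr_right; intro hl
  constructor
  · rintro ⟨⟨X, w, rfl⟩, h1, h2⟩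
    rw [coveredBy_next_iff hl, Rise.exists_next_eq_iff] at h2
    rw [coveredBy_low_iff hl, Rise.exists_low_eq_iff] at h1
    push Not at h2
    obtain ⟨u, v, rfl⟩ := h2 (h1 _)
    exact ⟨u, v, w, rfl⟩
  · rintro ⟨u, v, w, rfl⟩
    rw [coveredBy_next_iff hl, Rise.exists_next_eq_iff, coveredBy_low_iff hl,
      Rise.exists_low_eq_iff]
    exact ⟨⟨_, _, rfl⟩, by simp, by simp⟩

theorem mem_isolatedVerts_iff {n : ℕ} {x : List Bool} :
    x ∈ isolatedVerts n ↔ x.length = 2 * n + 1 ∧ ∃ w, x = upper (base leaf) w := by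
  simp only [isolatedVerts, Set.mem_ofPred_eq, mem_level_upper_iff, and_assoc]
  apply and_congr_right; intro hl
  constructor
  · rintro ⟨⟨X, w, rfl⟩, h1, h2⟩
    rw [coveredBy_next_iff hl, Rise.exists_next_eq_iff] at h1
    rw [coveredBy_low_iff hl, Rise.exists_low_eq_iff] at h2
    push Not at h1 h2
    obtain ⟨u, rfl⟩ := h2
    by_cases hu : u = leaf
    · exact ⟨w, by rw [hu]⟩
    · simp [hu] at h1
  · rintro ⟨w, rfl⟩
    rw [coveredBy_next_iff hl, Rise.exists_next_eq_iff, coveredBy_low_iff hl,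
      Rise.exists_low_eq_iff]
    exact ⟨⟨_, _, rfl⟩, by simp, by simp⟩

/-- In u 0 1 v 1 w the factor required to lie in D^{=0} is v 1 w, which returns to height zero
exactly if v is non-empty. -/
theorem mem_lastVerts'_iff {n : ℕ} {x : List Bool} :
    x ∈ lastVerts' n ↔
      x.length = 2 * n + 1 ∧ ∃ u v w, v ≠ leaf ∧ x = upper (wrap u (base leaf) v) w := by
  simp only [lastVerts', Set.mem_ofPred_eq, mem_lastVerts_iff, and_assoc]
  apply and_congr_right; intro hl
  constructor
  · rintro ⟨⟨u, v, w, rfl⟩, u', v', hu, hv, hx⟩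
    refine ⟨u, v, w, ?_, rfl⟩
    rintro rfl
    obtain ⟨t, rfl⟩ := mem_dyckWords_iff.1 hu
    simp [upper] at hx
    have h1 := (BinTree.word_append_false_inj hx).2
    simp at h1
    subst h1
    simp only [dyckZeroAll, Set.mem_iUnion] at hv
    obtain ⟨n', k', hv⟩ := hv
    obtain ⟨-, -, a, b, w', h2⟩ := (mem_dyckZero_iff (by simp)).1 hv
    have := (BinTree.append_true_word_inj (r := []) h2).1
    simp at this
  · rintro ⟨u, v, w, hv, rfl⟩
    refine ⟨⟨u, v, w, rfl⟩, u.word, v.word ++ true :: w.word, by simp, ?_, by simp [upper]⟩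
    simp only [dyckZeroAll, Set.mem_iUnion]
    cases v with
    | leaf => exact absurd rfl hv
    | node a b =>
      refine ⟨_, (node a b).size + w.size + 1, (mem_dyckZero_iff (by simp)).2
        ⟨rfl, ?_, a, b, w, rfl⟩⟩
      simp
      ring

/-- The edges between the two middle levels, from height `-1` to height `1`. -/
inductive Middle : List Bool → List Bool → Prop
  | flat (U w : BinTree) : Middle (lower U (base w)) (upper (base U) w)
  | turn (v : BinTree) : Middle (lower v.shift (base leaf)) (upper (base leaf) v)
  | last (u v w : BinTree) :
      Middle (lower u (wrap v.shift (base leaf) w)) (upper (wrap u (base leaf) v) w)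

theorem Middle.height_eq {z y : List Bool} (h : Middle z y) : height z = -1 ∧ height y = 1 := by
  cases h <;> simp

theorem Middle.length_eq {z y : List Bool} (h : Middle z y) : y.length = z.length := by
  cases h <;> simp [upper, lower, add_assoc]

theorem flip_flat (U w : BinTree) : Flip 0 [] (lower U (base w)) (upper (base U) w) := by
  refine ⟨U.word, w.word, by simp [lower], by simp [upper], ?_⟩
  simp [corank, BinTree.lowDowns_word]

theorem flip_turn (c d : BinTree) :
    Flip 1 [] (lower (c.snoc d).shift (base leaf)) (upper (base leaf) (c.snoc d)) := by
  refine ⟨true :: c.word, d.word ++ [false], by simp [lower], by simp [upper], ?_⟩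
  simp [corank, lowDowns_append, BinTree.lowDowns_word]

theorem flip_last_leaf (u w : BinTree) :
    Flip 0 [] (lower u (wrap leaf (base leaf) w)) (upper (wrap u (base leaf) leaf) w) := by
  refine ⟨u.word ++ [false], true :: w.word, by simp [lower], by simp [upper], ?_⟩
  simp [corank, lowDowns_append, BinTree.lowDowns_word]

theorem flip_last_snoc (u c d w : BinTree) :
    Flip 2 [] (lower u (wrap (c.snoc d).shift (base leaf) w))
      (upper (wrap u (base leaf) (c.snoc d)) w) := by
  refine ⟨u.word ++ false :: true :: c.word, d.word ++ false :: true :: w.word,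
    by simp [lower], by simp [upper], ?_⟩
  simp [corank, lowDowns_append, BinTree.lowDowns_word]

/-- The distinction between L' and L \ L', with different matchings, is absorbed by `shift`: the
edge u 0 v' 0 1 w — u 0 1 v 1 w flips corank 0 for empty v and corank 2 otherwise. The assumption on
n excludes the isolated vertex with empty w, at which the edge `turn` would coincide with `flat`. -/
theorem middleEdge_iff {n : ℕ} (hn : 1 ≤ n) {z y : List Bool} :
    middleEdge n z y ↔ z.length = 2 * n + 1 ∧ Middle z y := by
  have e0 : (n : ℤ) = n - (0 : ℕ) := by simp
  have e1 : (n : ℤ) - 1 = n - (1 : ℕ) := by simp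
  have e2 : (n : ℤ) - 2 = n - (2 : ℕ) := by simp
  simp only [middleEdge, Set.mem_union, Set.mem_sdiff, mem_firstVerts_iff, mem_lastVerts_iff,
    mem_lastVerts'_iff, mem_isolatedVerts_iff, lexMatch_lower_iff 0 e0, lexMatch_lower_iff 1 e1,
    lexMatch_lower_iff 2 e2]
  constructor
  · rintro (⟨⟨hl, hh, hf⟩, (⟨-, a, b, w, rfl⟩ | ⟨⟨hl', u, v, w, rfl⟩, hv⟩) | ⟨-, w, rfl⟩⟩ |
      ⟨⟨hl, hh, hf⟩, hl', w, rfl⟩ | ⟨⟨hl, hh, hf⟩, -, u, v, w, hv, rfl⟩)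
    · refine ⟨hl, ?_⟩
      rw [hf.left_unique (by simp) (flip_flat _ _)]
      exact .flat _ _
    · have : v = leaf := by
        by_contra h
        exact hv ⟨hl', u, v, w, h, rfl⟩
      subst this
      refine ⟨hl, ?_⟩
      rw [hf.left_unique (by simp) (flip_last_leaf _ _)]
      exact .last u leaf w
    · refine ⟨hl, ?_⟩
      rw [hf.left_unique (by simp) (flip_flat _ _)]
      exact .flat _ _
    · refine ⟨hl, ?_⟩
      rcases w.eq_leaf_or_snoc with rfl | ⟨c, d, rfl⟩
      · simp [upper] at hl'; omega
      · rw [hf.left_unique (by simp) (flip_turn _ _)]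
        exact .turn _
    · refine ⟨hl, ?_⟩
      rcases v.eq_leaf_or_snoc with rfl | ⟨c, d, rfl⟩
      · exact absurd rfl hv
      · rw [hf.left_unique (by simp) (flip_last_snoc _ _ _ _)]
        exact .last _ _ _
  · rintro ⟨hl, h⟩
    have hl' := h.length_eq.trans hl
    have hh := h.height_eq.1
    cases h with
    | flat U w =>
      left
      refine ⟨⟨hl, hh, flip_flat _ _⟩, ?_⟩
      cases U with
      | leaf => exact Or.inr ⟨hl', w, rfl⟩
      | node a b => exact Or.inl (Or.inl ⟨hl', a, b, w, rfl⟩)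
    | turn v =>
      right; left
      rcases v.eq_leaf_or_snoc with rfl | ⟨c, d, rfl⟩
      · simp [upper] at hl'; omega
      · exact ⟨⟨hl, hh, flip_turn _ _⟩, hl', _, rfl⟩
    | last u v w =>
      rcases v.eq_leaf_or_snoc with rfl | ⟨c, d, rfl⟩
      · left
        refine ⟨⟨hl, hh, flip_last_leaf _ _⟩, Or.inl (Or.inr ⟨⟨hl', _, _, _, rfl⟩, ?_⟩)⟩
        rintro ⟨-, u', v', w', hv, h⟩
        simp [Bridge.upper_inj] at h
        exact hv h.1.2.symm
      · right; right
        exact ⟨⟨hl, hh, flip_last_snoc _ _ _ _⟩, hl', _, _, _, by simp, rfl⟩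

/-- Reversal exchanges first and last components, so it conjugates `shift` to its inverse. This
makes E invariant under f. -/
theorem BinTree.shift_mirror_shift (v : BinTree) : v.shift.mirror.shift = v.mirror := by
  rcases v.eq_leaf_or_snoc with rfl | ⟨c, d, rfl⟩ <;> simp

theorem Middle.compRev {z y : List Bool} (h : Middle z y) :
    Middle (compRev y) (compRev z) := by
  cases h with
  | flat U w =>
    rw [Bridge.compRev_upper, Bridge.compRev_lower]
    exact .flat _ _
  | turn v =>
    rw [Bridge.compRev_upper, Bridge.compRev_lower]
    have := Middle.turn v.shift.mirror
    rwa [v.shift_mirror_shift] at this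
  | last u v w =>
    rw [Bridge.compRev_upper, Bridge.compRev_lower]
    have := Middle.last w.mirror v.shift.mirror u.mirror
    rwa [v.shift_mirror_shift] at this

/-! ### Cycles of a two-regular graph -/

section TwoRegular

variable {V : Type} {G : SimpleGraph V}

/-- A vertex of a cycle already has two neighbours on it, so in a two-regular graph no other edge is
left. Thus a cycle is the full component of each of its vertices. -/
theorem CyclesOf.adj_iff [Finite V] (h : ∀ v, (G.neighborSet v).ncard = 2) (S : CyclesOf G)
    (v w : V) : S.1.Adj v w ↔ v ∈ S.1.verts ∧ G.Adj v w := by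
  obtain ⟨S, u, p, hp, rfl⟩ := S
  constructor
  · intro hvw
    exact ⟨hvw.fst_mem, hvw.adj_sub⟩
  · rintro ⟨hv, hvw⟩
    have : G.LocallyFinite := fun v => Fintype.ofFinite _
    exact (hp.adj_toSubgraph_iff_of_isCycles (fun v _ => h v) hv w).2 hvw

theorem CyclesOf.mem_of_reachable [Finite V] (h : ∀ v, (G.neighborSet v).ncard = 2)
    (S : CyclesOf G) {v w : V} (hv : v ∈ S.1.verts) (hvw : G.Reachable v w) : w ∈ S.1.verts := by
  obtain ⟨p⟩ := hvw
  induction p with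
  | nil => exact hv
  | cons hadj _ ih => exact ih ((S.adj_iff h _ _).2 ⟨hv, hadj⟩).snd_mem

theorem CyclesOf.reachable (S : CyclesOf G) {v w : V} (hv : v ∈ S.1.verts) (hw : w ∈ S.1.verts) :
    G.Reachable v w := by
  obtain ⟨S, u, p, hp, rfl⟩ := S
  rw [SimpleGraph.Walk.mem_verts_toSubgraph] at hv hw
  classical
  exact ⟨(p.takeUntil v hv).reverse.append (p.takeUntil w hw)⟩

theorem CyclesOf.eq_of_mem [Finite V] (h : ∀ v, (G.neighborSet v).ncard = 2)
    {S T : CyclesOf G} {v : V} (hS : v ∈ S.1.verts) (hT : v ∈ T.1.verts) : S = T := by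
  have hverts : S.1.verts = T.1.verts := by
    ext w
    exact ⟨fun hw => T.mem_of_reachable h hT (S.reachable hS hw),
      fun hw => S.mem_of_reachable h hS (T.reachable hT hw)⟩
  apply Subtype.ext
  apply SimpleGraph.Subgraph.ext hverts
  ext a b
  rw [S.adj_iff h, T.adj_iff h, hverts]

theorem CyclesOf.exists_mem [Finite V] (h : ∀ v, (G.neighborSet v).ncard = 2) (v : V) :
    ∃ S : CyclesOf G, v ∈ S.1.verts := by
  have hne : (G.neighborSet v).Nonempty := by
    rw [← Set.ncard_pos, h v]; norm_num
  have hcyc : G.IsCycles := fun v _ => h v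
  obtain ⟨p, hp, hverts⟩ := hcyc.exists_cycle_toSubgraph_verts_eq_connectedComponentSupp
    (c := G.connectedComponentMk v) rfl hne
  exact ⟨⟨p.toSubgraph, v, p, hp, rfl⟩, by rw [hverts]; rfl⟩

theorem isCycleFactor_of_two_regular [Finite V] {H : SimpleGraph V} (hle : G ≤ H)
    (h : ∀ v, (G.neighborSet v).ncard = 2) : IsCycleFactor G H := by
  refine ⟨hle, fun v => ?_, fun v w hvw => ?_⟩
  · obtain ⟨S, hS⟩ := CyclesOf.exists_mem h v
    exact ⟨S, hS, fun T hT => CyclesOf.eq_of_mem h hT hS⟩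
  · obtain ⟨S, hS⟩ := CyclesOf.exists_mem h v
    exact ⟨S, (S.adj_iff h v w).2 ⟨hS, hvw⟩⟩

end TwoRegular

/-! ### Neighbours in the cycle factor -/

/-- An edge of the cycle factor from its lower to its upper end vertex. -/
def UpEdge (n : ℕ) (x y : List Bool) : Prop :=
  pathEdge n x y ∨ pathEdge n (compRev y) (compRev x) ∨ middleEdge n x y

/-- Adjacency in the cycle factor, as a relation on bitstrings. -/
def Linked (n : ℕ) (x y : List Bool) : Prop := UpEdge n x y ∨ UpEdge n y x

theorem Linked.symm {n : ℕ} {x y : List Bool} (h : Linked n x y) : Linked n y x := Or.symm h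

theorem UpEdge.height_eq {n : ℕ} {x y : List Bool} (h : UpEdge n x y) :
    x.length = 2 * n + 1 ∧ y.length = 2 * n + 1 ∧ height y = height x + 2 ∧
      (height x = -3 ∨ height x = -1 ∨ height x = 1) := by
  rcases h with h | h | h
  · have := pathEdge_height h
    omega
  · have := pathEdge_height h
    simp only [length_compRev, height_compRev] at this
    omega
  · have : ∃ i, lexMatch (2 * n + 1) n i x y := by
      rcases h with h | h | h <;> exact ⟨_, h.1⟩
    obtain ⟨i, hi⟩ := this
    have := lexMatch_lower_height hi
    omega

theorem mid_iff {n : ℕ} {x : List Bool} (hx : x.length = 2 * n + 1) :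
    (n ≤ x.count true + 1 ∧ x.count true ≤ n + 2) ↔
      (height x = -3 ∨ height x = -1 ∨ height x = 1 ∨ height x = 3) := by
  have := height_add_length x
  omega

theorem mid_of_height {n : ℕ} {x : List Bool} (hx : x.length = 2 * n + 1)
    (h : height x = -3 ∨ height x = -1 ∨ height x = 1 ∨ height x = 3) :
    x.length = 2 * n + 1 ∧ n ≤ x.count true + 1 ∧ x.count true ≤ n + 2 :=
  ⟨hx, (mid_iff hx).2 h⟩

theorem MidVertex.height_cases {n : ℕ} (x : MidVertex n) :
    height x.1 = -3 ∨ height x.1 = -1 ∨ height x.1 = 1 ∨ height x.1 = 3 :=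
  (mid_iff x.2.1).1 x.2.2

theorem Linked.mid {n : ℕ} {x y : List Bool} (h : Linked n x y) :
    y.length = 2 * n + 1 ∧ n ≤ y.count true + 1 ∧ y.count true ≤ n + 2 := by
  rcases h with h | h
  · have := h.height_eq
    exact mid_of_height this.2.1 (by omega)
  · have := h.height_eq
    exact mid_of_height this.1 (by omega)

theorem cycleFactor_adj_iff {n : ℕ} (x y : MidVertex n) :
    (cycleFactor n).Adj x y ↔ Linked n x.1 y.1 := by
  simp only [cycleFactor, SimpleGraph.fromRel_adj, Linked, UpEdge]
  constructor
  · exact fun h => h.2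
  · refine fun h => ⟨?_, h⟩
    rintro rfl
    have h' : UpEdge n x.1 x.1 := h.elim id id
    have := h'.height_eq
    omega

theorem UpEdge.exists_flip {n : ℕ} {x y : List Bool} (h : UpEdge n x y) :
    ∃ p s : List Bool, x = p ++ false :: s ∧ y = p ++ true :: s := by
  have key : ∀ {n k : ℕ} {i : ℤ} {x y : List Bool}, lexMatch n k i x y →
      ∃ p s : List Bool, x = p ++ false :: s ∧ y = p ++ true :: s := by
    rintro n k i x y ⟨-, p, s, hx, hy, -⟩
    exact ⟨p, s, hx, hy⟩
  rcases h with (h | h) | (h | h) | h | h | h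
  · exact key h
  · exact key h
  · obtain ⟨p, s, h1, h2⟩ := key h
    refine ⟨compRev s, compRev p, ?_, ?_⟩
    · rw [← compRev_compRev x, h2]; simp [compRev_cons]
    · rw [← compRev_compRev y, h1]; simp [compRev_cons]
  · obtain ⟨p, s, h1, h2⟩ := key h
    refine ⟨compRev s, compRev p, ?_, ?_⟩
    · rw [← compRev_compRev x, h2]; simp [compRev_cons]
    · rw [← compRev_compRev y, h1]; simp [compRev_cons]
  · exact key h.1
  · exact key h.1
  · exact key h.1

theorem cycleFactor_le (n : ℕ) : cycleFactor n ≤ midGraph n := by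
  intro x y h
  refine (SimpleGraph.fromRel_adj _ _ _).2 ⟨h.ne, ?_⟩
  rcases (cycleFactor_adj_iff x y).1 h with h | h
  · obtain ⟨p, s, h1, h2⟩ := h.exists_flip
    exact Or.inl ⟨p, s, false, h1, h2⟩
  · obtain ⟨p, s, h1, h2⟩ := h.exists_flip
    exact Or.inr ⟨p, s, false, h1, h2⟩

theorem UpEdge.compRev {n : ℕ} (hn : 1 ≤ n) {x y : List Bool} (h : UpEdge n x y) :
    UpEdge n (compRev y) (compRev x) := by
  rcases h with h | h | h
  · exact Or.inr (Or.inl (by simpa using h))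
  · exact Or.inl h
  · refine Or.inr (Or.inr ?_)
    rw [middleEdge_iff hn] at h ⊢
    exact ⟨by rw [length_compRev, h.2.length_eq, h.1], h.2.compRev⟩

theorem Linked.compRev {n : ℕ} (hn : 1 ≤ n) {x y : List Bool} (h : Linked n x y) :
    Linked n (compRev x) (compRev y) :=
  h.elim (fun h => Or.inr (h.compRev hn)) (fun h => Or.inl (h.compRev hn))

theorem linked_compRev_iff {n : ℕ} (hn : 1 ≤ n) {x y : List Bool} :
    Linked n (compRev x) y ↔ Linked n x (compRev y) := by
  constructor
  · intro h; simpa using h.compRev hn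
  · intro h; simpa using h.compRev hn

theorem linked_upper_iff {n : ℕ} (hn : 1 ≤ n) {X : Bridge} {w : BinTree}
    (hl : (upper X w).length = 2 * n + 1) {y : List Bool} :
    Linked n (upper X w) y ↔
      (∃ Z : Rise, (Z.next = X ∨ Z.low = X) ∧ y = Z.top w) ∨ Middle y (upper X w) := by
  constructor
  · rintro ((h | h | h) | (h | h | h))
    · obtain ⟨Z, w', rfl⟩ := Rise.exists_top_eq y (pathEdge_height h).2.2.2
      rw [pathEdge_top_iff, Bridge.upper_inj, Bridge.upper_inj] at h
      rcases h.2 with ⟨rfl, rfl⟩ | ⟨rfl, rfl⟩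
      · exact Or.inl ⟨Z, Or.inl rfl, rfl⟩
      · exact Or.inl ⟨Z, Or.inr rfl, rfl⟩
    · have := (pathEdge_height h).2.2.2
      simp at this
    · have := ((middleEdge_iff hn).1 h).2.height_eq.1
      simp at this
    · have := (pathEdge_height h).2.2.2
      simp at this
    · have := (pathEdge_height h).2.2.1
      simp at this
    · exact Or.inr ((middleEdge_iff hn).1 h).2
  · rintro (⟨Z, rfl | rfl, rfl⟩ | h)
    · exact Or.inl (Or.inl (pathEdge_top_iff.2 ⟨hl, Or.inl rfl⟩))
    · exact Or.inl (Or.inl (pathEdge_top_iff.2 ⟨hl, Or.inr rfl⟩))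
    · exact Or.inr (Or.inr (Or.inr ((middleEdge_iff hn).2 ⟨h.length_eq.symm.trans hl, h⟩)))

theorem linked_top_iff {n : ℕ} (hn : 1 ≤ n) {Z : Rise} {w : BinTree}
    (hl : (Z.top w).length = 2 * n + 1) {y : List Bool} :
    Linked n (Z.top w) y ↔ y = upper Z.next w ∨ y = upper Z.low w := by
  constructor
  · rintro (h | (h | h | h))
    · have := h.height_eq
      simp at this
    · exact (pathEdge_top_iff.1 h).2
    · have := (pathEdge_height h).2.2.1
      simp at this
    · have := ((middleEdge_iff hn).1 h).2.height_eq.2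
      simp at this
  · rintro (rfl | rfl)
    · exact Or.inr (Or.inl (pathEdge_top_iff.2
        ⟨(Z.flip_next_top w).length_eq.symm.trans hl, Or.inl rfl⟩))
    · exact Or.inr (Or.inl (pathEdge_top_iff.2
        ⟨(Z.flip_low_top w).length_eq.symm.trans hl, Or.inr rfl⟩))

/-- Two neighbours in every case: the number of 𝒫-edges at the vertex, decided by the two covering
criteria, is complemented by the matching number of edges of E. -/
theorem exists_pair_linked_upper {n : ℕ} (hn : 1 ≤ n) {X : Bridge} {w : BinTree}
    (hl : (upper X w).length = 2 * n + 1) :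
    ∃ a b, a ≠ b ∧ ∀ y, Linked n (upper X w) y ↔ y = a ∨ y = b := by
  simp only [linked_upper_iff hn hl]
  have hnext : ∀ Z Z' : Rise, Z.next = Z'.next → Z.top w = Z'.top w := by
    intro Z Z' h
    exact (h ▸ Z.flip_next_top w).right_unique (Z'.flip_next_top w)
  have hlow : ∀ Z Z' : Rise, Z.low = Z'.low → Z.top w = Z'.top w := by
    intro Z Z' h
    exact (h ▸ Z.flip_low_top w).right_unique (Z'.flip_low_top w)
  have h1 := Rise.exists_next_eq_iff X
  have h2 := Rise.exists_low_eq_iff X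
  have hne : ∀ Z : Rise, Z.top w ≠ lower leaf (base leaf) := by
    intro Z h
    have := congrArg height h
    simp at this
  by_cases hnx : ∃ Z : Rise, Z.next = X <;> by_cases hlw : ∃ Z : Rise, Z.low = X
  -- Inner vertex of a path of 𝒫: two neighbours above and none below.
  · have h3 := h1.1 hnx
    have h4 := h2.1 hlw
    obtain ⟨Z, hZ⟩ := hnx
    obtain ⟨Z', hZ'⟩ := hlw
    refine ⟨Z.top w, Z'.top w, ?_, fun y => ⟨?_, ?_⟩⟩
    · intro h
      have h5 := (h ▸ Z.flip_low_top w).left_unique (by simp) (Z'.flip_low_top w)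
      rw [hZ', ← hZ, Bridge.upper_inj] at h5
      exact Z.next_ne_low h5.1.symm
    · rintro (⟨Z'', h | h, rfl⟩ | h)
      · exact Or.inl (hnext _ _ (h.trans hZ.symm))
      · exact Or.inr (hlow _ _ (h.trans hZ'.symm))
      · generalize hx : upper X w = x at h
        cases h with
        | flat => exact absurd (Bridge.upper_inj.1 hx).1 (h4 _)
        | turn => exact absurd (Bridge.upper_inj.1 hx).1 (h4 _)
        | last => exact absurd (Bridge.upper_inj.1 hx).1 (h3.2 _ _)
    · rintro (rfl | rfl)
      · exact Or.inl ⟨Z, Or.inl hZ, rfl⟩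
      · exact Or.inl ⟨Z', Or.inr hZ', rfl⟩
  -- First vertex of a path: one edge upwards and the edge `flat`.
  · have h3 := h1.1 hnx
    rw [h2] at hlw
    push Not at hlw
    obtain ⟨u, rfl⟩ := hlw
    obtain ⟨Z, hZ⟩ := hnx
    refine ⟨Z.top w, lower u (base w), ?_, fun y => ⟨?_, ?_⟩⟩
    · intro h
      have := congrArg height h
      simp at this
    · rintro (⟨Z', h | h, rfl⟩ | h)
      · exact Or.inl (hnext _ _ (h.trans hZ.symm))
      · exact absurd rfl (h2.1 ⟨Z', h⟩ u)
      · right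
        generalize hx : upper (base u) w = x at h
        cases h with
        | flat =>
          obtain ⟨h4, rfl⟩ := Bridge.upper_inj.1 hx
          cases h4; rfl
        | turn => exact absurd (Bridge.upper_inj.1 hx).1 h3.1
        | last => exact absurd (Bridge.upper_inj.1 hx).1 (h3.2 _ _)
    · rintro (rfl | rfl)
      · exact Or.inl ⟨Z, Or.inl hZ, rfl⟩
      · exact Or.inr (.flat u w)
  -- Last vertex of a path: one edge upwards and the edge `last`.
  · have h4 := h2.1 hlw
    rw [h1] at hnx
    obtain ⟨u, v, rfl⟩ : ∃ u v, X = wrap u (base leaf) v := by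
      by_contra! h
      exact hnx ⟨h4 _, h⟩
    obtain ⟨Z, hZ⟩ := hlw
    refine ⟨Z.top w, lower u (wrap v.shift (base leaf) w), ?_, fun y => ⟨?_, ?_⟩⟩
    · intro h
      have := congrArg height h
      simp at this
    · rintro (⟨Z', h | h, rfl⟩ | h)
      · exact absurd (h1.1 ⟨Z', h⟩) hnx
      · exact Or.inl (hlow _ _ (h.trans hZ.symm))
      · right
        generalize hx : upper (wrap u (base leaf) v) w = x at h
        cases h with
        | flat => exact absurd (Bridge.upper_inj.1 hx).1 (h4 _)
        | turn => exact absurd (Bridge.upper_inj.1 hx).1 (h4 _)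
        | last =>
          obtain ⟨h5, rfl⟩ := Bridge.upper_inj.1 hx
          cases h5; rfl
    · rintro (rfl | rfl)
      · exact Or.inl ⟨Z, Or.inr hZ, rfl⟩
      · exact Or.inr (.last u v w)
  -- Isolated vertex: both edges go down, `flat` and `turn`.
  · rw [h2] at hlw
    push Not at hlw
    obtain ⟨u, rfl⟩ := hlw
    have hu : u = leaf := by
      by_contra hu
      exact hnx (h1.2 ⟨by simpa using hu, by simp⟩)
    subst hu
    refine ⟨lower leaf (base w), lower w.shift (base leaf), ?_, fun y => ⟨?_, ?_⟩⟩
    · intro h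
      -- The two lower neighbours coincide only for empty w, and then the length is 1, contrary to n
      -- ≥ 1.
      have h3 := (Bridge.lower_inj.1 h).2
      simp at h3
      subst h3
      simp [upper] at hl
      omega
    · rintro (⟨Z', h | h, rfl⟩ | h)
      · exact absurd ⟨Z', h⟩ hnx
      · exact absurd rfl (h2.1 ⟨Z', h⟩ leaf)
      · generalize hx : upper (base leaf) w = x at h
        cases h with
        | flat =>
          obtain ⟨h4, rfl⟩ := Bridge.upper_inj.1 hx
          cases h4; exact Or.inl rfl
        | turn =>
          obtain ⟨-, rfl⟩ := Bridge.upper_inj.1 hx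
          exact Or.inr rfl
        | last =>
          have := (Bridge.upper_inj.1 hx).1
          simp at this
    · rintro (rfl | rfl)
      · exact Or.inr (.flat leaf w)
      · exact Or.inr (.turn w)

/-- The map f exchanges the two lower levels with the two upper ones and preserves adjacency, so
only the upper half needs inspection. -/
theorem exists_pair_linked {n : ℕ} (hn : 1 ≤ n) {x : List Bool} (hl : x.length = 2 * n + 1)
    (hx : height x = -3 ∨ height x = -1 ∨ height x = 1 ∨ height x = 3) :
    ∃ a b, a ≠ b ∧ ∀ y, Linked n x y ↔ y = a ∨ y = b := by
  have upper_half : ∀ x : List Bool, x.length = 2 * n + 1 → height x = 1 ∨ height x = 3 →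
      ∃ a b, a ≠ b ∧ ∀ y, Linked n x y ↔ y = a ∨ y = b := by
    rintro x hl (hx | hx)
    · obtain ⟨X, w, rfl⟩ := Bridge.exists_upper_eq x hx
      exact exists_pair_linked_upper hn hl
    · obtain ⟨Z, w, rfl⟩ := Rise.exists_top_eq x hx
      refine ⟨_, _, ?_, fun y => linked_top_iff hn hl⟩
      rw [Ne, Bridge.upper_inj]
      exact fun h => Z.next_ne_low h.1
  by_cases h : height x = 1 ∨ height x = 3
  · exact upper_half x hl h
  · obtain ⟨a, b, hab, H⟩ := upper_half (compRev x) (by simpa using hl) (by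
      rw [height_compRev]; omega)
    refine ⟨compRev a, compRev b, fun h => hab ?_, fun y => ?_⟩
    · rw [← compRev_compRev a, h, compRev_compRev]
    · rw [← compRev_compRev y, ← linked_compRev_iff hn, H]
      constructor
      · rintro (h | h) <;> simp [h]
      · intro h
        refine h.imp (fun h => ?_) (fun h => ?_)
        · rw [← compRev_compRev (FourLevels.compRev y), h, compRev_compRev]
        · rw [← compRev_compRev (FourLevels.compRev y), h, compRev_compRev]

theorem ncard_neighborSet_cycleFactor {n : ℕ} (hn : 1 ≤ n) (x : MidVertex n) :
    ((cycleFactor n).neighborSet x).ncard = 2 := by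
  obtain ⟨a, b, hab, H⟩ := exists_pair_linked hn x.2.1 x.height_cases
  have ha := (H a).2 (Or.inl rfl)
  have hb := (H b).2 (Or.inr rfl)
  refine Set.ncard_eq_two.2 ⟨⟨a, ha.mid⟩, ⟨b, hb.mid⟩, by simpa using hab, ?_⟩
  ext y
  simp [cycleFactor_adj_iff, H, Subtype.ext_iff]

instance finite_midVertex (n : ℕ) : Finite (MidVertex n) :=
  (List.finite_length_eq Bool (2 * n + 1)).subset (fun _ h => h.1)

theorem isCycleFactor_cycleFactor {n : ℕ} (hn : 1 ≤ n) :
    IsCycleFactor (cycleFactor n) (midGraph n) :=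
  isCycleFactor_of_two_regular (cycleFactor_le n) (ncard_neighborSet_cycleFactor hn)

/-! ### The components of the cycle factor -/

/-- Moving the marked edge of a pair of binary trees joined at their roots one step along the
face. -/
def faceStep : BinTree × BinTree → BinTree × BinTree
  | (leaf, q) => (q, leaf)
  | (node a b, q) => (a, node b q)

@[simp] theorem faceStep_leaf (q : BinTree) : faceStep (leaf, q) = (q, leaf) := rfl
@[simp] theorem faceStep_node (a b q : BinTree) : faceStep (node a b, q) = (a, node b q) := rfl

/-- Pairs of binary trees up to moving along the face. -/
abbrev FaceClass : Type := Quot fun p q : BinTree × BinTree => q = faceStep p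

/-- The class of a pair of binary trees. -/
def faceClass (p q : BinTree) : FaceClass := Quot.mk _ (p, q)

@[simp] theorem faceClass_node (a b q : BinTree) :
    faceClass a (node b q) = faceClass (node a b) q :=
  (Quot.sound (r := fun p q : BinTree × BinTree => q = faceStep p) (a := (node a b, q)) rfl).symm

theorem faceClass_leaf (q : BinTree) : faceClass leaf q = faceClass q leaf :=
  Quot.sound (r := fun p q : BinTree × BinTree => q = faceStep p) (a := (leaf, q)) rfl

/-- The class of pairs of binary trees associated with a vertex of the middle four levels. -/
inductive HasClass : List Bool → FaceClass → Prop
  | upper (X : Bridge) (w : BinTree) : HasClass (upper X w) (faceClass X.source.ell w.ar)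
  | lower (w : BinTree) (X : Bridge) :
      HasClass (lower w X) (faceClass w.ell X.mirror.source.mirror.ar)
  | top (Z : Rise) (w : BinTree) : HasClass (Z.top w) (faceClass Z.low.source.ell w.ar)
  | bot (Z : Rise) (w : BinTree) :
      HasClass (compRev (Z.top w)) (faceClass w.mirror.ell Z.low.source.mirror.ar)

theorem HasClass.unique {x : List Bool} {c c' : FaceClass} (h : HasClass x c)
    (h' : HasClass x c') : c = c' := by
  -- Injectivity of `top` is not needed: the class depends on `Z` only through `Z.low`, which is
  -- determined by the matching partner.
  have htop : ∀ {Z Z' : Rise} {w w' : BinTree}, Z.top w = Z'.top w' →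
      Z.low = Z'.low ∧ w = w' := by
    intro Z Z' w w' hx
    exact Bridge.upper_inj.1 ((hx ▸ Z.flip_low_top w).left_unique (by simp) (Z'.flip_low_top w'))
  cases h with
  | upper X w =>
    generalize hx : Bridge.upper X w = x at h'
    cases h' with
    | upper => obtain ⟨rfl, rfl⟩ := Bridge.upper_inj.1 hx; rfl
    | lower => exact absurd (congrArg height hx) (by simp)
    | top => exact absurd (congrArg height hx) (by simp)
    | bot => exact absurd (congrArg height hx) (by simp)
  | lower w X =>
    generalize hx : Bridge.lower w X = x at h'
    cases h' with
    | lower => obtain ⟨rfl, rfl⟩ := Bridge.lower_inj.1 hx; rfl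
    | upper => exact absurd (congrArg height hx) (by simp)
    | top => exact absurd (congrArg height hx) (by simp)
    | bot => exact absurd (congrArg height hx) (by simp)
  | top Z w =>
    generalize hx : Z.top w = x at h'
    cases h' with
    | lower => exact absurd (congrArg height hx) (by simp)
    | upper => exact absurd (congrArg height hx) (by simp)
    | top => obtain ⟨h1, rfl⟩ := htop hx; rw [h1]
    | bot => exact absurd (congrArg height hx) (by simp)
  | bot Z w =>
    generalize hx : compRev (Z.top w) = x at h'
    cases h' with
    | lower => exact absurd (congrArg height hx) (by simp)
    | upper => exact absurd (congrArg height hx) (by simp)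
    | top => exact absurd (congrArg height hx) (by simp)
    | bot =>
      have hx' := congrArg compRev hx
      rw [compRev_compRev, compRev_compRev] at hx'
      obtain ⟨h1, rfl⟩ := htop hx'; rw [h1]

/-- The edge `flat` keeps the pair; `turn` replaces (leaf, r(v)) by (r(v), leaf); `last` replaces
(node ℓ(u) r(v), r(w)) by (ℓ(u), node r(v) r(w)). The last two use r(v) = ℓ(`v.shift`) and are steps
along the face. -/
theorem Middle.hasClass {z y : List Bool} (h : Middle z y) :
    ∃ c, HasClass z c ∧ HasClass y c := by
  cases h with
  | flat U w => exact ⟨_, .lower _ _, by simpa using HasClass.upper (base U) w⟩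
  | turn v =>
    refine ⟨_, .lower _ _, ?_⟩
    have := HasClass.upper (base leaf) v
    simpa [faceClass_leaf, BinTree.ar] using this
  | last u v w =>
    refine ⟨_, .lower _ _, ?_⟩
    have := HasClass.upper (wrap u (base leaf) v) w
    simpa [BinTree.ar] using this

/-- The class of `x` serves the edges of 𝒫, that of its image under f the edges of f(𝒫). -/
theorem pathEdge_hasClass {n : ℕ} {x y : List Bool} (h : pathEdge n x y) :
    ∃ Z w, y = Rise.top Z w ∧ HasClass x (faceClass Z.low.source.ell w.ar) ∧
      HasClass (compRev x) (faceClass w.mirror.ell Z.low.source.mirror.ar) := by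
  obtain ⟨Z, w, rfl⟩ := Rise.exists_top_eq y (pathEdge_height h).2.2.2
  refine ⟨Z, w, rfl, ?_⟩
  rcases (pathEdge_top_iff.1 h).2 with rfl | rfl
  · rw [← Z.source_next, Bridge.compRev_upper]
    exact ⟨.upper _ _, by simpa using HasClass.lower w.mirror Z.next.mirror⟩
  · rw [Bridge.compRev_upper]
    exact ⟨.upper _ _, by simpa using HasClass.lower w.mirror Z.low.mirror⟩

theorem UpEdge.hasClass {n : ℕ} (hn : 1 ≤ n) {x y : List Bool} (h : UpEdge n x y) :
    ∃ c, HasClass x c ∧ HasClass y c := by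
  rcases h with h | h | h
  · obtain ⟨Z, w, rfl, h1, -⟩ := pathEdge_hasClass h
    exact ⟨_, h1, .top Z w⟩
  · obtain ⟨Z, w, h0, -, h1⟩ := pathEdge_hasClass h
    rw [compRev_compRev] at h1
    rw [← compRev_compRev x, h0]
    exact ⟨_, .bot Z w, h1⟩
  · exact ((middleEdge_iff hn).1 h).2.hasClass

theorem Linked.hasClass {n : ℕ} (hn : 1 ≤ n) {x y : List Bool} (h : Linked n x y) :
    ∃ c, HasClass x c ∧ HasClass y c := by
  rcases h with h | h
  · exact h.hasClass hn
  · obtain ⟨c, h1, h2⟩ := h.hasClass hn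
    exact ⟨c, h2, h1⟩

theorem hasClass_iff_of_reachable {n : ℕ} (hn : 1 ≤ n) {x y : MidVertex n}
    (h : (cycleFactor n).Reachable x y) (c : FaceClass) : HasClass x.1 c ↔ HasClass y.1 c := by
  obtain ⟨p⟩ := h
  induction p with
  | nil => rfl
  | cons hadj _ ih =>
    rw [← ih]
    obtain ⟨c', h1, h2⟩ := ((cycleFactor_adj_iff _ _).1 hadj).hasClass hn
    exact ⟨fun h => h1.unique h ▸ h2, fun h => h2.unique h ▸ h1⟩

-- Steps along the face are realized by walks in the graph

/-- Being joined by a path in the cycle factor, as a relation on bitstrings. -/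
def Joined (n : ℕ) (x y : List Bool) : Prop := Relation.ReflTransGen (Linked n) x y

theorem Joined.symm {n : ℕ} {x y : List Bool} (h : Joined n x y) : Joined n y x := by
  induction h with
  | refl => exact .refl
  | tail _ h ih => exact ih.head h.symm

theorem Joined.trans {n : ℕ} {x y z : List Bool} (h : Joined n x y) (h' : Joined n y z) :
    Joined n x z := Relation.ReflTransGen.trans h h'

theorem Linked.joined {n : ℕ} {x y : List Bool} (h : Linked n x y) : Joined n x y := .single h

theorem Joined.compRev {n : ℕ} (hn : 1 ≤ n) {x y : List Bool} (h : Joined n x y) :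
    Joined n (compRev x) (compRev y) := by
  induction h with
  | refl => exact .refl
  | tail _ h ih => exact ih.tail (h.compRev hn)

theorem Joined.reachable {n : ℕ} {x y : MidVertex n} (h : Joined n x.1 y.1) :
    (cycleFactor n).Reachable x y := by
  have key : ∀ {b : List Bool}, Joined n x.1 b → ∀ hb, (cycleFactor n).Reachable x ⟨b, hb⟩ := by
    intro b h
    induction h with
    | refl => exact fun _ => SimpleGraph.Reachable.rfl
    | tail _ h ih =>
      intro hb
      exact (ih h.symm.mid).trans ((cycleFactor_adj_iff _ _).2 h).reachable
  exact key h y.2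

theorem Middle.joined {n : ℕ} (hn : 1 ≤ n) {z y : List Bool} (h : Middle z y)
    (hl : y.length = 2 * n + 1) : Joined n z y :=
  Linked.joined (Or.inl (Or.inr (Or.inr
    ((middleEdge_iff hn).2 ⟨h.length_eq.symm.trans hl, h⟩))))

namespace Bridge

/-- The number of up-steps of a bridge. -/
def size : Bridge → ℕ
  | base u => u.size
  | wrap u X w => u.size + X.size + w.size + 1

@[simp] theorem size_base (u : BinTree) : (base u).size = u.size := rfl
@[simp] theorem size_wrap (u : BinTree) (X : Bridge) (w : BinTree) :
    (wrap u X w).size = u.size + X.size + w.size + 1 := rfl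

@[simp] theorem length_word (X : Bridge) : X.word.length = 2 * X.size := by
  induction X with
  | base u => simp
  | wrap u X w ih => simp [ih]; ring

theorem length_upper (X : Bridge) (w : BinTree) :
    (upper X w).length = 2 * (X.size + w.size) + 1 := by
  simp [upper]; ring

theorem length_lower (X : Bridge) (w : BinTree) :
    (lower w X).length = 2 * (X.size + w.size) + 1 := by
  simp [lower]; ring

@[simp] theorem size_source (X : Bridge) : X.source.size = X.size := by
  induction X with
  | base u => simp
  | wrap u X w ih => simp [ih]

@[simp] theorem size_mirror (X : Bridge) : X.mirror.size = X.size := by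
  induction X with
  | base u => simp
  | wrap u X w ih => simp [ih]; ring

/-- Two bridges are joined if paths of lexical matching edges connect them. -/
def Conn : Bridge → Bridge → Prop :=
  Relation.EqvGen fun X Y => ∃ Z : Rise, Z.next = X ∧ Z.low = Y

theorem Conn.wrap {X Y : Bridge} (h : Conn X Y) (u w : BinTree) :
    Conn (wrap u X w) (wrap u Y w) := by
  induction h with
  | rel _ _ h =>
    obtain ⟨Z, rfl, rfl⟩ := h
    exact .rel _ _ ⟨.wrap u Z w, rfl, rfl⟩
  | refl => exact .refl _
  | symm _ _ _ ih => exact .symm _ _ ih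
  | trans _ _ _ _ _ ih ih' => exact .trans _ _ _ ih ih'

theorem conn_wrap_base (u a w : BinTree) :
    Conn (Bridge.wrap u (base a) w) (base (node (u.app a) w)) := by
  induction h : u.size using Nat.strong_induction_on generalizing u a w with
  | _ k ih =>
    -- Go up to u 1 a 1 w and down along its other edge. For u = p 1 q 0 this gives two wraps with
    -- shorter outer words q and p; they are removed from the inside out.
    refine .trans _ _ _ (.symm _ _ (.rel _ _ ⟨.base u a w, rfl, rfl⟩)) ?_
    rcases u.eq_leaf_or_snoc with rfl | ⟨p, q, rfl⟩
    · exact .refl _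
    · simp at h
      rw [Rise.next_base_snoc]
      refine .trans _ _ _ ((ih _ (by omega) q leaf a rfl).wrap p w) ?_
      have := ih _ (by omega) p (node (q.app leaf) a) w rfl
      simp only [BinTree.snoc_app, BinTree.app_leaf] at this ⊢
      exact this

theorem conn_source (X : Bridge) : Conn X (base X.source) := by
  induction X with
  | base u => exact .refl _
  | wrap u X w ih => exact .trans _ _ _ (ih.wrap u w) (conn_wrap_base _ _ _)

theorem Conn.joined {n : ℕ} {X Y : Bridge} (h : Conn X Y) (w : BinTree)
    (hl : (upper X w).length = 2 * n + 1) : Joined n (upper X w) (upper Y w) := by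
  -- Equality of sizes is proved simultaneously, so that the length condition is available at
  -- intermediate bridges.
  have key : X.size = Y.size ∧
      ((upper X w).length = 2 * n + 1 → Joined n (upper X w) (upper Y w)) := by
    clear hl
    induction h with
    | rel _ _ h =>
      obtain ⟨Z, rfl, rfl⟩ := h
      refine ⟨?_, fun hl => ?_⟩
      · have h1 := (Z.flip_next_top w).length_eq
        have h2 := (Z.flip_low_top w).length_eq
        rw [length_upper] at h1 h2
        omega
      · have hl2 := (Z.flip_low_top w).length_eq.symm.trans
          ((Z.flip_next_top w).length_eq.trans hl)
        exact (Linked.joined (Or.inl (Or.inl (pathEdge_top_iff.2 ⟨hl, Or.inl rfl⟩)))).trans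
          (Linked.joined (Or.inl (Or.inl (pathEdge_top_iff.2 ⟨hl2, Or.inr rfl⟩)))).symm
    | refl => exact ⟨rfl, fun _ => .refl⟩
    | symm _ _ _ ih =>
      refine ⟨ih.1.symm, fun hl => (ih.2 ?_).symm⟩
      rwa [length_upper, ih.1, ← length_upper]
    | trans _ _ _ _ _ ih ih' =>
      refine ⟨ih.1.trans ih'.1, fun hl => (ih.2 hl).trans (ih'.2 ?_)⟩
      rwa [length_upper, ← ih.1, ← length_upper]
  exact key.2 hl

theorem joined_source {n : ℕ} (X : Bridge) (w : BinTree)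
    (hl : (upper X w).length = 2 * n + 1) : Joined n (upper X w) (upper (base X.source) w) :=
  X.conn_source.joined w hl

/-- Apply f, follow 𝒫 to the first vertex, apply f again, and cross by a `flat` edge. -/
theorem joined_lower {n : ℕ} (hn : 1 ≤ n) (X : Bridge) (w : BinTree)
    (hl : (lower w X).length = 2 * n + 1) :
    Joined n (lower w X) (upper (base w) X.mirror.source.mirror) := by
  have h1 := (joined_source (n := n) X.mirror w.mirror (by
    rw [← compRev_lower, length_compRev, hl])).compRev hn
  rw [compRev_upper, compRev_upper] at h1
  simp only [mirror_mirror, BinTree.mirror_mirror, mirror_base] at h1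
  refine h1.trans ((Middle.flat _ _).joined hn ?_)
  rw [length_upper]
  rw [length_lower] at hl
  simp
  omega

end Bridge

/-- The vertices `(U,1,w)` and `(U',1,w')` are joined if a step along the face takes
`(ℓ(U), r(w))` to `(ℓ(U'), r(w'))`. -/
theorem joined_of_faceStep {n : ℕ} (hn : 1 ≤ n) {U w U' w' : BinTree}
    (h : (U'.ell, w'.ar) = faceStep (U.ell, w.ar)) (hs : U.size + w.size = n) :
    U'.size + w'.size = n ∧ Joined n (upper (base U) w) (upper (base U') w') := by
  cases U with
  | leaf =>
    simp at h
    have hw' : w' = leaf := BinTree.ar_injective (by simpa using h.2)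
    have hU' : U' = w.shift := BinTree.ell_injective h.1
    subst hw' hU'
    simp at hs ⊢
    refine ⟨hs, ((Middle.turn w).joined hn ?_).symm.trans ((Middle.flat _ _).joined hn ?_)⟩ <;>
    · rw [Bridge.length_upper]; simp; omega
  | node u v =>
    simp at h
    have hU' : U' = u := BinTree.ell_injective h.1
    -- This is the word with r(w') = node ℓ(`v.shift`) r(w) = node r(v) r(w).
    have hw' : w' = v.shift.snoc w := BinTree.ar_injective (by simpa [BinTree.ar] using h.2)
    subst hw' hU'
    simp at hs ⊢
    refine ⟨by omega, ?_⟩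
    -- The walk follows a path of 𝒫 from its first to its last vertex, takes the `last` edge down,
    -- and then a path of f(𝒫) followed by a `flat` edge.
    have h1 := Bridge.joined_source (n := n) (wrap U' (base leaf) v) w (by
      rw [Bridge.length_upper]; simp; omega)
    have h2 := (Middle.last U' v w).joined (n := n) hn (by
      rw [Bridge.length_upper]; simp; omega)
    have h3 := Bridge.joined_lower hn (wrap v.shift (base leaf) w) U' (by
      rw [Bridge.length_lower]; simp; omega)
    simp at h1 h3
    exact h1.symm.trans (h2.symm.trans h3)

theorem joined_of_faceClass_eq {n : ℕ} (hn : 1 ≤ n) {U w U' w' : BinTree}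
    (h : faceClass U.ell w.ar = faceClass U'.ell w'.ar) (hs : U.size + w.size = n) :
    Joined n (upper (base U) w) (upper (base U') w') := by
  -- Equality of classes is a zigzag of face steps. Since `ell` and `ar` are onto, every
  -- intermediate pair also comes from a vertex.
  have key : ∀ p q : BinTree × BinTree, Relation.EqvGen (fun p q => q = faceStep p) p q →
      ∀ U w U' w' : BinTree, p = (U.ell, w.ar) → q = (U'.ell, w'.ar) →
        U.size + w.size = U'.size + w'.size ∧ (U.size + w.size = n →
          Joined n (upper (base U) w) (upper (base U') w')) := by
    intro p q hpq
    induction hpq with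
    | rel p q h =>
      rintro U w U' w' rfl rfl
      refine ⟨?_, fun hs => (joined_of_faceStep hn h hs).2⟩
      have h1 := congrArg (fun p : BinTree × BinTree => p.1.size + p.2.size) h
      cases U <;> simp [BinTree.size_ell] at h h1 ⊢ <;> omega
    | refl p =>
      rintro U w U' w' rfl h
      simp only [Prod.mk.injEq] at h
      rw [BinTree.ell_injective h.1, BinTree.ar_injective h.2]
      exact ⟨rfl, fun _ => .refl⟩
    | symm p q _ ih =>
      rintro U w U' w' hp hq
      have := ih U' w' U w hq hp
      exact ⟨this.1.symm, fun hs => (this.2 (this.1.trans hs)).symm⟩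
    | trans p q r _ _ ih ih' =>
      rintro U w U' w' hp hq
      obtain ⟨U'', hU⟩ := BinTree.ell_surjective q.1
      obtain ⟨w'', hw⟩ := BinTree.ar_surjective q.2
      have h1 := ih U w U'' w'' hp (Prod.ext hU.symm hw.symm)
      have h2 := ih' U'' w'' U' w' (Prod.ext hU.symm hw.symm) hq
      exact ⟨h1.1.trans h2.1, fun hs => (h1.2 hs).trans (h2.2 (h1.1.symm.trans hs))⟩
  exact (key _ _ (Quot.eqvGen_exact h) U w U' w' rfl rfl).2 hs

/-- Every vertex is joined to a vertex `(U,1,w)` with Dyck words `U` and `w`. -/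
theorem MidVertex.exists_joined {n : ℕ} (hn : 1 ≤ n) (x : MidVertex n) :
    ∃ U w : BinTree, U.size + w.size = n ∧ Joined n x.1 (upper (base U) w) := by
  have h1 : ∀ x : List Bool, x.length = 2 * n + 1 → height x = 1 ∨ height x = -1 →
      ∃ U w : BinTree, U.size + w.size = n ∧ Joined n x (upper (base U) w) := by
    rintro x hl (hx | hx)
    · obtain ⟨X, w, rfl⟩ := Bridge.exists_upper_eq x hx
      refine ⟨X.source, w, ?_, X.joined_source w hl⟩
      rw [Bridge.length_upper] at hl
      simp; omega
    · obtain ⟨w, X, rfl⟩ := Bridge.exists_lower_eq x hx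
      refine ⟨w, X.mirror.source.mirror, ?_, X.joined_lower hn w hl⟩
      rw [Bridge.length_lower] at hl
      simp; omega
  by_cases hx : height x.1 = 1 ∨ height x.1 = -1
  · exact h1 _ x.2.1 hx
  · have hx' := x.height_cases
    obtain ⟨a, b, hab, H⟩ := exists_pair_linked hn x.2.1 x.height_cases
    have ha := (H a).2 (Or.inl rfl)
    have hah : height a = 1 ∨ height a = -1 := by
      have hm := (mid_iff ha.mid.1).1 ha.mid.2
      rcases ha with h | h <;> have := h.height_eq <;> omega
    obtain ⟨U, w, hs, h⟩ := h1 a ha.mid.1 hah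
    exact ⟨U, w, hs, ha.joined.trans h⟩

/-! ### Branches and faces of plane trivalent trees -/

namespace PlaneTree

variable (T : PlaneTree)

open Classical in
/-- The neighbour of `v` that follows `p`, in the cyclic ordering at `v`. -/
noncomputable def succ (v p : T.V) : T.V :=
  if h : T.graph.Adj v p then (T.next v ⟨p, h⟩).1 else p

variable {T}

theorem next_eq_succ {v p : T.V} (h : T.graph.Adj v p) : (T.next v ⟨p, h⟩).1 = T.succ v p := by
  simp [succ, h]

theorem next_val_eq_succ {v : T.V} (w : T.graph.neighborSet v) :
    (T.next v w).1 = T.succ v w.1 := next_eq_succ w.2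

theorem adj_succ {v p : T.V} (h : T.graph.Adj v p) : T.graph.Adj v (T.succ v p) := by
  rw [← next_eq_succ h]; exact (T.next v ⟨p, h⟩).2

theorem iterate_succ {v p : T.V} (h : T.graph.Adj v p) (k : ℕ) :
    (T.succ v)^[k] p = ((T.next v ^ k) ⟨p, h⟩).1 := by
  induction k with
  | zero => rfl
  | succ k ih => rw [Function.iterate_succ_apply', ih, pow_succ', Equiv.Perm.mul_apply,
      next_val_eq_succ]

/-- The ordering at `v` is one cycle whose length is the degree. All identities for `succ` at
vertices of degree one and three follow from this. -/
theorem iterate_succ_eq_iff {v p : T.V} (h : T.graph.Adj v p) (k : ℕ) :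
    (T.succ v)^[k] p = p ↔ (T.graph.neighborSet v).ncard ∣ k := by
  have := T.finite
  have hfin : Fintype (T.graph.neighborSet v) := Fintype.ofFinite _
  have hc := T.next_cyclic v
  rw [← Finset.coe_univ] at hc
  rw [iterate_succ h, ← Nat.card_coe_set_eq, Nat.card_eq_fintype_card, ← Finset.card_univ,
    ← hc.pow_apply_eq (Finset.mem_univ (⟨p, h⟩ : T.graph.neighborSet v)), Subtype.ext_iff]

theorem succ_of_ncard_eq_one {v p : T.V} (h : T.graph.Adj v p)
    (hv : (T.graph.neighborSet v).ncard = 1) : T.succ v p = p :=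
  (iterate_succ_eq_iff h 1).2 (by rw [hv])

theorem Internal.succ_ne {v p : T.V} (hv : T.Internal v) (h : T.graph.Adj v p) :
    T.succ v p ≠ p := by
  intro h'
  have h1 := (iterate_succ_eq_iff h 1).1 h'
  rw [hv] at h1
  omega

theorem Internal.succ_succ_ne {v p : T.V} (hv : T.Internal v) (h : T.graph.Adj v p) :
    T.succ v (T.succ v p) ≠ p := by
  intro h'
  have h1 := (iterate_succ_eq_iff h 2).1 h'
  rw [hv] at h1
  omega

theorem Internal.succ_succ_succ {v p : T.V} (hv : T.Internal v) (h : T.graph.Adj v p) :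
    T.succ v (T.succ v (T.succ v p)) = p :=
  (iterate_succ_eq_iff h 3).2 (by rw [hv])

theorem eq_of_ncard_eq_one {v p q : T.V} (h : T.graph.Adj v p) (h' : T.graph.Adj v q)
    (hv : (T.graph.neighborSet v).ncard = 1) : q = p := by
  obtain ⟨a, ha⟩ := Set.ncard_eq_one.1 hv
  have h1 : p ∈ T.graph.neighborSet v := h
  have h2 : q ∈ T.graph.neighborSet v := h'
  rw [ha] at h1 h2
  rw [h1, h2]

theorem Internal.neighbor_cases {v p q : T.V} (hv : T.Internal v) (h : T.graph.Adj v p)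
    (h' : T.graph.Adj v q) : q = p ∨ q = T.succ v p ∨ q = T.succ v (T.succ v p) := by
  have := T.finite
  have h1 := adj_succ h
  have h2 := adj_succ h1
  have hs : ({p, T.succ v p, T.succ v (T.succ v p)} : Set T.V) = T.graph.neighborSet v := by
    apply Set.eq_of_subset_of_ncard_le
    · rintro x (rfl | rfl | rfl) <;> assumption
    · rw [hv, Set.ncard_eq_three.2 ⟨_, _, _, (hv.succ_ne h).symm, (hv.succ_succ_ne h).symm,
        (hv.succ_ne h1).symm, rfl⟩]
    · exact Set.toFinite _
  have h3 : q ∈ T.graph.neighborSet v := h'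
  rw [← hs] at h3
  exact h3

theorem internal_or (v : T.V) : (T.graph.neighborSet v).ncard = 1 ∨ T.Internal v := T.degree_eq v

theorem isBranch_leaf_iff {p v : T.V} : T.IsBranch p v leaf ↔
    T.graph.Adj v p ∧ (T.graph.neighborSet v).ncard = 1 := by
  constructor
  · rintro ⟨h, hv⟩; exact ⟨h, hv⟩
  · rintro ⟨h, hv⟩; exact .leaf h hv

theorem isBranch_node_iff {p v : T.V} {s t : BinTree} : T.IsBranch p v (node s t) ↔
    T.graph.Adj v p ∧ T.Internal v ∧ T.IsBranch v (T.succ v p) s ∧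
      T.IsBranch v (T.succ v (T.succ v p)) t := by
  constructor
  · rintro (_ | ⟨h, hv, hs, ht⟩)
    rw [next_eq_succ] at hs
    rw [next_val_eq_succ, next_eq_succ] at ht
    exact ⟨h, hv, hs, ht⟩
  · rintro ⟨h, hv, hs, ht⟩
    refine .node h hv ?_ ?_
    · rwa [next_eq_succ]
    · rwa [next_val_eq_succ, next_eq_succ]

theorem IsBranch.adj {p v : T.V} {t : BinTree} (h : T.IsBranch p v t) : T.graph.Adj v p := by
  cases h <;> assumption

theorem IsBranch.unique {p v : T.V} {t t' : BinTree} (h : T.IsBranch p v t)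
    (h' : T.IsBranch p v t') : t = t' := by
  induction t generalizing p v t' with
  | leaf =>
    rw [isBranch_leaf_iff] at h
    cases t' with
    | leaf => rfl
    | node a b =>
      have := (isBranch_node_iff.1 h').2.1
      rw [Internal, h.2] at this
      omega
  | node a b iha ihb =>
    rw [isBranch_node_iff] at h
    cases t' with
    | leaf =>
      have := h.2.1
      rw [Internal, (isBranch_leaf_iff.1 h').2] at this
      omega
    | node a' b' =>
      rw [isBranch_node_iff] at h'
      rw [iha h.2.2.1 h'.2.2.1, ihb h.2.2.2 h'.2.2.2]

theorem exists_isBranch {p v : T.V} (h : T.graph.Adj v p) : ∃ t, T.IsBranch p v t := by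
  have := T.finite
  have := Fintype.ofFinite T.V
  -- Here `q` is a path arriving at `v` from its parent. By acyclicity any other neighbour prolongs
  -- it, and a path has fewer edges than there are vertices; the induction is on the difference `k`.
  have key : ∀ (k : ℕ) (u v : T.V) (q : T.graph.Walk u v), q.IsPath → ¬ q.Nil →
      q.length + k = Fintype.card T.V → ∃ t, T.IsBranch q.penultimate v t := by
    intro k
    induction k with
    | zero =>
      intro u v q hq _ hl
      have := hq.length_lt
      omega
    | succ k ih =>
      intro u v q hq hnil hl
      have hadj : T.graph.Adj v q.penultimate := (q.adj_penultimate hnil).symm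
      rcases internal_or v with hv | hv
      · exact ⟨_, .leaf hadj hv⟩
      · have hstep : ∀ a, T.graph.Adj v a → a ≠ q.penultimate → ∃ t, T.IsBranch v a t := by
          intro a ha hne
          have hns : a ∉ q.support := fun hs =>
            hne (T.isTree.isAcyclic.eq_penultimate_of_adj_end hq ha hs)
          have := ih u a (q.concat ha) (hq.concat hns ha)
            (SimpleGraph.Walk.not_nil_of_ne fun h => hns (h ▸ q.start_mem_support))
            (by rw [SimpleGraph.Walk.length_concat]; omega)
          simpa using this
        obtain ⟨s, hs⟩ := hstep _ (adj_succ hadj) (hv.succ_ne hadj)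
        obtain ⟨t, ht⟩ := hstep _ (adj_succ (adj_succ hadj)) (hv.succ_succ_ne hadj)
        exact ⟨node s t, isBranch_node_iff.2 ⟨hadj, hv, hs, ht⟩⟩
  have hp : (SimpleGraph.Walk.cons h.symm .nil).IsPath := by
    simp [h.ne']
  have hlt := hp.length_lt
  have := key (Fintype.card T.V - 1) p v (.cons h.symm .nil) hp (by simp) (by
    simp at hlt ⊢; omega)
  simpa using this

/-- The two branches at the edge between `p` and `v`. -/
def DartPair (T : PlaneTree) (p v : T.V) (c : BinTree × BinTree) : Prop :=
  T.IsBranch p v c.1 ∧ T.IsBranch v p c.2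

theorem DartPair.unique {p v : T.V} {c c' : BinTree × BinTree} (h : T.DartPair p v c)
    (h' : T.DartPair p v c') : c = c' :=
  Prod.ext (h.1.unique h'.1) (h.2.unique h'.2)

theorem exists_dartPair {p v : T.V} (h : T.graph.Adj v p) : ∃ c, T.DartPair p v c := by
  obtain ⟨s, hs⟩ := exists_isBranch h
  obtain ⟨t, ht⟩ := exists_isBranch h.symm
  exact ⟨(s, t), hs, ht⟩

/-- At a leaf the walk turns back. At an internal vertex it proceeds to the left branch, and what
lies behind it is the right branch together with the old rear part. -/
theorem DartPair.faceStep {p v : T.V} {c : BinTree × BinTree} (h : T.DartPair p v c) :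
    T.DartPair v (T.succ v p) (faceStep c) := by
  obtain ⟨P, Q⟩ := c
  obtain ⟨h1, h2⟩ := h
  cases P with
  | leaf =>
    have := isBranch_leaf_iff.1 h1
    rw [succ_of_ncard_eq_one this.1 this.2]
    exact ⟨h2, h1⟩
  | node a b =>
    have h3 := isBranch_node_iff.1 h1
    refine ⟨h3.2.2.1, isBranch_node_iff.2 ⟨adj_succ h3.1, h3.2.1, h3.2.2.2, ?_⟩⟩
    rw [h3.2.1.succ_succ_succ h3.1]
    exact h2

/-- Reachability of darts along the face. -/
def FaceReach (T : PlaneTree) : T.V × T.V → T.V × T.V → Prop :=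
  Relation.ReflTransGen fun d e => e = (d.2, T.succ d.2 d.1)

/-- Walking along the face goes all the way around a branch and comes back through the edge by which
it entered. -/
theorem IsBranch.faceReach {p v : T.V} {t : BinTree} (h : T.IsBranch p v t) :
    T.FaceReach (p, v) (v, p) := by
  induction t generalizing p v with
  | leaf =>
    have := isBranch_leaf_iff.1 h
    refine .single ?_
    simp [succ_of_ncard_eq_one this.1 this.2]
  | node s t ihs iht =>
    obtain ⟨h0, hv, hs, ht⟩ := isBranch_node_iff.1 h
    have h1 : T.FaceReach (p, v) (v, T.succ v p) := .single rfl
    have h2 : T.FaceReach (T.succ v p, v) (v, T.succ v (T.succ v p)) := .single rfl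
    have h3 : T.FaceReach (T.succ v (T.succ v p), v) (v, p) := .single (by
      simp [hv.succ_succ_succ h0])
    exact h1.trans ((ihs hs).trans (h2.trans ((iht ht).trans h3)))

theorem faceReach_swap {p v : T.V} (h : T.graph.Adj p v) : T.FaceReach (p, v) (v, p) := by
  obtain ⟨t, ht⟩ := exists_isBranch h.symm
  exact ht.faceReach

theorem faceReach_of_adj {v p q : T.V} (hp : T.graph.Adj v p) (hq : T.graph.Adj v q) :
    T.FaceReach (v, p) (v, q) := by
  have step : ∀ {w}, T.graph.Adj v w → T.FaceReach (v, w) (v, T.succ v w) := fun h =>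
    (faceReach_swap h).tail rfl
  rcases internal_or v with hv | hv
  · rw [eq_of_ncard_eq_one hp hq hv]; exact .refl
  · rcases hv.neighbor_cases hp hq with rfl | rfl | rfl
    · exact .refl
    · exact step hp
    · exact (step hp).trans (step (adj_succ hp))

/-- A plane tree has a single face: oriented edges starting at one vertex reach each other by going
around branches, and a walk in the tree carries this from vertex to vertex. -/
theorem faceReach {p v p' v' : T.V} (h : T.graph.Adj p v) (h' : T.graph.Adj p' v') :
    T.FaceReach (p, v) (p', v') := by
  obtain ⟨q⟩ := T.isTree.connected p p'
  induction q generalizing v with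
  | nil => exact faceReach_of_adj h h'
  | cons hadj _ ih =>
    exact (faceReach_of_adj h hadj).trans ((faceReach_swap hadj).trans (ih hadj.symm h'))

theorem DartPair.exists_of_faceReach {d e : T.V × T.V} (h : T.FaceReach d e)
    {c : BinTree × BinTree} (hd : T.DartPair d.1 d.2 c) :
    ∃ c' : BinTree × BinTree, T.DartPair e.1 e.2 c' ∧
      faceClass c.1 c.2 = faceClass c'.1 c'.2 := by
  induction h with
  | refl => exact ⟨c, hd, rfl⟩
  | tail _ h ih =>
    obtain ⟨c', h1, h2⟩ := ih
    subst h
    exact ⟨_, h1.faceStep, h2.trans (Quot.sound rfl)⟩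

theorem faceClass_eq_of_dartPair {p v p' v' : T.V} {c c' : BinTree × BinTree}
    (h : T.DartPair p v c) (h' : T.DartPair p' v' c') :
    faceClass c.1 c.2 = faceClass c'.1 c'.2 := by
  obtain ⟨c'', h1, h2⟩ := DartPair.exists_of_faceReach (d := (p, v)) (e := (p', v'))
    (faceReach h.2.adj h'.2.adj) h
  rw [h2, h1.unique h']

end PlaneTree

theorem faceStep_injective : Function.Injective faceStep := by
  rintro ⟨_ | ⟨a, b⟩, q⟩ ⟨_ | ⟨a', b'⟩, q'⟩ h <;> simp_all

namespace PlaneTree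

variable {T : PlaneTree}

theorem exists_succ_eq {v p : T.V} (h : T.graph.Adj v p) :
    ∃ q, T.graph.Adj v q ∧ T.succ v q = p := by
  refine ⟨((T.next v).symm ⟨p, h⟩).1, ((T.next v).symm ⟨p, h⟩).2, ?_⟩
  rw [← next_val_eq_succ, Equiv.apply_symm_apply]

theorem exists_dartPair_of_faceClass_eq {p v : T.V} {c c' : BinTree × BinTree}
    (h : T.DartPair p v c) (hc : faceClass c.1 c.2 = faceClass c'.1 c'.2) :
    ∃ p' v', T.DartPair p' v' c' := by
  have key : ∀ c c' : BinTree × BinTree, Relation.EqvGen (fun p q => q = faceStep p) c c' →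
      ((∃ p v, T.DartPair p v c) ↔ ∃ p v, T.DartPair p v c') := by
    intro c c' h
    induction h with
    | rel c c' h =>
      subst h
      constructor
      · rintro ⟨p, v, h⟩
        exact ⟨_, _, h.faceStep⟩
      · rintro ⟨p, v, h⟩
        -- Backwards: the pair at the preceding oriented edge has the given pair as its step, so by
        -- injectivity of `faceStep` it is `c`.
        obtain ⟨q, hq, rfl⟩ := exists_succ_eq h.2.adj
        obtain ⟨c'', hc''⟩ := exists_dartPair hq
        exact ⟨q, p, faceStep_injective (h.unique hc''.faceStep) ▸ hc''⟩
    | refl => rfl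
    | symm _ _ _ ih => exact ih.symm
    | trans _ _ _ _ _ ih ih' => exact ih.trans ih'
  exact (key c c' (Quot.eqvGen_exact hc)).1 ⟨p, v, h⟩

end PlaneTree

/-! ### The plane trivalent tree of a pair of binary trees -/

/-- The vertices of a binary tree. -/
inductive Pos : BinTree → Type
  | root {t : BinTree} : Pos t
  | left {s t : BinTree} : Pos s → Pos (node s t)
  | right {s t : BinTree} : Pos t → Pos (node s t)

namespace Pos

/-- The binary tree below a vertex. -/
def sub : {t : BinTree} → Pos t → BinTree
  | t, root => t
  | _, left x => x.sub
  | _, right x => x.sub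

/-- The parent of a vertex. -/
def parent : {t : BinTree} → Pos t → Option (Pos t)
  | _, root => none
  | _, left x => some (x.parent.elim root left)
  | _, right x => some (x.parent.elim root right)

/-- The left and the right child of an inner node. -/
def kids : {t : BinTree} → Pos t → Option (Pos t × Pos t)
  | leaf, root => none
  | node _ _, root => some (left root, right root)
  | _, left x => x.kids.map (Prod.map left left)
  | _, right x => x.kids.map (Prod.map right right)

/-- The distance from the root. -/
def depth : {t : BinTree} → Pos t → ℕ
  | _, root => 0
  | _, left x => x.depth + 1
  | _, right x => x.depth + 1

theorem depth_parent {t : BinTree} {x y : Pos t} (h : x.parent = some y) :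
    y.depth < x.depth := by
  induction x with
  | root => simp [parent] at h
  | left x ih =>
    simp [parent] at h
    subst h
    cases hx : x.parent with
    | none => simp [depth]
    | some z => simpa [depth] using ih hx
  | right x ih =>
    simp [parent] at h
    subst h
    cases hx : x.parent with
    | none => simp [depth]
    | some z => simpa [depth] using ih hx

theorem parent_eq_none_iff {t : BinTree} {x : Pos t} : x.parent = none ↔ x = root := by
  cases x <;> simp [parent]

theorem kids_none_iff {t : BinTree} {x : Pos t} : x.kids = none ↔ x.sub = leaf := by
  induction x with
  | @root t => cases t <;> simp [kids, sub]
  | left x ih => simpa [kids, sub] using ih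
  | right x ih => simpa [kids, sub] using ih

theorem kids_spec {t : BinTree} {x l r : Pos t} (h : x.kids = some (l, r)) :
    x.sub = node l.sub r.sub ∧ l.parent = some x ∧ r.parent = some x ∧ l ≠ r := by
  induction x with
  | @root t =>
    cases t with
    | leaf => simp [kids] at h
    | node a b =>
      simp [kids] at h
      obtain ⟨rfl, rfl⟩ := h
      simp [sub, parent]
  | left x ih =>
    simp [kids, Option.map_eq_some_iff] at h
    obtain ⟨l, r, h, rfl, rfl⟩ := h
    have := ih h
    simp [sub, parent, this]
  | right x ih =>
    simp [kids, Option.map_eq_some_iff] at h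
    obtain ⟨l, r, h, rfl, rfl⟩ := h
    have := ih h
    simp [sub, parent, this]

theorem kids_of_parent {t : BinTree} {x y : Pos t} (h : y.parent = some x) :
    ∃ l r, x.kids = some (l, r) ∧ (y = l ∨ y = r) := by
  induction y with
  | root => simp [parent] at h
  | left y ih =>
    simp [parent] at h
    subst h
    cases hy : y.parent with
    | none =>
      rw [parent_eq_none_iff] at hy
      subst hy
      exact ⟨_, _, rfl, Or.inl rfl⟩
    | some z =>
      obtain ⟨l, r, h, h'⟩ := ih hy
      refine ⟨left l, left r, by simp [kids, h], ?_⟩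
      simpa using h'
  | right y ih =>
    simp [parent] at h
    subst h
    cases hy : y.parent with
    | none =>
      rw [parent_eq_none_iff] at hy
      subst hy
      exact ⟨_, _, rfl, Or.inr rfl⟩
    | some z =>
      obtain ⟨l, r, h, h'⟩ := ih hy
      refine ⟨right l, right r, by simp [kids, h], ?_⟩
      simpa using h'

instance finite (t : BinTree) : Finite (Pos t) := by
  induction t with
  | leaf => exact Finite.of_surjective (fun _ : Unit => root) (by rintro ⟨⟩; exact ⟨(), rfl⟩)
  | node s t ihs iht =>
    refine Finite.of_surjective
      (fun x : Option (Pos s ⊕ Pos t) => x.elim root (Sum.elim left right)) ?_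
    rintro (_ | x | x)
    · exact ⟨none, rfl⟩
    · exact ⟨some (Sum.inl x), rfl⟩
    · exact ⟨some (Sum.inr x), rfl⟩

theorem ncard_kids_ne_none (t : BinTree) : {x : Pos t | x.kids ≠ none}.ncard = t.size := by
  induction t with
  | leaf =>
    rw [show {x : Pos leaf | x.kids ≠ none} = ∅ by ext x; cases x; simp [kids]]
    simp
  | node s t ihs iht =>
    have h : {x : Pos (node s t) | x.kids ≠ none} =
        insert root (left '' {x : Pos s | x.kids ≠ none} ∪ right '' {x : Pos t | x.kids ≠ none}) := by
      ext x
      cases x <;> simp [kids]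
    rw [h, Set.ncard_insert_of_notMem (by simp), Set.ncard_union_eq,
      Set.ncard_image_of_injective _ (fun _ _ h => by simpa using h),
      Set.ncard_image_of_injective _ (fun _ _ h => by simpa using h), ihs, iht]
    · simp
    · rw [Set.disjoint_left]
      rintro _ ⟨x, -, rfl⟩
      simp

end Pos

/-- The vertices of the tree obtained from two binary trees by joining their roots. -/
abbrev PairPos (P Q : BinTree) : Type := Pos P ⊕ Pos Q

namespace PairPos

variable {P Q : BinTree}

/-- The parent of a vertex; the two roots are the parents of each other. -/
def up : PairPos P Q → PairPos P Q
  | Sum.inl x => x.parent.elim (Sum.inr .root) Sum.inl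
  | Sum.inr x => x.parent.elim (Sum.inl .root) Sum.inr

/-- The left and the right child of an inner node. -/
def kids : PairPos P Q → Option (PairPos P Q × PairPos P Q)
  | Sum.inl x => x.kids.map (Prod.map Sum.inl Sum.inl)
  | Sum.inr x => x.kids.map (Prod.map Sum.inr Sum.inr)

/-- The binary tree below a vertex. -/
def sub : PairPos P Q → BinTree
  | Sum.inl x => x.sub
  | Sum.inr x => x.sub

theorem kids_none_iff {x : PairPos P Q} : x.kids = none ↔ x.sub = leaf := by
  cases x <;> simp [kids, sub, Pos.kids_none_iff]

theorem up_ne (x : PairPos P Q) : x.up ≠ x := by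
  intro h
  rcases x with x | x <;>
  · cases hx : x.parent with
    | none => simp [up, hx] at h
    | some y =>
      simp [up, hx] at h
      subst h
      exact lt_irrefl _ (Pos.depth_parent hx)

theorem kids_spec {x l r : PairPos P Q} (h : x.kids = some (l, r)) :
    x.sub = node l.sub r.sub ∧ l.up = x ∧ r.up = x ∧ l ≠ r ∧ l ≠ x.up ∧ r ≠ x.up := by
  rcases x with x | x <;>
  · simp [kids, Option.map_eq_some_iff] at h
    obtain ⟨l, r, h, rfl, rfl⟩ := h
    obtain ⟨h1, h2, h3, h4⟩ := Pos.kids_spec h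
    refine ⟨h1, by simp [up, h2], by simp [up, h3], by simpa using h4, ?_, ?_⟩ <;>
    · intro h'
      cases hx : x.parent with
      | none => simp [up, hx] at h'
      | some y =>
        simp [up, hx] at h'
        subst h'
        have d1 := Pos.depth_parent hx
        have d2 := Pos.depth_parent h2
        have d3 := Pos.depth_parent h3
        omega

theorem of_up_eq {x y : PairPos P Q} (h : y.up = x) :
    y = x.up ∨ ∃ l r, x.kids = some (l, r) ∧ (y = l ∨ y = r) := by
  subst h
  rcases y with y | y <;>
  · cases hy : y.parent with
    | none =>
      rw [Pos.parent_eq_none_iff] at hy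
      subst hy
      exact Or.inl rfl
    | some z =>
      obtain ⟨l, r, h, h'⟩ := Pos.kids_of_parent hy
      right
      simp [up, hy, kids, h]
      exact h'

variable (P Q) in
/-- The tree obtained by joining the roots of two binary trees. -/
def graph : SimpleGraph (PairPos P Q) where
  Adj x y := x.up = y ∨ y.up = x
  symm := ⟨fun _ _ h => h.symm⟩
  loopless := ⟨fun x h => x.up_ne (h.elim id id)⟩

theorem adj_up (x : PairPos P Q) : (graph P Q).Adj x x.up := Or.inl rfl

theorem adj_iff_of_leaf {x y : PairPos P Q} (h : x.kids = none) :
    (graph P Q).Adj x y ↔ y = x.up := by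
  constructor
  · rintro (h' | h')
    · exact h'.symm
    · rcases of_up_eq h' with h' | ⟨l, r, h', -⟩
      · exact h'
      · simp [h] at h'
  · rintro rfl; exact adj_up x

theorem adj_iff_of_node {x y l r : PairPos P Q} (h : x.kids = some (l, r)) :
    (graph P Q).Adj x y ↔ y = x.up ∨ y = l ∨ y = r := by
  constructor
  · rintro (h' | h')
    · exact Or.inl h'.symm
    · rcases of_up_eq h' with h' | ⟨l', r', h', h''⟩
      · exact Or.inl h'
      · simp [h] at h'
        obtain ⟨rfl, rfl⟩ := h'
        exact Or.inr h''
  · have := kids_spec h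
    rintro (rfl | rfl | rfl)
    · exact adj_up x
    · exact Or.inr this.2.1
    · exact Or.inr this.2.2.1

theorem isTree (P Q : BinTree) : (graph P Q).IsTree := by
  have hl : ∀ k (x : Pos P), x.depth = k →
      (graph P Q).Reachable (Sum.inl x) (Sum.inl .root) := by
    intro k
    induction k using Nat.strong_induction_on with
    | _ k ih =>
      intro x hx
      cases hp : x.parent with
      | none => rw [Pos.parent_eq_none_iff] at hp; rw [hp]
      | some y =>
        have h1 := adj_up (Sum.inl x : PairPos P Q)
        simp only [up, hp, Option.elim_some] at h1
        exact h1.reachable.trans (ih _ (hx ▸ Pos.depth_parent hp) y rfl)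
  have hr : ∀ k (x : Pos Q), x.depth = k →
      (graph P Q).Reachable (Sum.inr x) (Sum.inl .root) := by
    intro k
    induction k using Nat.strong_induction_on with
    | _ k ih =>
      intro x hx
      have h1 := adj_up (Sum.inr x : PairPos P Q)
      cases hp : x.parent with
      | none =>
        simp only [up, hp, Option.elim_none] at h1
        exact h1.reachable
      | some y =>
        simp only [up, hp, Option.elim_some] at h1
        exact h1.reachable.trans (ih _ (hx ▸ Pos.depth_parent hp) y rfl)
  have hroot : ∀ x : PairPos P Q, (graph P Q).Reachable x (Sum.inl .root) := by
    rintro (x | x)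
    · exact hl _ x rfl
    · exact hr _ x rfl
  have hconn : (graph P Q).Connected :=
    { preconnected := fun x y => (hroot x).trans (hroot y).symm
      nonempty := ⟨Sum.inl .root⟩ }
  rw [SimpleGraph.isTree_iff_connected_and_card]
  refine ⟨hconn, le_antisymm ?_ hconn.card_vert_le_card_edgeSet_add_one⟩
  -- Every edge joins a vertex to its parent, and the edge between the two roots arises from both of
  -- them. One root can be omitted, so there are at most |V| - 1 edges, which with connectedness
  -- gives a tree.
  have hsub : (graph P Q).edgeSet ⊆ (fun x : PairPos P Q => s(x, x.up)) '' {Sum.inl .root}ᶜ := by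
    intro e he
    induction e using Sym2.ind with
    | _ x y =>
      have key : ∀ x : PairPos P Q, s(x, x.up) ∈
          (fun x : PairPos P Q => s(x, x.up)) '' {Sum.inl .root}ᶜ := by
        intro x
        by_cases hx : x = Sum.inl .root
        · subst hx
          exact ⟨Sum.inr .root, by simp, by simp [up, Pos.parent]⟩
        · exact ⟨x, hx, rfl⟩
      have he' : x.up = y ∨ y.up = x := he
      rcases he' with rfl | rfl
      · exact key x
      · rw [Sym2.eq_swap]; exact key y
  have h1 := Set.ncard_le_ncard hsub (Set.toFinite _)
  have h2 := Set.ncard_image_le (f := fun x : PairPos P Q => s(x, x.up))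
    (Set.toFinite ({Sum.inl .root}ᶜ : Set (PairPos P Q)))
  have h3 := Set.ncard_add_ncard_compl ({Sum.inl .root} : Set (PairPos P Q))
  rw [Set.ncard_singleton] at h3
  rw [Nat.card_coe_set_eq]
  omega

open Classical in
/-- The neighbour of `x` that follows `y`: the parent, the left and the right child of `x` follow
each other cyclically. -/
noncomputable def turn (x y : PairPos P Q) : PairPos P Q :=
  match x.kids with
  | none => y
  | some (l, r) => if y = x.up then l else if y = l then r else x.up

theorem turn_of_leaf {x y : PairPos P Q} (h : x.kids = none) : turn x y = y := by
  simp [turn, h]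

theorem turn_of_node {x l r : PairPos P Q} (h : x.kids = some (l, r)) :
    turn x x.up = l ∧ turn x l = r ∧ turn x r = x.up := by
  have := kids_spec h
  simp [turn, h, this.2.2.2.1.symm, this.2.2.2.2.1, this.2.2.2.2.2]

theorem adj_turn {x y : PairPos P Q} (h : (graph P Q).Adj x y) :
    (graph P Q).Adj x (turn x y) := by
  cases hk : x.kids with
  | none => rwa [turn_of_leaf hk]
  | some lr =>
    obtain ⟨l, r⟩ := lr
    have ht := turn_of_node hk
    rw [adj_iff_of_node hk] at h ⊢
    rcases h with rfl | rfl | rfl <;> simp [ht]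

/-- At a leaf `turn` is the identity, so its cube is the identity for both degrees and its square
can serve as the inverse. -/
theorem turn_turn_turn {x y : PairPos P Q} (h : (graph P Q).Adj x y) :
    turn x (turn x (turn x y)) = y := by
  cases hk : x.kids with
  | none => simp [turn_of_leaf hk]
  | some lr =>
    obtain ⟨l, r⟩ := lr
    have ht := turn_of_node hk
    rw [adj_iff_of_node hk] at h
    rcases h with rfl | rfl | rfl <;> simp [ht]

/-- The cyclic ordering of the neighbours of a vertex. -/
noncomputable def turnPerm (x : PairPos P Q) : Equiv.Perm ((graph P Q).neighborSet x) where
  toFun y := ⟨turn x y.1, adj_turn y.2⟩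
  invFun y := ⟨turn x (turn x y.1), adj_turn (adj_turn y.2)⟩
  left_inv y := Subtype.ext (turn_turn_turn y.2)
  right_inv y := Subtype.ext (turn_turn_turn y.2)

theorem turnPerm_isCycleOn (x : PairPos P Q) : (turnPerm x).IsCycleOn Set.univ := by
  refine ⟨Set.bijOn_univ.2 (turnPerm x).bijective, ?_⟩
  have hup : ∀ y : (graph P Q).neighborSet x, (turnPerm x).SameCycle ⟨x.up, adj_up x⟩ y := by
    rintro ⟨y, hy⟩
    cases hk : x.kids with
    | none =>
      obtain rfl := (adj_iff_of_leaf hk).1 hy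
      exact .rfl
    | some lr =>
      obtain ⟨l, r⟩ := lr
      have ht := turn_of_node hk
      rcases (adj_iff_of_node hk).1 hy with rfl | rfl | rfl
      · exact .rfl
      · exact ⟨1, Subtype.ext (by simp [turnPerm, ht])⟩
      · refine ⟨2, Subtype.ext ?_⟩
        rw [zpow_ofNat, pow_two, Equiv.Perm.mul_apply]
        simp [turnPerm, ht]
  intro y _ z _
  exact (hup y).symm.trans (hup z)

theorem ncard_neighborSet (x : PairPos P Q) :
    ((graph P Q).neighborSet x).ncard = if x.kids = none then 1 else 3 := by
  cases hk : x.kids with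
  | none =>
    rw [show (graph P Q).neighborSet x = {x.up} by ext y; simp [adj_iff_of_leaf hk]]
    simp
  | some lr =>
    obtain ⟨l, r⟩ := lr
    have := kids_spec hk
    rw [show (graph P Q).neighborSet x = {x.up, l, r} by ext y; simp [adj_iff_of_node hk],
      Set.ncard_eq_three.2 ⟨_, _, _, this.2.2.2.2.1.symm, this.2.2.2.2.2.symm, this.2.2.2.1, rfl⟩]
    simp

end PairPos

/-- The plane trivalent tree obtained by joining the roots of two binary trees. -/
noncomputable def pairTree (P Q : BinTree) : PlaneTree where
  V := PairPos P Q
  finite := inferInstance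
  graph := PairPos.graph P Q
  isTree := PairPos.isTree P Q
  degree_eq x := by rw [PairPos.ncard_neighborSet]; split_ifs <;> simp
  next := PairPos.turnPerm
  next_cyclic := PairPos.turnPerm_isCycleOn

namespace PairPos

variable {P Q : BinTree}

theorem succ_eq {x y : PairPos P Q} (h : (graph P Q).Adj x y) :
    (pairTree P Q).succ x y = turn x y :=
  (PlaneTree.next_eq_succ (T := pairTree P Q) h).symm

theorem internal_iff (x : PairPos P Q) : (pairTree P Q).Internal x ↔ x.kids ≠ none := by
  change ((graph P Q).neighborSet x).ncard = 3 ↔ _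
  rw [ncard_neighborSet]
  split_ifs with h <;> simp [h]

theorem numInternal_pairTree (P Q : BinTree) :
    (pairTree P Q).numInternal = P.size + Q.size := by
  have h : {x : PairPos P Q | ((graph P Q).neighborSet x).ncard = 3} =
      Sum.inl '' {x : Pos P | x.kids ≠ none} ∪ Sum.inr '' {x : Pos Q | x.kids ≠ none} := by
    ext x
    rw [Set.mem_ofPred_eq, ncard_neighborSet]
    rcases x with x | x <;> simp [kids]
  change Set.ncard {x : PairPos P Q | ((graph P Q).neighborSet x).ncard = 3} = _
  rw [h, Set.ncard_union_eq,
    Set.ncard_image_of_injective _ Sum.inl_injective,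
    Set.ncard_image_of_injective _ Sum.inr_injective, Pos.ncard_kids_ne_none,
    Pos.ncard_kids_ne_none]
  rw [Set.disjoint_left]
  rintro _ ⟨x, -, rfl⟩
  simp

theorem isBranch_sub (x : PairPos P Q) : (pairTree P Q).IsBranch x.up x x.sub := by
  generalize ht : x.sub = t
  induction t generalizing x with
  | leaf =>
    refine .leaf (adj_up x) ?_
    change ((graph P Q).neighborSet x).ncard = 1
    rw [ncard_neighborSet, if_pos (kids_none_iff.2 ht)]
  | node a b iha ihb =>
    cases hk : x.kids with
    | none => rw [kids_none_iff.1 hk] at ht; simp at ht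
    | some lr =>
      obtain ⟨l, r⟩ := lr
      obtain ⟨h1, h2, h3, -⟩ := kids_spec hk
      have h4 := turn_of_node hk
      rw [ht] at h1
      simp only [BinTree.node.injEq] at h1
      refine PlaneTree.isBranch_node_iff.2 ⟨adj_up x, (internal_iff x).2 (by simp [hk]), ?_, ?_⟩
      · rw [succ_eq (adj_up x), h4.1]
        have := iha l h1.1.symm
        rwa [h2] at this
      · rw [succ_eq (adj_up x), h4.1, succ_eq (Or.inr h2), h4.2.1]
        have := ihb r h1.2.symm
        rwa [h3] at this

theorem dartPair_pairTree (P Q : BinTree) : (pairTree P Q).DartPair (Sum.inr .root)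
    (Sum.inl .root) (P, Q) :=
  ⟨isBranch_sub (Sum.inl .root : PairPos P Q), isBranch_sub (Sum.inr .root : PairPos P Q)⟩

end PairPos

/-- A locally injective homomorphism from a connected to an acyclic graph is injective. -/
theorem injective_of_locally_injective {V W : Type} {G : SimpleGraph V} {H : SimpleGraph W}
    (hG : G.Connected) (hH : H.IsAcyclic) (f : G →g H)
    (hf : ∀ x y z, G.Adj x y → G.Adj x z → f y = f z → y = z) : Function.Injective f := by
  -- If the image of a path returned to its start, acyclicity of `H` would make its second step undo
  -- the first; local injectivity would then do the same to the path itself.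
  have key : ∀ {x y : V} (p : G.Walk x y), p.IsPath → (p.map f).IsPath := by
    intro x y p
    induction p with
    | nil => simp
    | @cons x z y h p ih =>
      intro hp
      rw [SimpleGraph.Walk.cons_isPath_iff] at hp
      have hp' := ih hp.1
      rw [SimpleGraph.Walk.map_cons, SimpleGraph.Walk.cons_isPath_iff]
      refine ⟨hp', fun hmem => ?_⟩
      have h1 := hH.eq_snd_of_adj_start hp' (f.map_adj h.symm) hmem
      cases p with
      | nil => simp at h1; exact (f.map_adj h).ne h1
      | cons h' p' =>
        simp at h1
        have := hf _ _ _ h.symm h' h1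
        subst this
        exact hp.2 (by simp)
  intro x y hxy
  obtain ⟨p, hp⟩ := (hG.preconnected x y).exists_isPath
  have hp' := key p hp
  cases p with
  | nil => rfl
  | cons h p =>
    rw [SimpleGraph.Walk.map_cons, SimpleGraph.Walk.cons_isPath_iff] at hp'
    exact absurd (by rw [hxy]; exact (p.map f).end_mem_support) hp'.2

-- Reconstruction of a plane trivalent tree from the two branches at an edge

namespace PlaneTree

variable {T : PlaneTree}

/-- The vertex of `T` at a given position of the branch at `v` with parent `p`. -/
noncomputable def loc (T : PlaneTree) : {t : BinTree} → T.V → T.V → Pos t → T.V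
  | _, _, v, .root => v
  | _, p, v, .left x => T.loc v (T.succ v p) x
  | _, p, v, .right x => T.loc v (T.succ v (T.succ v p)) x

theorem loc_kids {t : BinTree} (p v : T.V) {x l r : Pos t} (h : x.kids = some (l, r)) :
    T.loc p v l = T.succ (T.loc p v x) (x.parent.elim p (T.loc p v)) ∧
      T.loc p v r = T.succ (T.loc p v x) (T.loc p v l) := by
  induction x generalizing p v with
  | @root t =>
    cases t with
    | leaf => simp [Pos.kids] at h
    | node a b =>
      simp [Pos.kids] at h
      obtain ⟨rfl, rfl⟩ := h
      simp [loc, Pos.parent]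
  | left x ih =>
    simp [Pos.kids, Option.map_eq_some_iff] at h
    obtain ⟨l, r, h, rfl, rfl⟩ := h
    have := ih v (T.succ v p) h
    cases hx : x.parent <;> simpa [loc, Pos.parent, hx] using this
  | right x ih =>
    simp [Pos.kids, Option.map_eq_some_iff] at h
    obtain ⟨l, r, h, rfl, rfl⟩ := h
    have := ih v (T.succ v (T.succ v p)) h
    cases hx : x.parent <;> simpa [loc, Pos.parent, hx] using this

theorem IsBranch.loc {t : BinTree} {p v : T.V} (h : T.IsBranch p v t) (x : Pos t) :
    T.IsBranch (x.parent.elim p (T.loc p v)) (T.loc p v x) x.sub := by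
  induction x generalizing p v with
  | root => simpa [PlaneTree.loc, Pos.parent, Pos.sub] using h
  | left x ih =>
    have := ih (isBranch_node_iff.1 h).2.2.1
    cases hx : x.parent <;> simpa [PlaneTree.loc, Pos.parent, hx, Pos.sub] using this
  | right x ih =>
    have := ih (isBranch_node_iff.1 h).2.2.2
    cases hx : x.parent <;> simpa [PlaneTree.loc, Pos.parent, hx, Pos.sub] using this

/-- The vertex of `T` at a given position of the two branches at the edge between `p` and `v`. -/
noncomputable def pairLoc (T : PlaneTree) {P Q : BinTree} (p v : T.V) : PairPos P Q → T.V
  | Sum.inl x => T.loc p v x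
  | Sum.inr x => T.loc v p x

section

variable {P Q : BinTree} {p v : T.V}

theorem pairLoc_up_inl (x : Pos P) : T.pairLoc p v (PairPos.up (Sum.inl x : PairPos P Q)) =
    x.parent.elim p (T.loc p v) := by
  cases hx : x.parent <;> simp [PairPos.up, pairLoc, hx, loc]

theorem pairLoc_up_inr (x : Pos Q) : T.pairLoc p v (PairPos.up (Sum.inr x : PairPos P Q)) =
    x.parent.elim v (T.loc v p) := by
  cases hx : x.parent <;> simp [PairPos.up, pairLoc, hx, loc]

theorem pairLoc_kids {x l r : PairPos P Q} (h : x.kids = some (l, r)) :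
    T.pairLoc p v l = T.succ (T.pairLoc p v x) (T.pairLoc p v x.up) ∧
      T.pairLoc p v r = T.succ (T.pairLoc p v x) (T.pairLoc p v l) := by
  rcases x with x | x
  · rw [pairLoc_up_inl]
    simp [PairPos.kids, Option.map_eq_some_iff] at h
    obtain ⟨l, r, h, rfl, rfl⟩ := h
    exact loc_kids p v h
  · rw [pairLoc_up_inr]
    simp [PairPos.kids, Option.map_eq_some_iff] at h
    obtain ⟨l, r, h, rfl, rfl⟩ := h
    exact loc_kids v p h

theorem DartPair.isBranch (h : T.DartPair p v (P, Q)) (x : PairPos P Q) :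
    T.IsBranch (T.pairLoc p v x.up) (T.pairLoc p v x) x.sub := by
  rcases x with x | x
  · rw [pairLoc_up_inl]; exact h.1.loc x
  · rw [pairLoc_up_inr]; exact h.2.loc x

theorem DartPair.ncard_of_leaf (h : T.DartPair p v (P, Q)) {x : PairPos P Q}
    (hx : x.kids = none) : (T.graph.neighborSet (T.pairLoc p v x)).ncard = 1 := by
  have := h.isBranch x
  rw [PairPos.kids_none_iff.1 hx] at this
  exact (isBranch_leaf_iff.1 this).2

theorem DartPair.internal_of_node (h : T.DartPair p v (P, Q)) {x l r : PairPos P Q}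
    (hx : x.kids = some (l, r)) : T.Internal (T.pairLoc p v x) := by
  have := h.isBranch x
  rw [(PairPos.kids_spec hx).1] at this
  exact (isBranch_node_iff.1 this).2.1

theorem DartPair.adj_pairLoc (h : T.DartPair p v (P, Q)) {x y : PairPos P Q}
    (hxy : (PairPos.graph P Q).Adj x y) :
    T.graph.Adj (T.pairLoc p v x) (T.pairLoc p v y) := by
  have hxy' : x.up = y ∨ y.up = x := hxy
  rcases hxy' with rfl | rfl
  · exact (h.isBranch x).adj
  · exact (h.isBranch y).adj.symm

/-- Children were placed by iterating `succ`; the remaining turn, from the right child back to the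
parent, holds because three successors close up. -/
theorem DartPair.pairLoc_turn (h : T.DartPair p v (P, Q)) {x y : PairPos P Q}
    (hxy : (PairPos.graph P Q).Adj x y) :
    T.pairLoc p v (PairPos.turn x y) = T.succ (T.pairLoc p v x) (T.pairLoc p v y) := by
  cases hk : x.kids with
  | none =>
    rw [PairPos.turn_of_leaf hk, succ_of_ncard_eq_one (h.adj_pairLoc hxy) (h.ncard_of_leaf hk)]
  | some lr =>
    obtain ⟨l, r⟩ := lr
    have ht := PairPos.turn_of_node hk
    have hl := pairLoc_kids (T := T) (p := p) (v := v) hk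
    rcases (PairPos.adj_iff_of_node hk).1 hxy with rfl | rfl | rfl
    · rw [ht.1, hl.1]
    · rw [ht.2.1, hl.2]
    · rw [ht.2.2, hl.2, hl.1,
        (h.internal_of_node hk).succ_succ_succ (h.adj_pairLoc (PairPos.adj_up x))]

theorem DartPair.pairLoc_locally_injective (h : T.DartPair p v (P, Q)) (x y z : PairPos P Q)
    (hxy : (PairPos.graph P Q).Adj x y) (hxz : (PairPos.graph P Q).Adj x z)
    (hyz : T.pairLoc p v y = T.pairLoc p v z) : y = z := by
  cases hk : x.kids with
  | none => rw [(PairPos.adj_iff_of_leaf hk).1 hxy, (PairPos.adj_iff_of_leaf hk).1 hxz]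
  | some lr =>
    obtain ⟨l, r⟩ := lr
    have hi := h.internal_of_node hk
    have hl := pairLoc_kids (T := T) (p := p) (v := v) hk
    have hu := h.adj_pairLoc (PairPos.adj_up x)
    have h1 := hi.succ_ne hu
    have h2 := hi.succ_succ_ne hu
    have h3 := hi.succ_ne (adj_succ hu)
    rw [← hl.1] at h1 h2 h3
    rw [← hl.2] at h2 h3
    rcases (PairPos.adj_iff_of_node hk).1 hxy with rfl | rfl | rfl <;>
      rcases (PairPos.adj_iff_of_node hk).1 hxz with rfl | rfl | rfl <;>
      first
        | rfl
        | exact absurd hyz h1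
        | exact absurd hyz.symm h1
        | exact absurd hyz h2
        | exact absurd hyz.symm h2
        | exact absurd hyz h3
        | exact absurd hyz.symm h3

theorem DartPair.pairLoc_locally_surjective (h : T.DartPair p v (P, Q)) (x : PairPos P Q)
    {w : T.V} (hw : T.graph.Adj (T.pairLoc p v x) w) :
    ∃ y, (PairPos.graph P Q).Adj x y ∧ T.pairLoc p v y = w := by
  have hu := h.adj_pairLoc (PairPos.adj_up x)
  cases hk : x.kids with
  | none =>
    exact ⟨x.up, PairPos.adj_up x, (eq_of_ncard_eq_one hu hw (h.ncard_of_leaf hk)).symm⟩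
  | some lr =>
    obtain ⟨l, r⟩ := lr
    have hl := pairLoc_kids (T := T) (p := p) (v := v) hk
    rcases (h.internal_of_node hk).neighbor_cases hu hw with rfl | rfl | rfl
    · exact ⟨x.up, PairPos.adj_up x, rfl⟩
    · exact ⟨l, (PairPos.adj_iff_of_node hk).2 (by simp), hl.1⟩
    · exact ⟨r, (PairPos.adj_iff_of_node hk).2 (by simp), by rw [hl.2, hl.1]⟩

/-- The placement is bijective on neighbourhoods. It is injective because the target is acyclic, and
surjective because the target is connected. -/
theorem DartPair.pairLoc_bijective (h : T.DartPair p v (P, Q)) :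
    Function.Bijective (T.pairLoc p v : PairPos P Q → T.V) := by
  constructor
  · exact injective_of_locally_injective (PairPos.isTree P Q).connected T.isTree.isAcyclic
      ⟨T.pairLoc p v, fun hxy => h.adj_pairLoc hxy⟩ h.pairLoc_locally_injective
  · intro w
    have key : ∀ {a b : T.V}, T.graph.Walk a b → (∃ x : PairPos P Q, T.pairLoc p v x = a) →
        ∃ x : PairPos P Q, T.pairLoc p v x = b := by
      intro a b q
      induction q with
      | nil => exact id
      | cons hadj _ ih =>
        rintro ⟨x, rfl⟩
        obtain ⟨y, -, hy⟩ := h.pairLoc_locally_surjective x hadj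
        exact ih ⟨y, hy⟩
    obtain ⟨q⟩ := T.isTree.connected v w
    exact key q ⟨Sum.inl .root, rfl⟩

/-- A plane trivalent tree is isomorphic to the tree of the two branches at one of its edges. -/
noncomputable def DartPair.iso (h : T.DartPair p v (P, Q)) : (pairTree P Q).graph ≃g T.graph where
  toEquiv := Equiv.ofBijective _ h.pairLoc_bijective
  map_rel_iff' := by
    intro x y
    constructor
    · intro hxy
      obtain ⟨y', hy', h'⟩ := h.pairLoc_locally_surjective x hxy
      rwa [h.pairLoc_bijective.1 h'] at hy'
    · exact fun hxy => h.adj_pairLoc hxy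

theorem DartPair.iso_isIso (h : T.DartPair p v (P, Q)) : (pairTree P Q).IsIso T h.iso := by
  intro x y
  apply Subtype.ext
  rw [next_val_eq_succ]
  exact h.pairLoc_turn y.2

end

theorem DartPair.exists_iso {T T' : PlaneTree} {p v : T.V} {p' v' : T'.V}
    {c : BinTree × BinTree} (h : T.DartPair p v c) (h' : T'.DartPair p' v' c) :
    ∃ e : T.graph ≃g T'.graph, T.IsIso T' e ∧ e p = p' ∧ e v = v' := by
  have hp : h.iso.symm p = Sum.inr .root := h.iso.symm_apply_apply (Sum.inr .root)
  have hv : h.iso.symm v = Sum.inl .root := h.iso.symm_apply_apply (Sum.inl .root)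
  refine ⟨h.iso.symm.trans h'.iso, isIso_trans (isIso_symm h.iso_isIso) h'.iso_isIso, ?_, ?_⟩
  · change h'.iso (h.iso.symm p) = p'
    rw [hp]; rfl
  · change h'.iso (h.iso.symm v) = v'
    rw [hv]; rfl

theorem ncard_neighborSet_iso {T T' : PlaneTree} (e : T.graph ≃g T'.graph) (v : T.V) :
    (T'.graph.neighborSet (e v)).ncard = (T.graph.neighborSet v).ncard := by
  rw [← Nat.card_coe_set_eq, ← Nat.card_coe_set_eq]
  exact (Nat.card_congr (e.mapNeighborSet v)).symm

theorem numInternal_iso {T T' : PlaneTree} (e : T.graph ≃g T'.graph) :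
    T.numInternal = T'.numInternal := by
  have h : {v | T'.Internal v} = e '' {v | T.Internal v} := by
    ext v
    constructor
    · intro hv
      refine ⟨e.symm v, ?_, e.apply_symm_apply v⟩
      have hv' : (T'.graph.neighborSet v).ncard = 3 := hv
      rw [← e.apply_symm_apply v, ncard_neighborSet_iso] at hv'
      exact hv'
    · rintro ⟨w, hw, rfl⟩
      exact (ncard_neighborSet_iso e w).trans hw
  rw [numInternal, numInternal, h, Set.ncard_image_of_injective _ e.injective]

theorem DartPair.numInternal_eq {T : PlaneTree} {p v : T.V} {P Q : BinTree}
    (h : T.DartPair p v (P, Q)) : T.numInternal = P.size + Q.size := by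
  rw [← numInternal_iso h.iso, PairPos.numInternal_pairTree]

theorem IsIso.succ {T T' : PlaneTree} {e : T.graph ≃g T'.graph} (h : T.IsIso T' e) {v w : T.V}
    (hw : T.graph.Adj v w) : e (T.succ v w) = T'.succ (e v) (e w) := by
  have := congrArg Subtype.val (h v ⟨w, hw⟩)
  rw [next_val_eq_succ] at this
  rw [← next_eq_succ hw]
  exact this

theorem IsIso.isBranch {T T' : PlaneTree} {e : T.graph ≃g T'.graph} (h : T.IsIso T' e)
    {p v : T.V} {t : BinTree} (hb : T.IsBranch p v t) : T'.IsBranch (e p) (e v) t := by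
  induction t generalizing p v with
  | leaf =>
    rw [isBranch_leaf_iff] at hb ⊢
    exact ⟨e.map_adj_iff.2 hb.1, (ncard_neighborSet_iso e v).trans hb.2⟩
  | node a b iha ihb =>
    rw [isBranch_node_iff] at hb ⊢
    obtain ⟨h1, h2, h3, h4⟩ := hb
    refine ⟨e.map_adj_iff.2 h1, (ncard_neighborSet_iso e v).trans h2, ?_, ?_⟩
    · rw [← h.succ h1]; exact iha h3
    · rw [← h.succ h1, ← h.succ (adj_succ h1)]; exact ihb h4

theorem IsIso.dartPair {T T' : PlaneTree} {e : T.graph ≃g T'.graph} (h : T.IsIso T' e)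
    {p v : T.V} {c : BinTree × BinTree} (hb : T.DartPair p v c) :
    T'.DartPair (e p) (e v) c := ⟨h.isBranch hb.1, h.isBranch hb.2⟩

/-- Plane trivalent trees are isomorphic iff the branches at their edges belong to the same
class. -/
theorem exists_isIso_iff {T T' : PlaneTree} {p v : T.V} {p' v' : T'.V}
    {c c' : BinTree × BinTree} (h : T.DartPair p v c) (h' : T'.DartPair p' v' c') :
    (∃ e, T.IsIso T' e) ↔ faceClass c.1 c.2 = faceClass c'.1 c'.2 := by
  constructor
  · rintro ⟨e, he⟩
    exact faceClass_eq_of_dartPair (he.dartPair h) h'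
  · intro hc
    obtain ⟨q, w, hq⟩ := exists_dartPair_of_faceClass_eq h hc
    obtain ⟨e, he, -⟩ := hq.exists_iso h'
    exact ⟨e, he⟩

end PlaneTree

/-! ### Rooted trivalent trees and triples of binary trees -/

namespace RootedTree

theorem hasShape_iff (R : RootedTree) (a b c : BinTree) :
    R.HasShape a b c ↔ R.Internal R.root ∧ R.IsBranch R.root R.first.1 a ∧
      R.IsBranch R.root (R.succ R.root R.first.1) b ∧
      R.IsBranch R.root (R.succ R.root (R.succ R.root R.first.1)) c := by
  simp only [HasShape, PlaneTree.next_val_eq_succ]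

theorem adj_first (R : RootedTree) : R.graph.Adj R.root R.first.1 := R.first.2

/-- The rightmost child is followed by the leftmost one. Seen from the rightmost child as parent,
the root therefore carries the first two branches as its left and right subtree. -/
theorem hasShape_iff_dartPair (R : RootedTree) (a b c : BinTree) :
    R.HasShape a b c ↔
      R.DartPair (R.succ R.root (R.succ R.root R.first.1)) R.root (node a b, c) := by
  have h1 := PlaneTree.adj_succ (PlaneTree.adj_succ R.adj_first)
  rw [hasShape_iff, PlaneTree.DartPair]
  simp only [PlaneTree.isBranch_node_iff]
  constructor
  · rintro ⟨h, ha, hb, hc⟩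
    refine ⟨⟨h1, h, ?_, ?_⟩, hc⟩
    · rwa [h.succ_succ_succ R.adj_first]
    · rwa [h.succ_succ_succ R.adj_first]
  · rintro ⟨⟨-, h, ha, hb⟩, hc⟩
    rw [h.succ_succ_succ R.adj_first] at ha hb
    exact ⟨h, ha, hb, hc⟩

theorem exists_hasShape (R : RootedTree) (h : R.Internal R.root) :
    ∃ a b c, R.HasShape a b c := by
  obtain ⟨a, ha⟩ := PlaneTree.exists_isBranch R.adj_first.symm
  obtain ⟨b, hb⟩ := PlaneTree.exists_isBranch (PlaneTree.adj_succ R.adj_first).symm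
  obtain ⟨c, hc⟩ := PlaneTree.exists_isBranch
    (PlaneTree.adj_succ (PlaneTree.adj_succ R.adj_first)).symm
  exact ⟨a, b, c, (R.hasShape_iff a b c).2 ⟨h, ha, hb, hc⟩⟩

theorem HasShape.numInternal_eq {R : RootedTree} {a b c : BinTree} (h : R.HasShape a b c) :
    R.numInternal = a.size + b.size + c.size + 1 := by
  rw [((R.hasShape_iff_dartPair a b c).1 h).numInternal_eq]
  simp; ring

theorem IsIso.hasShape {R R' : RootedTree} {e : R.graph ≃g R'.graph} (he : R.IsIso R' e)
    {a b c : BinTree} (h : R.HasShape a b c) : R'.HasShape a b c := by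
  obtain ⟨h0, h1, h2⟩ := he
  rw [hasShape_iff] at h ⊢
  obtain ⟨hi, ha, hb, hc⟩ := h
  have s1 := h0.succ R.adj_first
  have s2 := h0.succ (PlaneTree.adj_succ R.adj_first)
  rw [h1, h2] at s1
  rw [h1, s1] at s2
  have hi' := (PlaneTree.ncard_neighborSet_iso e R.root).trans hi
  rw [h1] at hi'
  have ha' := h0.isBranch ha
  have hb' := h0.isBranch hb
  have hc' := h0.isBranch hc
  rw [h1, h2] at ha'
  rw [h1, s1] at hb'
  rw [h1, s2] at hc'
  exact ⟨hi', ha', hb', hc'⟩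

theorem HasShape.exists_isIso {R R' : RootedTree} {a b c : BinTree} (h : R.HasShape a b c)
    (h' : R'.HasShape a b c) : ∃ e, R.IsIso R' e := by
  have hi := h.1
  have hi' := h'.1
  rw [hasShape_iff_dartPair] at h h'
  obtain ⟨e, he, h1, h2⟩ := h.exists_iso h'
  refine ⟨e, he, h2, ?_⟩
  have := he.succ h.1.adj
  rw [h1, h2, hi.succ_succ_succ R.adj_first, hi'.succ_succ_succ R'.adj_first] at this
  exact this

theorem HasShape.unique {R : RootedTree} {a b c a' b' c' : BinTree} (h : R.HasShape a b c)
    (h' : R.HasShape a' b' c') : a = a' ∧ b = b' ∧ c = c' := by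
  rw [hasShape_iff] at h h'
  exact ⟨h.2.1.unique h'.2.1, h.2.2.1.unique h'.2.2.1, h.2.2.2.unique h'.2.2.2⟩

end RootedTree

/-- The three branches at the root after a rotation. -/
def rotTriple : BinTree × BinTree × BinTree → BinTree × BinTree × BinTree
  | (leaf, b, c) => (b, c, leaf)
  | (node s t, b, c) => (s, t, node b c)

/-- The rotation of the words `(1,u,0,v,1,w,0)`, given by the Dyck words `u`, `v`, `w`. -/
def rhoTriple : BinTree × BinTree × BinTree → BinTree × BinTree × BinTree
  | (leaf, v, w) => (v.shift, w, leaf)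
  | (node a b, v, w) => (a, b, v.shift.snoc w)

/-- The branches of the tree `τ(1,u,0,v,1,w,0)`. -/
def tauTriple (t : BinTree × BinTree × BinTree) : BinTree × BinTree × BinTree :=
  (t.1.ell, t.2.1.ar, t.2.2.ar)

/-- The compatibility of ρ with rotation. It reduces to ℓ(`v.shift`) = r(v) and r(`v.shift.snoc w`)
= node r(v) r(w). -/
theorem tauTriple_rhoTriple (t : BinTree × BinTree × BinTree) :
    tauTriple (rhoTriple t) = rotTriple (tauTriple t) := by
  obtain ⟨_ | ⟨a, b⟩, v, w⟩ := t <;> simp [tauTriple, rhoTriple, rotTriple, BinTree.ar]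

/-- Left-rotation acts on the branches at the root by `rotTriple`. -/
theorem RootedTree.HasShape.exists_rotatesTo {R : RootedTree} {a b c : BinTree}
    (h : R.HasShape a b c) : ∃ R' : RootedTree, R.RotatesTo R' ∧
      R'.numInternal = R.numInternal ∧
      R'.HasShape (rotTriple (a, b, c)).1 (rotTriple (a, b, c)).2.1
        (rotTriple (a, b, c)).2.2 := by
  have hs := (R.hasShape_iff a b c).1 h
  have e1 : (R.leftRotate.first.1 : R.V) = R.succ R.first.1 R.root :=
    PlaneTree.next_eq_succ R.adj_first.symm
  cases a with
  | node s t =>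
    obtain ⟨h0, h1, h2, h3⟩ := PlaneTree.isBranch_node_iff.1 hs.2.1
    have hsh : R.leftRotate.HasShape s t (node b c) := by
      rw [hasShape_iff]
      change R.Internal R.first.1 ∧ R.IsBranch R.first.1 (R.leftRotate.first.1 : R.V) s ∧
        R.IsBranch R.first.1 (R.succ R.first.1 (R.leftRotate.first.1 : R.V)) t ∧
        R.IsBranch R.first.1 (R.succ R.first.1 (R.succ R.first.1 (R.leftRotate.first.1 : R.V)))
          (node b c)
      rw [e1, h1.succ_succ_succ h0]
      exact ⟨h1, h2, h3, PlaneTree.isBranch_node_iff.2 ⟨R.adj_first, hs.1, hs.2.2.1, hs.2.2.2⟩⟩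
    exact ⟨R.leftRotate, ⟨1, le_rfl, rfl, hsh.1, fun j h1 h2 => absurd h1 (by omega)⟩, rfl, hsh⟩
  | leaf =>
    obtain ⟨h0, h1⟩ := PlaneTree.isBranch_leaf_iff.1 hs.2.1
    -- At a leaf the only neighbour follows itself, so the second move returns to the old root, with
    -- the former middle child now leftmost.
    rw [PlaneTree.succ_of_ncard_eq_one h0 h1] at e1
    have e2 : (R.leftRotate.leftRotate.root : R.V) = R.root := e1
    have e3 : (R.leftRotate.leftRotate.first.1 : R.V) = R.succ R.root R.first.1 := by
      have := PlaneTree.next_eq_succ R.leftRotate.adj_first.symm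
      refine Eq.trans this ?_
      change R.succ (R.leftRotate.first.1 : R.V) R.first.1 = _
      rw [e1]
    have hsh : R.leftRotate.leftRotate.HasShape b c leaf := by
      rw [hasShape_iff]
      change R.Internal (R.leftRotate.leftRotate.root : R.V) ∧
        R.IsBranch (R.leftRotate.leftRotate.root : R.V)
          (R.leftRotate.leftRotate.first.1 : R.V) b ∧
        R.IsBranch (R.leftRotate.leftRotate.root : R.V)
          (R.succ (R.leftRotate.leftRotate.root : R.V)
            (R.leftRotate.leftRotate.first.1 : R.V)) c ∧
        R.IsBranch (R.leftRotate.leftRotate.root : R.V)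
          (R.succ (R.leftRotate.leftRotate.root : R.V)
            (R.succ (R.leftRotate.leftRotate.root : R.V)
              (R.leftRotate.leftRotate.first.1 : R.V))) leaf
      rw [e3, e2, hs.1.succ_succ_succ R.adj_first]
      exact ⟨hs.1, hs.2.2.1, hs.2.2.2, hs.2.1⟩
    refine ⟨R.leftRotate.leftRotate, ⟨2, by norm_num, rfl, hsh.1, fun j hj hj' => ?_⟩, rfl, hsh⟩
    obtain rfl : j = 1 := by omega
    intro hi
    have hi' : (R.graph.neighborSet R.first.1).ncard = 3 := hi
    omega

/-- Triples of binary trees with `n - 1` inner nodes in total. -/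
abbrev Triple (n : ℕ) : Type :=
  {t : BinTree × BinTree × BinTree // t.1.size + t.2.1.size + t.2.2.size + 1 = n}

theorem size_rotTriple (t : BinTree × BinTree × BinTree) :
    (rotTriple t).1.size + (rotTriple t).2.1.size + (rotTriple t).2.2.size =
      t.1.size + t.2.1.size + t.2.2.size := by
  obtain ⟨_ | ⟨a, b⟩, v, w⟩ := t <;> (simp [rotTriple]; try omega)

theorem size_tauTriple (t : BinTree × BinTree × BinTree) :
    (tauTriple t).1.size + (tauTriple t).2.1.size + (tauTriple t).2.2.size =
      t.1.size + t.2.1.size + t.2.2.size := by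
  simp [tauTriple, BinTree.size_ell]

theorem rotTriple_bijective : Function.Bijective rotTriple := by
  constructor
  · rintro ⟨_ | ⟨a, b⟩, v, w⟩ ⟨_ | ⟨a', b'⟩, v', w'⟩ h <;> simp_all [rotTriple]
  · rintro ⟨a, b, _ | ⟨c, d⟩⟩
    · exact ⟨(leaf, a, b), rfl⟩
    · exact ⟨(node a b, c, d), rfl⟩

theorem tauTriple_bijective : Function.Bijective tauTriple := by
  constructor
  · rintro ⟨u, v, w⟩ ⟨u', v', w'⟩ h
    simp only [tauTriple, Prod.mk.injEq] at h
    rw [BinTree.ell_injective h.1, BinTree.ar_injective h.2.1, BinTree.ar_injective h.2.2]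
  · rintro ⟨a, b, c⟩
    obtain ⟨u, rfl⟩ := BinTree.ell_surjective a
    obtain ⟨v, rfl⟩ := BinTree.ar_surjective b
    obtain ⟨w, rfl⟩ := BinTree.ar_surjective c
    exact ⟨(u, v, w), rfl⟩

/-- The rotation as a permutation of triples. -/
noncomputable def rotEquiv (n : ℕ) : Equiv.Perm (Triple n) :=
  (Equiv.ofBijective _ rotTriple_bijective).subtypeEquiv fun t => by
    rw [Equiv.ofBijective_apply, size_rotTriple]

/-- The map `tauTriple` as a permutation of triples. -/
noncomputable def tauEquiv (n : ℕ) : Equiv.Perm (Triple n) :=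
  (Equiv.ofBijective _ tauTriple_bijective).subtypeEquiv fun t => by
    rw [Equiv.ofBijective_apply, size_tauTriple]

theorem rotEquiv_val {n : ℕ} (t : Triple n) : (rotEquiv n t).1 = rotTriple t.1 := rfl
theorem tauEquiv_val {n : ℕ} (t : Triple n) : (tauEquiv n t).1 = tauTriple t.1 := rfl

/-- `R` has the branches `t` at its root. -/
def HasTriple {n : ℕ} (R : InternallyRooted n) (t : BinTree × BinTree × BinTree) : Prop :=
  R.1.HasShape t.1 t.2.1 t.2.2

/-- Join the roots of `node a b` and `c`, and take the root of `node a b` as the root of the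
trivalent tree. -/
theorem exists_hasTriple {n : ℕ} (t : Triple n) : ∃ R : InternallyRooted n, HasTriple R t.1 := by
  obtain ⟨⟨a, b, c⟩, ht⟩ := t
  have hk : PairPos.kids (Sum.inl .root : PairPos (node a b) c) =
      some (Sum.inl (.left .root), Sum.inl (.right .root)) := rfl
  have hadj : (PairPos.graph (node a b) c).Adj (Sum.inl .root) (Sum.inl (.left .root)) :=
    (PairPos.adj_iff_of_node hk).2 (by simp)
  have hadj' : (PairPos.graph (node a b) c).Adj (Sum.inl .root) (Sum.inl (.right .root)) :=
    (PairPos.adj_iff_of_node hk).2 (by simp)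
  let R : RootedTree :=
    { toPlaneTree := pairTree (node a b) c
      root := (Sum.inl .root : PairPos (node a b) c)
      first := ⟨(Sum.inl (.left .root) : PairPos (node a b) c), hadj⟩ }
  have hR : R.HasShape a b c := by
    rw [RootedTree.hasShape_iff_dartPair]
    have h1 := PairPos.dartPair_pairTree (node a b) c
    have ht := PairPos.turn_of_node hk
    have e : R.succ R.root (R.succ R.root R.first.1) =
        (Sum.inr .root : PairPos (node a b) c) := by
      change (pairTree (node a b) c).succ (Sum.inl .root : PairPos (node a b) c)
        ((pairTree (node a b) c).succ (Sum.inl .root : PairPos (node a b) c)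
          (Sum.inl (.left .root) : PairPos (node a b) c)) = _
      rw [PairPos.succ_eq hadj, ht.2.1, PairPos.succ_eq hadj', ht.2.2]
      rfl
    rw [e]
    exact h1
  exact ⟨⟨R, hR.1, by rw [hR.numInternal_eq, ← ht]⟩, hR⟩

/-- Triples of binary trees as rooted trivalent trees. -/
noncomputable def shapeEquiv (n : ℕ) : Triple n ≃ RootedTrivalent n :=
  Equiv.ofBijective (fun t => Quotient.mk _ (exists_hasTriple t).choose) (by
    constructor
    · intro t t' h
      obtain ⟨e, he⟩ := Quotient.exact h
      have h1 : HasTriple _ _ := he.hasShape (exists_hasTriple t).choose_spec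
      have := RootedTree.HasShape.unique h1 (exists_hasTriple t').choose_spec
      exact Subtype.ext (Prod.ext this.1 (Prod.ext this.2.1 this.2.2))
    · intro q
      induction q using Quotient.inductionOn with
      | _ R =>
        obtain ⟨a, b, c, h⟩ := R.1.exists_hasShape R.2.1
        refine ⟨⟨(a, b, c), by rw [← h.numInternal_eq]; exact R.2.2⟩, Quotient.sound ?_⟩
        exact RootedTree.HasShape.exists_isIso (exists_hasTriple _).choose_spec h)

theorem shapeEquiv_eq_iff {n : ℕ} (t : Triple n) (R : InternallyRooted n) :
    shapeEquiv n t = Quotient.mk _ R ↔ HasTriple R t.1 := by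
  constructor
  · intro h
    obtain ⟨e, he⟩ := Quotient.exact h
    exact he.hasShape (exists_hasTriple t).choose_spec
  · intro h
    exact Quotient.sound
      (RootedTree.HasShape.exists_isIso (exists_hasTriple t).choose_spec h)

/-! ### The words in `𝒯` -/

/-- The word `(1,u,0,v,1,w,0)`. -/
def tripleWord (t : BinTree × BinTree × BinTree) : List Bool :=
  upper (base (node t.1 t.2.1)) t.2.2 ++ [false]

theorem tripleWord_injective : Function.Injective tripleWord := by
  rintro ⟨u, v, w⟩ ⟨u', v', w'⟩ h
  have := Bridge.upper_inj.1 (List.append_cancel_right h)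
  simp at this
  simp [this]

/-- The words in `𝒯` correspond to triples of Dyck words. -/
noncomputable def wordEquiv (n : ℕ) : Triple n ≃ DyckTree n :=
  Equiv.ofBijective (fun t => ⟨tripleWord t.1, upper (base (node t.1.1 t.1.2.1)) t.1.2.2, by
    rw [mem_dyckZero_iff (by simp), Bridge.length_upper]
    refine ⟨?_, by ring, _, _, _, rfl⟩
    have := t.2
    simp; omega, rfl⟩) (by
    constructor
    · intro t t' h
      exact Subtype.ext (tripleWord_injective (Subtype.ext_iff.1 h))
    · rintro ⟨x, y, hy, rfl⟩
      have hh : height y = 1 := by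
        have := (mem_levelSet_iff.1 hy.1.1).2
        push_cast at this; omega
      obtain ⟨hl, -, u, v, w, rfl⟩ := (mem_dyckZero_iff hh).1 hy
      refine ⟨⟨(u, v, w), ?_⟩, rfl⟩
      simp at hl ⊢
      omega)

theorem wordEquiv_val {n : ℕ} (t : Triple n) : (wordEquiv n t).1 = tripleWord t.1 := rfl

/-- The four rules are the cases u empty or not and v empty or not. Splitting v = (c,1,d,0) at its
last component turns each pair of rules into one formula with `v.shift`. -/
theorem rho_iff (x y : List Bool) : Rho x y ↔ ∃ t, x = tripleWord t ∧ y = tripleWord (rhoTriple t) := by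
  constructor
  · rintro (⟨hu, hne, h₃⟩ | ⟨hu, hne, h₁, h₂, h₃⟩ | ⟨h₃⟩ | ⟨h₁, h₂, h₃⟩)
    · obtain ⟨u, rfl⟩ := mem_dyckWords_iff.1 hu
      obtain ⟨w, rfl⟩ := mem_dyckWords_iff.1 h₃
      cases u with
      | leaf => simp at hne
      | node a b =>
        exact ⟨(node a b, leaf, w), by simp [tripleWord, upper],
          by simp [tripleWord, upper, rhoTriple]⟩
    · obtain ⟨u, rfl⟩ := mem_dyckWords_iff.1 hu
      obtain ⟨c, rfl⟩ := mem_dyckWords_iff.1 h₁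
      obtain ⟨d, rfl⟩ := mem_dyckWords_iff.1 h₂
      obtain ⟨w, rfl⟩ := mem_dyckWords_iff.1 h₃
      cases u with
      | leaf => simp at hne
      | node a b =>
        exact ⟨(node a b, c.snoc d, w), by simp [tripleWord, upper],
          by simp [tripleWord, upper, rhoTriple]⟩
    · obtain ⟨w, rfl⟩ := mem_dyckWords_iff.1 h₃
      exact ⟨(leaf, leaf, w), by simp [tripleWord, upper], by simp [tripleWord, upper, rhoTriple]⟩
    · obtain ⟨c, rfl⟩ := mem_dyckWords_iff.1 h₁
      obtain ⟨d, rfl⟩ := mem_dyckWords_iff.1 h₂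
      obtain ⟨w, rfl⟩ := mem_dyckWords_iff.1 h₃
      exact ⟨(leaf, c.snoc d, w), by simp [tripleWord, upper],
        by simp [tripleWord, upper, rhoTriple]⟩
  · rintro ⟨⟨u, v, w⟩, rfl, rfl⟩
    rcases u with _ | ⟨a, b⟩ <;> rcases v.eq_leaf_or_snoc with rfl | ⟨c, d, rfl⟩
    · simpa [tripleWord, upper, rhoTriple] using Rho.light₁ w.word_mem_dyckWords
    · simpa [tripleWord, upper, rhoTriple] using Rho.light₂ c.word_mem_dyckWords
        d.word_mem_dyckWords w.word_mem_dyckWords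
    · simpa [tripleWord, upper, rhoTriple] using Rho.heavy₁ (node a b).word_mem_dyckWords
        (by simp) w.word_mem_dyckWords
    · simpa [tripleWord, upper, rhoTriple] using Rho.heavy₂ (node a b).word_mem_dyckWords
        (by simp) c.word_mem_dyckWords d.word_mem_dyckWords w.word_mem_dyckWords

mutual

theorem IsEll.exists_eq {x : List Bool} {t : BinTree} :
    IsEll x t → ∃ u : BinTree, x = u.word ∧ t = u.ell
  | .nil => ⟨leaf, by simp⟩
  | .node hu hv ha hb => by
    obtain ⟨u, rfl, rfl⟩ := ha.exists_eq
    obtain ⟨v, rfl, rfl⟩ := hb.exists_eq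
    exact ⟨node u v, by simp⟩

theorem IsAr.exists_eq {x : List Bool} {t : BinTree} :
    IsAr x t → ∃ u : BinTree, x = u.word ∧ t = u.ar
  | .nil => ⟨leaf, by simp⟩
  | .node hu hv ha hb => by
    obtain ⟨u, rfl, rfl⟩ := ha.exists_eq
    obtain ⟨v, rfl, rfl⟩ := hb.exists_eq
    exact ⟨u.snoc v, by simp⟩

end

theorem isEll_isAr_word (t : BinTree) : IsEll t.word t.ell ∧ IsAr t.word t.ar := by
  induction h : t.size using Nat.strong_induction_on generalizing t with
  | _ k ih =>
    constructor
    · cases t with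
      | leaf => simpa using IsEll.nil
      | node u v =>
        simp at h
        simpa using IsEll.node u.word_mem_dyckWords v.word_mem_dyckWords
          (ih _ (by omega) u rfl).1 (ih _ (by omega) v rfl).2
    · rcases t.eq_leaf_or_snoc with rfl | ⟨u, v, rfl⟩
      · simpa using IsAr.nil
      · simp at h
        simpa using IsAr.node u.word_mem_dyckWords v.word_mem_dyckWords
          (ih _ (by omega) u rfl).1 (ih _ (by omega) v rfl).2

theorem isTau_tripleWord_iff (t : BinTree × BinTree × BinTree) (R : RootedTree) :
    IsTau (tripleWord t) R ↔
      R.HasShape (tauTriple t).1 (tauTriple t).2.1 (tauTriple t).2.2 := by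
  constructor
  · rintro ⟨u, v, w, a, b, c, -, -, -, hx, ha, hb, hc, h⟩
    obtain ⟨u, rfl, rfl⟩ := ha.exists_eq
    obtain ⟨v, rfl, rfl⟩ := hb.exists_eq
    obtain ⟨w, rfl, rfl⟩ := hc.exists_eq
    have : t = (u, v, w) := tripleWord_injective (by rw [hx]; simp [tripleWord, upper])
    rw [this]
    exact h
  · intro h
    obtain ⟨u, v, w⟩ := t
    exact ⟨u.word, v.word, w.word, _, _, _, u.word_mem_dyckWords, v.word_mem_dyckWords,
      w.word_mem_dyckWords, by simp [tripleWord, upper], (isEll_isAr_word u).1,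
      (isEll_isAr_word v).2, (isEll_isAr_word w).2, h⟩

/-! ### The bijection between cycles and plane trivalent trees -/

/-- The vertex `(1,u,0,v,1,w)`. -/
def tripleVertex {n : ℕ} (t : Triple n) : MidVertex n :=
  ⟨upper (base (node t.1.1 t.1.2.1)) t.1.2.2, mid_of_height (by
    have := t.2
    rw [Bridge.length_upper]; simp; omega) (by simp)⟩

/-- The class of the pairs of branches at the edges of the tree of a triple. -/
def tripleClass (t : BinTree × BinTree × BinTree) : FaceClass :=
  faceClass (node (tauTriple t).1 (tauTriple t).2.1) (tauTriple t).2.2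

/-- The class is constant along edges, and conversely equal classes are connected by face steps
realized in the graph. -/
theorem reachable_tripleVertex_iff {n : ℕ} (hn : 1 ≤ n) (s t : Triple n) :
    (cycleFactor n).Reachable (tripleVertex s) (tripleVertex t) ↔
      tripleClass s.1 = tripleClass t.1 := by
  have hc : ∀ t : Triple n, HasClass (tripleVertex t).1 (tripleClass t.1) := by
    intro t
    have := HasClass.upper (base (node t.1.1 t.1.2.1)) t.1.2.2
    rw [Bridge.source_base, BinTree.ell_node] at this
    exact this
  constructor
  · intro h
    exact ((hasClass_iff_of_reachable hn h _).1 (hc s)).unique (hc t)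
  · intro h
    refine Joined.reachable (joined_of_faceClass_eq hn ?_ ?_)
    · simpa [tripleClass, tauTriple] using h
    · have := s.2
      simp; omega

theorem exists_reachable_tripleVertex {n : ℕ} (hn : 1 ≤ n) (x : MidVertex n) :
    ∃ t : Triple n, (cycleFactor n).Reachable x (tripleVertex t) := by
  obtain ⟨U, w, hs, h⟩ := x.exists_joined hn
  cases U with
  | node u v =>
    exact ⟨⟨(u, v, w), by simp at hs ⊢; omega⟩, Joined.reachable h⟩
  | leaf =>
    -- The vertex 1 w has no triple form, but one face step leads to (`w.shift`, 1), and `w.shift`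
    -- is non-empty since n ≥ 1.
    have h' := (joined_of_faceStep hn (U := leaf) (w := w) (U' := w.shift) (w' := leaf)
      (by simp [BinTree.ar]) hs)
    cases hw : w.shift with
    | leaf =>
      have := w.size_shift
      rw [hw] at this
      simp at this hs
      omega
    | node u v =>
      rw [hw] at h'
      refine ⟨⟨(u, v, leaf), ?_⟩, Joined.reachable (h.trans h'.2)⟩
      have := h'.1
      simp at this ⊢
      omega

/-- The cycle through the vertex `(1,u,0,v,1,w)`. -/
noncomputable def cycleOf {n : ℕ} (hn : 1 ≤ n) (t : Triple n) : CyclesOf (cycleFactor n) :=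
  (CyclesOf.exists_mem (ncard_neighborSet_cycleFactor hn) (tripleVertex t)).choose

theorem mem_cycleOf {n : ℕ} (hn : 1 ≤ n) (t : Triple n) :
    tripleVertex t ∈ (cycleOf hn t).1.verts :=
  (CyclesOf.exists_mem (ncard_neighborSet_cycleFactor hn) (tripleVertex t)).choose_spec

theorem cycleOf_eq {n : ℕ} (hn : 1 ≤ n) (t : Triple n) {S : CyclesOf (cycleFactor n)}
    (h : tripleVertex t ∈ S.1.verts) : cycleOf hn t = S :=
  CyclesOf.eq_of_mem (ncard_neighborSet_cycleFactor hn) (mem_cycleOf hn t) h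

theorem cycleOf_surjective {n : ℕ} (hn : 1 ≤ n) : Function.Surjective (cycleOf hn) := by
  intro S
  obtain ⟨v, w, -, hw⟩ := S.2
  have hv : v ∈ S.1.verts := by rw [← hw]; exact w.start_mem_verts_toSubgraph
  obtain ⟨t, ht⟩ := exists_reachable_tripleVertex hn v
  exact ⟨t, cycleOf_eq hn t (S.mem_of_reachable (ncard_neighborSet_cycleFactor hn) hv ht)⟩

theorem cycleOf_eq_iff {n : ℕ} (hn : 1 ≤ n) (s t : Triple n) :
    cycleOf hn s = cycleOf hn t ↔ tripleClass s.1 = tripleClass t.1 := by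
  rw [← reachable_tripleVertex_iff hn]
  constructor
  · intro h
    exact (cycleOf hn t).reachable (h ▸ mem_cycleOf hn s) (mem_cycleOf hn t)
  · intro h
    exact cycleOf_eq hn s (CyclesOf.mem_of_reachable (ncard_neighborSet_cycleFactor hn) _
      (mem_cycleOf hn t) h.symm)

/-- The plane trivalent tree of a triple of Dyck words. -/
noncomputable def planeOf {n : ℕ} (t : Triple n) : PlaneTrivalent n :=
  Quotient.mk _ (exists_hasTriple (tauEquiv n t)).choose.unroot

theorem planeOf_eq_iff {n : ℕ} {t : Triple n} {R : InternallyRooted n}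
    (h : HasTriple R (tauEquiv n t).1) (T : {T : PlaneTree // T.numInternal = n}) :
    planeOf t = Quotient.mk _ T ↔ ∃ e, R.unroot.1.IsIso T.1 e := by
  have h1 : (planeSetoid n).r (exists_hasTriple (tauEquiv n t)).choose.unroot R.unroot := by
    obtain ⟨e, he⟩ := RootedTree.HasShape.exists_isIso
      (exists_hasTriple (tauEquiv n t)).choose_spec h
    exact ⟨e, he.1⟩
  rw [planeOf, show (Quotient.mk (planeSetoid n) _) = Quotient.mk _ R.unroot from Quotient.sound h1]
  exact Quotient.eq

theorem planeOf_eq {n : ℕ} {t : Triple n} {R : InternallyRooted n}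
    (h : HasTriple R (tauEquiv n t).1) : planeOf t = Quotient.mk _ R.unroot :=
  (planeOf_eq_iff h _).2 ⟨_, PlaneTree.isIso_refl _⟩

theorem planeOf_surjective {n : ℕ} (hn : 1 ≤ n) :
    Function.Surjective (planeOf : Triple n → PlaneTrivalent n) := by
  intro q
  induction q using Quotient.inductionOn with
  | _ T =>
    obtain ⟨T, hT⟩ := T
    -- Since n ≥ 1, an internal vertex can be chosen as root, with any neighbour as leftmost child.
    have hne : {v | T.Internal v}.Nonempty := by
      apply Set.nonempty_of_ncard_ne_zero
      rw [PlaneTree.numInternal] at hT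
      omega
    obtain ⟨v, hv⟩ := hne
    have hne' : (T.graph.neighborSet v).Nonempty := by
      apply Set.nonempty_of_ncard_ne_zero
      have hv' : (T.graph.neighborSet v).ncard = 3 := hv
      omega
    obtain ⟨w, hw⟩ := hne'
    let R : InternallyRooted n := ⟨⟨T, v, ⟨w, hw⟩⟩, hv, hT⟩
    obtain ⟨t, ht⟩ := (shapeEquiv n).surjective (Quotient.mk _ R)
    obtain ⟨t, rfl⟩ := (tauEquiv n).surjective t
    exact ⟨t, planeOf_eq ((shapeEquiv_eq_iff _ _).1 ht)⟩

theorem planeOf_eq_planeOf_iff {n : ℕ} (s t : Triple n) :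
    planeOf s = planeOf t ↔ tripleClass s.1 = tripleClass t.1 := by
  obtain ⟨R, hR⟩ := exists_hasTriple (tauEquiv n s)
  obtain ⟨R', hR'⟩ := exists_hasTriple (tauEquiv n t)
  rw [planeOf_eq hR', planeOf_eq_iff hR]
  exact PlaneTree.exists_isIso_iff ((R.1.hasShape_iff_dartPair _ _ _).1 hR)
    ((R'.1.hasShape_iff_dartPair _ _ _).1 hR')

/-- The bijection between the cycles and the plane trivalent trees. -/
noncomputable def cyclesEquiv {n : ℕ} (hn : 1 ≤ n) :
    CyclesOf (cycleFactor n) ≃ PlaneTrivalent n :=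
  Equiv.ofBijective (fun S => planeOf (Function.surjInv (cycleOf_surjective hn) S)) (by
    constructor
    · intro S S' h
      have h' := (planeOf_eq_planeOf_iff _ _).1 h
      rw [← cycleOf_eq_iff hn, Function.surjInv_eq (cycleOf_surjective hn), Function.surjInv_eq (cycleOf_surjective hn)] at h'
      exact h'
    · intro q
      obtain ⟨t, rfl⟩ := planeOf_surjective hn q
      refine ⟨cycleOf hn t, ?_⟩
      change planeOf _ = _
      rw [planeOf_eq_planeOf_iff, ← cycleOf_eq_iff hn, Function.surjInv_eq (cycleOf_surjective hn)])

theorem cyclesEquiv_cycleOf {n : ℕ} (hn : 1 ≤ n) (t : Triple n) :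
    cyclesEquiv hn (cycleOf hn t) = planeOf t := by
  change planeOf _ = _
  rw [planeOf_eq_planeOf_iff, ← cycleOf_eq_iff hn, Function.surjInv_eq (cycleOf_surjective hn)]

/-- The rotation `ρ` on words. -/
noncomputable def rhoEquiv (n : ℕ) : Equiv.Perm (DyckTree n) :=
  (wordEquiv n).permCongr ((tauEquiv n).symm.permCongr (rotEquiv n))

theorem rhoEquiv_wordEquiv {n : ℕ} (t : Triple n) :
    (rhoEquiv n (wordEquiv n t)).1 = tripleWord (rhoTriple t.1) := by
  simp only [rhoEquiv, Equiv.permCongr_apply, Equiv.symm_apply_apply, Equiv.symm_symm]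
  rw [wordEquiv_val]
  congr 1
  apply tauTriple_bijective.1
  rw [tauTriple_rhoTriple, ← tauEquiv_val, Equiv.apply_symm_apply, rotEquiv_val, tauEquiv_val]

end FourLevels

theorem mainTheorem7 (n : ℕ) (hn : 1 ≤ n) :
    -- the graph is a cycle factor through the middle four levels
    IsCycleFactor (cycleFactor n) (midGraph n) ∧
    ∃ (Φ : CyclesOf (cycleFactor n) ≃ PlaneTrivalent n)
      (ρ : Equiv.Perm (DyckTree n)) (τ : DyckTree n ≃ RootedTrivalent n),
      -- `ρ` is the rotation map and `τ` is the explicit map from rooted trees to trivalent trees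
      (∀ x y : DyckTree n, ρ x = y ↔ Rho x.1 y.1) ∧
      (∀ (x : DyckTree n) (R : InternallyRooted n), τ x = Quotient.mk _ R ↔ IsTau x.1 R.1) ∧
      -- `τ` sends `ρ` to rotation of the root
      (∀ (x : DyckTree n) (R : InternallyRooted n), τ x = Quotient.mk _ R →
        ∃ R' : InternallyRooted n, R.1.RotatesTo R'.1 ∧ τ (ρ x) = Quotient.mk _ R') ∧
      -- a cycle through the vertex `x` with `(x,0) ∈ 𝒯_{n+1}` corresponds to `τ(x,0)`, unrooted
      (∀ (S : CyclesOf (cycleFactor n)) (x : MidVertex n) (x' : DyckTree n)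
        (R : InternallyRooted n), x ∈ S.1.verts → x'.1 = x.1 ++ [false] →
        τ x' = Quotient.mk _ R → Φ S = Quotient.mk _ R.unroot) := by
  have hτ : ∀ (t : Triple n) (R : InternallyRooted n),
      ((wordEquiv n).symm.trans ((tauEquiv n).trans (shapeEquiv n))) (wordEquiv n t) =
        Quotient.mk _ R ↔ HasTriple R (tauTriple t.1) := by
    intro t R
    simp only [Equiv.trans_apply, Equiv.symm_apply_apply]
    exact shapeEquiv_eq_iff _ _
  refine ⟨isCycleFactor_cycleFactor hn, cyclesEquiv hn, rhoEquiv n,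
    (wordEquiv n).symm.trans ((tauEquiv n).trans (shapeEquiv n)), ?_, ?_, ?_, ?_⟩
  · intro x y
    obtain ⟨t, rfl⟩ := (wordEquiv n).surjective x
    rw [Subtype.ext_iff, rhoEquiv_wordEquiv, rho_iff]
    constructor
    · exact fun h => ⟨t.1, rfl, h.symm⟩
    · rintro ⟨t', h1, h2⟩
      rw [h2, tripleWord_injective ((wordEquiv_val t).symm.trans h1)]
  · intro x R
    obtain ⟨t, rfl⟩ := (wordEquiv n).surjective x
    rw [hτ, wordEquiv_val, isTau_tripleWord_iff]
    rfl
  · intro x R h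
    obtain ⟨t, rfl⟩ := (wordEquiv n).surjective x
    obtain ⟨R', h1, h2, h3⟩ := RootedTree.HasShape.exists_rotatesTo ((hτ t R).1 h)
    refine ⟨⟨R', h3.1, h2.trans R.2.2⟩, h1, ?_⟩
    obtain ⟨t', ht'⟩ := (wordEquiv n).surjective (rhoEquiv n (wordEquiv n t))
    have hw := congrArg Subtype.val ht'
    rw [rhoEquiv_wordEquiv, wordEquiv_val] at hw
    rw [← ht', hτ, tripleWord_injective hw, tauTriple_rhoTriple]
    exact h3
  · intro S x x' R hx hx' h
    obtain ⟨t, rfl⟩ := (wordEquiv n).surjective x'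
    -- Removing the final downstep from the word of the triple leaves the vertex (1,u,0,v,1,w).
    have hxt : x = tripleVertex t := Subtype.ext (List.append_cancel_right hx').symm
    rw [hxt] at hx
    rw [← cycleOf_eq hn t hx, cyclesEquiv_cycleOf]
    exact planeOf_eq ((hτ t R).1 h)
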